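/- Let $q$ be a power of an odd prime $p$, $\mathbb{A}=\mathbb{F}_q[T]$, $k=\mathbb{F}_q(T)$, and let $\Omega$ be the completion of an algebraic closure of $k_\infty=\mathbb{F}_q((1/T))$. For $0\ne\varpi\in\Omega$ let $e(x)=x\prod_{0\neq u\in\varpi\mathbb{A}}(1-x/u)$, and let $\bar\pi$ be a period of the Carlitz module, i.e. a $\varpi\neq 0$ for which $e(Tx)=T\,e(x)+e(x)^q$ for all $x\in\Omega$; write $\mathbf{e}_C$ for the corresponding $e$. For $A\in k$ let $\{A\}$ be the representative of $A$ modulo $\mathbb{A}$ that is zero or of negative degree, let $\mathrm{sgn}$ denote the leading coefficient, and let $\sin(A)=\sqrt[q-1]{-1}\;\mathbf{e}_C(\bar\pi\{A\}/\mathrm{sgn}\{A\})$. Extend $\sin$ to a homomorphism from the free abelian group on the symbols $[A]$, $A\in k/\mathbb{A}$, to $\Omega^*$ by $\sin[A]=\sin(A)$ if $A\notin\mathbb{A}$ and $\sin[A]=1$ otherwise. Fix a generator $\gamma$ of $\mathbb{F}_q^*$. Let $M\in\mathbb{A}$ be monic, $S_M$ the set of its monic prime factors, and let $P\ne Q$ be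 in $S_M$, of degrees $d_P,d_Q$. Put $$\mathbf{a}_{PQ}=\sum_{\substack{A \text{ monic}\\ \deg A<d_Q}}\ \sum_{\substack{B\text{ monic}\\ \deg B<d_P}}\ \sum_{s=1}^{q-2}s\left(\left[\tfrac{BQ+\gamma^{-s}A}{PQ}\right]-\left[\tfrac{AP+\gamma^{-s}B}{PQ}\right]\right),\qquad u=\varepsilon_P\,\varepsilon_Q\,\sin\mathbf{a}_{PQ},$$ where $\varepsilon_P=\sqrt{P}$ if $d_Q$ is odd and $\varepsilon_P=1$ otherwise, and $\varepsilon_Q=\sqrt{Q}$ if $d_P$ is odd and $\varepsilon_Q=1$ otherwise. Let $K=k(\mathbf{e}_C(\bar\pi/M))$, $\widetilde K=K(\sqrt[q-1]{u})$, $G=\mathrm{Gal}(K/k)$ and $\widetilde G=\mathrm{Gal}(\widetilde K/k)$; all roots may be chosen arbitrarily. A lifting of $\sigma\in G$ is an element of $\widetilde G$ that restricts to $\sigma$ on $K$. Let $L\in S_M$, let $r$ be the exponent of $L$ in $M$, let $|L|=q^{\deg L}$, and let $(\mathbb{A}/L^r\mathbb{A})^{(1)}$ be the group of units of $\mathbb{A}/L^r\mathbb{A}$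 congruent to $1$ modulo $L$. Let $\sigma_L\in G$ correspond to a generator of the factor $(\mathbb{A}/L\mathbb{A})^*$ under $$G\cong(\mathbb{A}/M\mathbb{A})^*\cong(\mathbb{A}/L^r\mathbb{A})^{(1)}\times(\mathbb{A}/L\mathbb{A})^*\times(\mathbb{A}/(M/L^r)\mathbb{A})^*;$$ that is, $\sigma_L(\mathbf{e}_C(\bar\pi/M))=\mathbf{e}_C(\bar\pi a/M)$ for some $a\in\mathbb{A}$ with $a\equiv1$ modulo $M/L^r$, $a^{|L|-1}\equiv 1$ modulo $L^r$, and $a$ generating $(\mathbb{A}/L\mathbb{A})^*$. Let $\widetilde L$ be a prime of (the integral closure of $\mathbb{A}$ in) $\widetilde K$ above $L$, with inertia group $\widetilde I_L$ and first ramification group (lower numbering) $\widetilde G_1$ in $\widetilde K/k$. Let $\widetilde G_L$ be the group of all liftings of elements of $\langle\sigma_L\rangle$ that lie in $\widetilde I_L$, and let $e_L$ be the ramification index of $\widetilde L$ in $\widetilde K/K$. **Proposition 2.3.** We have $\widetilde G_1\cong(\mathbb{A}/L^r\mathbb{A})^{(1)}$; the group $\widetilde G_L$ is cyclic and generated by a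 lifting of $\sigma_L$; and $\widetilde I_L=\widetilde G_1\times\widetilde G_L$ (internal direct product). In particular, every lifting of $\sigma_L$ to $\widetilde K$ has order $e_L\cdot\mathrm{ord}(\sigma_L)$. -/

import Mathlib

open scoped Polynomial NNReal WithZero

noncomputable section

namespace QuasiCyclotomic

/-! ### The field `Ω`

`F` is the finite field `F_q`, `F[X]` is `𝔸 = F_q[T]` and `RatFunc F` is `k = F_q(T)`. -/

section Omega

variable (F : Type*) [Field F]

/-- The completion `k_∞ = F_q((1/T))` of `k = F_q(T)` at the place `1/T`. -/
def KInfty : Type _ :=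
  @RatFunc.CompletionAtInfty F _ (Classical.decEq _)

instance : Field (KInfty F) :=
  @RatFunc.CompletionAtInfty.instField F _ (Classical.decEq _)

instance : Algebra (RatFunc F) (KInfty F) :=
  @RatFunc.CompletionAtInfty.instAlgebra F _ (Classical.decEq _)

instance : Valued (KInfty F) ℤᵐ⁰ :=
  @RatFunc.CompletionAtInfty.instValuedWithZeroMultiplicativeInt F _ (Classical.decEq _)

instance : CompleteSpace (KInfty F) :=
  @UniformSpace.Completion.completeSpace (RatFunc F)
    (@RatFunc.inftyValued F _ (Classical.decEq _)).toUniformSpace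

/-- The valuation of `k_∞` restricts to the valuation of `k` at the place `1/T`. -/
theorem KInfty.valuation_algebraMap (f : RatFunc F) :
    Valued.v (algebraMap (RatFunc F) (KInfty F) f) =
      @RatFunc.inftyValuation F _ (Classical.decEq _) f :=
  letI := Classical.decEq (RatFunc F)
  @Valued.extensionValuation_apply_coe (RatFunc F) _ _ _ (RatFunc.inftyValued F) f

theorem KInfty.valuation_X :
    Valued.v (algebraMap (RatFunc F) (KInfty F) RatFunc.X) = WithZero.exp (1 : ℤ) := by
  rw [KInfty.valuation_algebraMap]
  exact @RatFunc.inftyValuation.X F _ (Classical.decEq _)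

variable [Fintype F]

theorem one_lt_card : (1 : ℝ≥0) < (Fintype.card F : ℝ≥0) := by
  exact_mod_cast Fintype.one_lt_card

/-- The real-valued absolute value of `k_∞`, normalized by `|T| = q`. -/
instance : Valuation.RankOne (Valued.v : Valuation (KInfty F) ℤᵐ⁰) where
  hom' := (WithZeroMulInt.toNNReal (one_lt_card F).ne_bot).comp
    MonoidWithZeroHom.ValueGroup₀.embedding
  strictMono' := (WithZeroMulInt.toNNReal_strictMono (one_lt_card F)).comp
    MonoidWithZeroHom.ValueGroup₀.embedding_strictMono
  exists_val_nontrivial := by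
    refine ⟨algebraMap (RatFunc F) (KInfty F) RatFunc.X, ?_⟩
    rw [KInfty.valuation_X]
    exact ⟨WithZero.exp_ne_zero, by simp⟩

instance : NontriviallyNormedField (KInfty F) where
  __ := Valued.toNormedField (KInfty F) ℤᵐ⁰
  non_trivial := by
    refine ⟨algebraMap (RatFunc F) (KInfty F) RatFunc.X, ?_⟩
    refine (Valued.toNormedField.one_lt_norm_iff (L := KInfty F) (Γ₀ := ℤᵐ⁰)).2 ?_
    rw [KInfty.valuation_X]
    exact WithZero.exp_lt_exp.2 zero_lt_one

instance : IsUltrametricDist (KInfty F) :=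
  (inferInstance : @IsUltrametricDist (KInfty F) (Valued.toNormedField (KInfty F) ℤᵐ⁰).toDist)

/-- An algebraic closure of `k_∞`. -/
def KInftyAlgClosure : Type _ := AlgebraicClosure (KInfty F)

instance : Field (KInftyAlgClosure F) :=
  inferInstanceAs (Field (AlgebraicClosure (KInfty F)))

instance : Algebra (KInfty F) (KInftyAlgClosure F) :=
  inferInstanceAs (Algebra (KInfty F) (AlgebraicClosure (KInfty F)))

instance : IsAlgClosure (KInfty F) (KInftyAlgClosure F) :=
  inferInstanceAs (IsAlgClosure (KInfty F) (AlgebraicClosure (KInfty F)))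

instance : Algebra.IsAlgebraic (KInfty F) (KInftyAlgClosure F) :=
  IsAlgClosure.isAlgebraic

/-- The unique absolute value of the algebraic closure that extends the one of `k_∞`. -/
instance : NormedField (KInftyAlgClosure F) :=
  spectralNorm.normedField (KInfty F) (KInftyAlgClosure F)

/-- The field `Ω`: the completion of the algebraic closure of `k_∞`. -/
def Omega : Type _ := UniformSpace.Completion (KInftyAlgClosure F)

instance : NormedField (Omega F) :=
  inferInstanceAs (NormedField (UniformSpace.Completion (KInftyAlgClosure F)))

instance : CompleteSpace (Omega F) :=
  inferInstanceAs (CompleteSpace (UniformSpace.Completion (KInftyAlgClosure F)))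

/-- The embedding `k → k_∞ → (algebraic closure of k_∞) → Ω`. -/
instance : Algebra (RatFunc F) (Omega F) :=
  (((UniformSpace.Completion.coeRingHom :
        KInftyAlgClosure F →+* UniformSpace.Completion (KInftyAlgClosure F)).comp
      (algebraMap (KInfty F) (KInftyAlgClosure F))).comp
    (algebraMap (RatFunc F) (KInfty F))).toAlgebra

instance : Algebra F[X] (Omega F) :=
  ((algebraMap (RatFunc F) (Omega F)).comp (algebraMap F[X] (RatFunc F))).toAlgebra

instance : IsScalarTower F[X] (RatFunc F) (Omega F) :=
  IsScalarTower.of_algebraMap_eq fun _ => rfl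

instance (K : IntermediateField (RatFunc F) (Omega F)) : IsScalarTower F[X] K (Omega F) :=
  IsScalarTower.of_algebraMap_eq fun _ => rfl

instance (K : IntermediateField (RatFunc F) (Omega F)) (E : IntermediateField K (Omega F)) :
    IsScalarTower F[X] (RatFunc F) E :=
  IsScalarTower.of_algebraMap_eq fun _ => rfl

end Omega

/-! ### The Carlitz module -/

section Carlitz

variable {F : Type*} [Field F] [Fintype F]

/-- The exponential function of the lattice `ϖ𝔸`:
`e(x) = x ∏_{0 ≠ u ∈ ϖ𝔸} (1 - x / u)`. -/
def latticeExp (ϖ x : Omega F) : Omega F :=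
  x * ∏' a : {a : F[X] // a ≠ 0}, (1 - x / (ϖ * algebraMap F[X] (Omega F) a.1))

/-- `ϖ` is a period of the Carlitz module: the rank one module corresponding to the lattice `ϖ𝔸`
is the Carlitz module `C_T(z) = T z + z ^ q`. -/
def IsCarlitzPeriod (ϖ : Omega F) : Prop :=
  ϖ ≠ 0 ∧ ∀ x : Omega F,
    latticeExp ϖ (algebraMap F[X] (Omega F) Polynomial.X * x) =
      algebraMap F[X] (Omega F) Polynomial.X * latticeExp ϖ x +
        latticeExp ϖ x ^ Fintype.card F

/-- The function `A ↦ e_C(ϖ A)` on `k`. -/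
def expAt (ϖ : Omega F) (A : RatFunc F) : Omega F :=
  latticeExp ϖ (ϖ * algebraMap (RatFunc F) (Omega F) A)

end Carlitz

/-! ### The sine function and its extension to divisors -/

section Sine

variable {F : Type*} [Field F]

/-- The representative `{A}` of `A ∈ k` modulo `𝔸` that is zero or has negative degree. -/
def fracPart (A : RatFunc F) : RatFunc F :=
  algebraMap F[X] (RatFunc F) (A.num % A.denom) / algebraMap F[X] (RatFunc F) A.denom

/-- The sign of `A ∈ k ⊆ F_q((1/T))`, its leading coefficient (`RatFunc.denom` is monic). -/
def sgn (A : RatFunc F) : F := A.num.leadingCoeff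

/-- The subgroup `𝔸` of `k`. -/
def polySubgroup (F : Type*) [Field F] : AddSubgroup (RatFunc F) :=
  (algebraMap F[X] (RatFunc F)).toAddMonoidHom.range

theorem fracPart_eq_of_sub_mem {A B : RatFunc F} (h : -A + B ∈ polySubgroup F) :
    fracPart A = fracPart B := by
  obtain ⟨p, hp⟩ := h
  have key (A : RatFunc F) :
      A = algebraMap F[X] (RatFunc F) (A.num / A.denom) + fracPart A := by
    have h0 : algebraMap F[X] (RatFunc F) A.denom ≠ 0 := by
      simpa using A.denom_ne_zero
    conv_lhs => rw [← RatFunc.num_div_denom A, ← EuclideanDomain.div_add_mod A.num A.denom]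
    rw [map_add, map_mul, add_div, mul_div_cancel_left₀ _ h0]
    rfl
  have hdeg (A : RatFunc F) : (A.num % A.denom).degree < A.denom.degree :=
    Polynomial.degree_mod_lt _ A.denom_ne_zero
  have hA := hdeg A
  have hB := hdeg B
  have hfA : fracPart A = algebraMap F[X] (RatFunc F) (A.num % A.denom) /
    algebraMap F[X] (RatFunc F) A.denom := rfl
  have hfB : fracPart B = algebraMap F[X] (RatFunc F) (B.num % B.denom) /
    algebraMap F[X] (RatFunc F) B.denom := rfl
  have hA0 : algebraMap F[X] (RatFunc F) A.denom ≠ 0 := by simpa using A.denom_ne_zero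
  have hB0 : algebraMap F[X] (RatFunc F) B.denom ≠ 0 := by simpa using B.denom_ne_zero
  have h1 : fracPart B - fracPart A =
      algebraMap F[X] (RatFunc F) (p + A.num / A.denom - B.num / B.denom) := by
    have hp' : algebraMap F[X] (RatFunc F) p = -A + B := hp
    have e1 := key A
    have e2 := key B
    rw [map_sub, map_add, hp']
    linear_combination e1 - e2
  generalize p + A.num / A.denom - B.num / B.denom = c at h1
  generalize A.num % A.denom = a at hA hfA
  generalize B.num % B.denom = b at hB hfB
  have h2 : b * A.denom - a * B.denom = c * (A.denom * B.denom) := by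
    apply RatFunc.algebraMap_injective F
    rw [hfA, hfB, div_sub_div _ _ hB0 hA0, div_eq_iff (mul_ne_zero hB0 hA0)] at h1
    simp only [map_sub, map_mul]
    linear_combination h1
  have hc0 : c = 0 := by
    by_contra hne
    have hlt : (b * A.denom - a * B.denom).degree < (A.denom * B.denom).degree := by
      refine lt_of_le_of_lt (Polynomial.degree_sub_le _ _) (max_lt ?_ ?_)
      · rw [mul_comm A.denom, Polynomial.degree_mul, Polynomial.degree_mul]
        exact WithBot.add_lt_add_right (by simpa using A.denom_ne_zero) hB
      · rw [Polynomial.degree_mul, Polynomial.degree_mul]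
        exact WithBot.add_lt_add_right (by simpa using B.denom_ne_zero) hA
    have hcdeg : (A.denom * B.denom).degree ≤ (c * (A.denom * B.denom)).degree := by
      rw [mul_comm c]
      exact Polynomial.degree_le_mul_left (A.denom * B.denom) hne
    rw [h2] at hlt
    exact absurd hlt (not_lt.2 hcdeg)
  rw [hc0, map_zero, sub_eq_zero] at h1
  exact h1.symm

variable [Fintype F]

/-- `sin(A) = ρ · e_C(ϖ {A} / sgn {A})`, where `ρ` is a `(q-1)`-th root of `-1`. -/
def sine (ϖ ρ : Omega F) (A : RatFunc F) : Omega F :=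
  ρ * expAt ϖ (fracPart A / RatFunc.C (sgn (fracPart A)))

/-- The sine function on `k / 𝔸`. -/
def sineClass (ϖ ρ : Omega F) : RatFunc F ⧸ polySubgroup F → Omega F :=
  Quotient.lift (sine ϖ ρ) fun A B h => by
    rw [← Quotient.eq_iff_equiv, QuotientAddGroup.eq] at h
    simp only [sine, fracPart_eq_of_sub_mem h]

/-- The free abelian group on the symbols `[A]`, `A ∈ k / 𝔸`. -/
abbrev Divisors (F : Type*) [Field F] : Type _ := (RatFunc F ⧸ polySubgroup F) →₀ ℤ

/-- The symbol `[A]`. -/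
def symb (A : RatFunc F) : Divisors F :=
  Finsupp.single (QuotientAddGroup.mk A) 1

open scoped Classical in
/-- The homomorphism `sin` from the free abelian group on `k / 𝔸` to `Ω^*`, with
`sin [A] = sin(A)` if `A ∉ 𝔸` and `sin [A] = 1` otherwise. -/
def sineHom (ϖ ρ : Omega F) (a : Divisors F) : Omega F :=
  a.prod fun c n => (if c = 0 then 1 else sineClass ϖ ρ c) ^ n

end Sine

/-! ### The element `u_{PQ}` -/

section Kummer

variable {F : Type*} [Field F] [Fintype F]

theorem finite_monic_lt (F : Type*) [Field F] [Fintype F] (d : ℕ) :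
    {A : F[X] | A.Monic ∧ A.natDegree < d}.Finite := by
  have : Finite (Polynomial.degreeLT F d) :=
    Finite.of_equiv _ (Polynomial.degreeLTEquiv F d).toEquiv.symm
  refine (Set.toFinite (Polynomial.degreeLT F d : Set F[X])).subset ?_
  rintro A ⟨hA, hd⟩
  rw [SetLike.mem_coe, Polynomial.mem_degreeLT, Polynomial.degree_eq_natDegree hA.ne_zero]
  exact_mod_cast hd

/-- The monic polynomials of degree less than `d`. -/
def monicsLT (F : Type*) [Field F] [Fintype F] (d : ℕ) : Finset F[X] :=
  (finite_monic_lt F d).toFinset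

/-- The quotient of two polynomials, in `k`. -/
def frac (A B : F[X]) : RatFunc F :=
  algebraMap F[X] (RatFunc F) A / algebraMap F[X] (RatFunc F) B

/-- The divisor `a_{PQ}`. -/
def aPQ (γ : Fˣ) (P Q : F[X]) : Divisors F :=
  ∑ A ∈ monicsLT F Q.natDegree, ∑ B ∈ monicsLT F P.natDegree,
    ∑ s ∈ Finset.Icc 1 (Fintype.card F - 2),
      (s : ℤ) • (symb (frac (B * Q + Polynomial.C ((γ ^ s)⁻¹ : Fˣ).1 * A) (P * Q)) -
        symb (frac (A * P + Polynomial.C ((γ ^ s)⁻¹ : Fˣ).1 * B) (P * Q)))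

/-- The element `u_{PQ}`; here `sP` and `sQ` are square roots of `P` and `Q` in `Ω`. -/
def uPQ (ϖ ρ : Omega F) (γ : Fˣ) (P Q : F[X]) (sP sQ : Omega F) : Omega F :=
  (if Odd Q.natDegree then sP else 1) * (if Odd P.natDegree then sQ else 1) *
    sineHom ϖ ρ (aPQ γ P Q)

/-- The cyclotomic function field `K = k(e_C(ϖ / M))` of conductor `M`. -/
abbrev cyclotomicField (ϖ : Omega F) (M : F[X]) : IntermediateField (RatFunc F) (Omega F) :=
  IntermediateField.adjoin (RatFunc F) {expAt ϖ (frac 1 M)}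

/-- The extension `K(y)` of the cyclotomic function field `K`. -/
abbrev kummerField (ϖ : Omega F) (M : F[X]) (y : Omega F) :
    IntermediateField (cyclotomicField ϖ M) (Omega F) :=
  IntermediateField.adjoin (cyclotomicField ϖ M) {y}

/-- The monic prime factors of `M`. -/
def monicPrimeFactors (M : F[X]) : Set F[X] := {P | P.Monic ∧ Irreducible P ∧ P ∣ M}

/-- Let `M = L ^ r N` with `L` prime to `N`. The automorphism `σ` of `K` corresponds, under
`Gal(K/k) ≅ (𝔸/M)^* ≅ (𝔸/L^r)^* × (𝔸/N)^* ≅ (𝔸/L^r)^{(1)} × (𝔸/L)^* × (𝔸/N)^*`,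
to a generator of the factor `(𝔸/L)^*`. The class of `a` is the automorphism that maps
`e_C(ϖ / M)` to `C_a(e_C(ϖ / M)) = e_C(ϖ a / M)`; the factor `(𝔸/L)^*` of `(𝔸/L^r)^*` consists of
the elements whose order divides `|L| - 1`. -/
def IsSigma (ϖ : Omega F) (M L : F[X]) (r : ℕ)
    (σ : Gal(cyclotomicField ϖ M/RatFunc F)) : Prop :=
  ∃ a N : F[X], M = L ^ r * N ∧
    (σ ⟨expAt ϖ (frac 1 M), IntermediateField.mem_adjoin_simple_self _ _⟩ : Omega F) =
      expAt ϖ (frac a M) ∧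
    N ∣ a - 1 ∧
    L ^ r ∣ a ^ (Fintype.card F ^ L.natDegree - 1) - 1 ∧
    ∀ b : F[X], ¬ L ∣ b → ∃ n : ℕ, L ∣ b - a ^ n

/-- The group `(𝔸/L^r)^{(1)}` of the units of `𝔸/L^r` that are congruent to `1` modulo `L`. -/
def oneUnits (L : F[X]) (r : ℕ) : Subgroup (F[X] ⧸ Ideal.span {L ^ r})ˣ :=
  (Units.map (Ideal.Quotient.mk
    (Ideal.span {Ideal.Quotient.mk (Ideal.span {L ^ r}) L})).toMonoidHom).ker

end Kummer

/-! ### Galois groups, inertia and ramification -/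

section Ramification

variable (R k K E : Type*) [CommRing R] [Field k] [Field K] [Field E]
  [Algebra k K] [Algebra k E] [Algebra K E]
  [Algebra R k] [Algebra R K] [Algebra R E]
  [IsScalarTower R k E] [IsScalarTower R K E]

variable {k K E} in
/-- `τ ∈ Gal(E/k)` is a lifting of `σ ∈ Gal(K/k)`. -/
def IsLifting (σ : Gal(K/k)) (τ : Gal(E/k)) : Prop :=
  ∀ x : K, τ (algebraMap K E x) = algebraMap K E (σ x)

variable {k K} in
/-- The subgroup of `Gal(E/k)` of all liftings of the elements of a subgroup of `Gal(K/k)`. -/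
def liftings (H : Subgroup Gal(K/k)) : Subgroup Gal(E/k) where
  carrier := {τ | ∃ σ ∈ H, IsLifting σ τ}
  one_mem' := ⟨1, H.one_mem, fun _ => rfl⟩
  mul_mem' := by
    rintro τ₁ τ₂ ⟨σ₁, h₁, l₁⟩ ⟨σ₂, h₂, l₂⟩
    refine ⟨σ₁ * σ₂, H.mul_mem h₁ h₂, fun x => ?_⟩
    rw [AlgEquiv.mul_apply, l₂ x, l₁ (σ₂ x), AlgEquiv.mul_apply]
  inv_mem' := by
    rintro τ ⟨σ, h, l⟩
    refine ⟨σ⁻¹, H.inv_mem h, fun x => ?_⟩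
    apply τ.injective
    rw [l, ← AlgEquiv.mul_apply, ← AlgEquiv.mul_apply]
    simp

/-- The action of `Gal(E/k)` on the integral closure of `R` in `E`. -/
def galIntegralClosure : Gal(E/k) →* (integralClosure R E ≃ₐ[R] integralClosure R E) where
  toFun τ := (τ.restrictScalars R).mapIntegralClosure
  map_one' := rfl
  map_mul' _ _ := rfl

variable {R E}

/-- The inertia group of a prime `𝔓` of `E`:
all `τ` with `τ x ≡ x` modulo `𝔓` for every integral `x`. -/
def inertiaGroup (𝔓 : Ideal (integralClosure R E)) : Subgroup Gal(E/k) :=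
  (𝔓.inertia (integralClosure R E ≃ₐ[R] integralClosure R E)).comap (galIntegralClosure R k E)

/-- The `i`-th ramification group (in the lower numbering, `i ≥ 0`) of a prime `𝔓` of `E`:
all `τ` with `τ x ≡ x` modulo `𝔓 ^ (i + 1)` for every integral `x`. -/
def ramificationGroup (𝔓 : Ideal (integralClosure R E)) (i : ℕ) : Subgroup Gal(E/k) :=
  ((𝔓 ^ (i + 1)).inertia (integralClosure R E ≃ₐ[R] integralClosure R E)).comap
    (galIntegralClosure R k E)

variable {k K} in
/-- The subgroup of the inertia group of `𝔓` of all liftings of powers of `σ ∈ Gal(K/k)`. -/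
def inertiaLiftings (σ : Gal(K/k)) (𝔓 : Ideal (integralClosure R E)) : Subgroup Gal(E/k) :=
  liftings E (Subgroup.zpowers σ) ⊓ inertiaGroup k 𝔓

/-- The ramification index in `E/K` of a prime `𝔓` of `E`, over the prime of `K` below `𝔓`. -/
def ramIndex (𝔓 : Ideal (integralClosure R E)) : ℕ :=
  letI : Algebra (integralClosure R K) (integralClosure R E) :=
    ((IsScalarTower.toAlgHom R K E).mapIntegralClosure).toRingHom.toAlgebra
  𝔓.ramificationIdx (integralClosure R K)

end Ramification

end QuasiCyclotomic

end

/-!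
The function field `K = k(e_C(ϖ / M))` is an analogue of a cyclotomic field: `Gal(K/k)` is the group
`(𝔸/M)^*`, acting by multiplication on the `M`-torsion of the Carlitz module. The proof has three parts.

**`K̃/k` is Galois.** Up to a constant, `u_{PQ}` is a product of torsion points `e_C(ϖ a / (P Q))`
(`uPQ_div_kummerProd_mem`), so it lies in `K`. The classes of these torsion points modulo `(q - 1)`-th
powers form a distribution: they are homogeneous under `F_q^*` and satisfy the relations that come from
the factorization of the Carlitz polynomials. An automorphism of `K` multiplies the torsion points by a
pair of units modulo `P` and `Q`, and `a_{PQ}` is the difference of the sums of the same weighted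
divisor over pairs of residues modulo `P` and `Q` normalized to be monic in one or in the other
coordinate. By changing the normalization one computes the effect of a unit of one factor
(`sum_divisor_sub`). The error term is a bilinear alternating pairing on the cyclic group `(𝔸/P)^*`,
hence trivial (`logPairing_eq_zero`), and the constant that remains is cancelled by the square roots of
`P` and `Q`. Therefore the class of `u_{PQ}` modulo `(q - 1)`-th powers is invariant under `Gal(K/k)`
(`exists_uPQ_mem`). As the `(q - 1)`-th roots of unity lie in `k`, Kummer theory shows that `K̃/k` is
Galois and that `Gal(K̃/K)` is central and of exponent dividing `q - 1` (`isGalois_kummer`,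
`mul_comm_of_isLifting_one`).

**Two characters of the inertia group.** For a uniformizer `π`, the map `g ↦ g π / π` is a homomorphism
`θ` from the inertia group to the units of the residue field whose kernel is the first ramification group
`G̃_1`, a `p`-group (`exists_tame_character`, `smul_eq_of_mem_inertia_sq`). On the other hand, inertia at
`L` acts trivially on the torsion of order prime to `L`, because differences of such torsion points divide
a polynomial prime to `L`. Its action on the `L^r`-torsion gives a homomorphism `χ` to `(𝔸/L^r)^*` whose
kernel is the inertia group in `Gal(K̃/K)`, of order `e_L`. It is surjective: `L` is the product of the
torsion points of exact order `L^r`, which all generate the same ideal, so that the ramification index of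
`L` in `K` is at least the order of `(𝔸/L^r)^*` (`exists_inertia_character`).

**Group theory.** As the kernel of `χ` has order prime to `p`, `χ` maps `G̃_1` isomorphically onto the
`p`-part `(𝔸/L^r)^{(1)}`. The group `G̃_L` is the preimage of the group generated by `χ(σ_L)`, whose order
is prime to `p`; hence it meets `G̃_1` trivially, `θ` embeds it into a cyclic group, and the
inertia group is the direct product of both (`TameData`). Finally, two liftings of `σ_L` differ by a
central element of order dividing `q - 1`, and `q - 1` divides the order `|L| - 1` of `σ_L`; so all
liftings have the order of the generator of `G̃_L`, which is `e_L · ord(σ_L)`.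
-/

noncomputable section

namespace QuasiCyclotomic

/-! ### Infinite products over an ultrametric field -/

section

open Filter Topology

theorem norm_prod_one_add_sub_one_le {Ω ι : Type*} [NormedField Ω] [IsUltrametricDist Ω]
    {f : ι → Ω} {δ : ℝ} (hδ0 : 0 ≤ δ) (hδ : δ < 1) (S : Finset ι) (hS : ∀ i ∈ S, ‖f i‖ ≤ δ) :
    ‖∏ i ∈ S, (1 + f i) - 1‖ ≤ δ := by
  classical
  induction S using Finset.induction_on with
  | empty => simpa using hδ0
  | insert i S hi ih =>
    have h1 := ih fun j hj => hS j (Finset.mem_insert_of_mem hj)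
    have h2 := hS i (Finset.mem_insert_self i S)
    rw [Finset.prod_insert hi]
    have h3 : (1 + f i) * ∏ j ∈ S, (1 + f j) - 1 =
        (∏ j ∈ S, (1 + f j) - 1) + (f i + f i * (∏ j ∈ S, (1 + f j) - 1)) := by ring
    rw [h3]
    refine (IsUltrametricDist.norm_add_le_max _ _).trans (max_le h1 ?_)
    refine (IsUltrametricDist.norm_add_le_max _ _).trans (max_le h2 ?_)
    rw [norm_mul]
    calc ‖f i‖ * _ ≤ δ * 1 := mul_le_mul h2 (h1.trans hδ.le) (norm_nonneg _) hδ0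
      _ = δ := mul_one δ

theorem norm_one_add_eq_one {Ω : Type*} [NormedField Ω] [IsUltrametricDist Ω] {x : Ω}
    (hx : ‖x‖ < 1) : ‖1 + x‖ = 1 := by
  rw [IsUltrametricDist.norm_add_eq_max_of_norm_ne_norm (by rw [norm_one]; exact hx.ne'),
    norm_one, max_eq_left hx.le]

/-- Factors `1 + x` with `‖x‖ < 1` do not change the absolute value of a product. -/
theorem norm_prod_one_add_eq {Ω ι : Type*} [NormedField Ω] [IsUltrametricDist Ω] {f : ι → Ω}
    {T S : Finset ι} (hT : ∀ i ∉ T, ‖f i‖ < 1) (hTS : T ⊆ S) :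
    ‖∏ i ∈ S, (1 + f i)‖ = ‖∏ i ∈ T, (1 + f i)‖ := by
  classical
  rw [← Finset.prod_sdiff hTS, norm_mul, norm_prod, Finset.prod_eq_one, one_mul]
  intro i hi
  exact norm_one_add_eq_one (hT i (Finset.mem_sdiff.1 hi).2)

theorem exists_finset_norm_lt {Ω ι : Type*} [NormedField Ω] {f : ι → Ω}
    (hf : Tendsto f cofinite (𝓝 0)) {ε : ℝ} (hε : 0 < ε) : ∃ T : Finset ι, ∀ i ∉ T, ‖f i‖ < ε := by
  have h : {i | ¬ ‖f i‖ < ε}.Finite :=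
    (tendsto_zero_iff_norm_tendsto_zero.1 hf).eventually (gt_mem_nhds hε)
  refine ⟨h.toFinset, fun i hi => ?_⟩
  by_contra hh
  exact hi (h.mem_toFinset.2 hh)

/-- Over a complete ultrametric field, a product of factors tending to `1` converges. -/
theorem multipliable_one_add_of_tendsto {Ω ι : Type*} [NormedField Ω] [CompleteSpace Ω]
    [IsUltrametricDist Ω] {f : ι → Ω} (hf : Tendsto f cofinite (𝓝 0)) :
    Multipliable fun i => 1 + f i := by
  classical
  obtain ⟨T₀, hT₀⟩ := exists_finset_norm_lt hf one_pos
  set C := ‖∏ i ∈ T₀, (1 + f i)‖ + 1 with hC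
  have hC0 : 0 < C := by positivity
  have hcau : CauchySeq fun S : Finset ι => ∏ i ∈ S, (1 + f i) := by
    rw [Metric.cauchySeq_iff']
    intro ε hε
    obtain ⟨T₁, hT₁⟩ := exists_finset_norm_lt hf (ε := min (1 / 2) (ε / (2 * C))) (by positivity)
    refine ⟨T₀ ∪ T₁, fun S hS => ?_⟩
    have hS' : T₀ ∪ T₁ ⊆ S := hS
    rw [dist_eq_norm, ← Finset.prod_sdiff hS']
    have h1 : ‖∏ i ∈ S \ (T₀ ∪ T₁), (1 + f i) - 1‖ ≤ min (1 / 2) (ε / (2 * C)) := by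
      refine norm_prod_one_add_sub_one_le (by positivity)
        ((min_le_left _ _).trans_lt (by norm_num)) _ fun i hi => (hT₁ i ?_).le
      simp only [Finset.mem_sdiff, Finset.mem_union, not_or] at hi
      exact hi.2.2
    have h2 : ‖∏ i ∈ T₀ ∪ T₁, (1 + f i)‖ ≤ C := by
      rw [norm_prod_one_add_eq hT₀ Finset.subset_union_left]
      exact (lt_add_one _).le
    rw [← sub_one_mul, norm_mul]
    calc _ ≤ (ε / (2 * C)) * C :=
          mul_le_mul (h1.trans (min_le_right _ _)) h2 (norm_nonneg _) (by positivity)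
      _ = ε / 2 := by field_simp
      _ < ε := half_lt_self hε
  obtain ⟨a, ha⟩ := cauchySeq_tendsto_of_complete hcau
  exact ⟨a, ha⟩

/-- A convergent product of nonzero factors is not zero: the absolute values of the partial products
are eventually constant. -/
theorem tprod_one_add_ne_zero {Ω ι : Type*} [NormedField Ω] [CompleteSpace Ω]
    [IsUltrametricDist Ω] {f : ι → Ω} (hf : Tendsto f cofinite (𝓝 0)) (h0 : ∀ i, 1 + f i ≠ 0) :
    ∏' i, (1 + f i) ≠ 0 := by
  obtain ⟨T₀, hT₀⟩ := exists_finset_norm_lt hf one_pos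
  have h1 : Tendsto (fun S : Finset ι => ∏ i ∈ S, (1 + f i)) atTop (𝓝 (∏' i, (1 + f i))) :=
    (multipliable_one_add_of_tendsto hf).hasProd
  have h2 : Tendsto (fun S : Finset ι => ‖∏ i ∈ S, (1 + f i)‖) atTop
      (𝓝 ‖∏ i ∈ T₀, (1 + f i)‖) :=
    tendsto_const_nhds.congr' <| by
      filter_upwards [eventually_ge_atTop T₀] with S hS
      exact (norm_prod_one_add_eq hT₀ hS).symm
  rw [← norm_ne_zero_iff, tendsto_nhds_unique h1.norm h2, norm_ne_zero_iff]
  exact Finset.prod_ne_zero_iff.2 fun i _ => h0 i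

open Polynomial in
/-- A monic polynomial whose roots form a finite additive group is additive. -/
theorem eval_add_of_roots_addGroup {k V : Type*} [Field k] [AddCommGroup V] [Fintype V]
    (φ : V →+ k) (hφ : Function.Injective φ) (x y : k) :
    ∏ v, (x + y - φ v) = ∏ v, (x - φ v) + ∏ v, (y - φ v) := by
  classical
  set P : k[X] := ∏ v, (X - C (φ v)) with hP
  have hev : ∀ z, ∏ v, (z - φ v) = P.eval z := fun z => by simp [hP, eval_prod]
  have hroot : ∀ (v : V) (z : k), P.eval (φ v + z) = P.eval z := by
    intro v z
    simp only [← hev]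
    refine Fintype.prod_equiv (Equiv.subRight v) _ _ fun w => ?_
    simp only [Equiv.subRight_apply, map_sub]
    ring
  have hmonic : P.Monic := by
    rw [hP]; exact monic_prod_of_monic _ _ fun v _ => monic_X_sub_C _
  have hP0 : ∀ v : V, P.eval (φ v) = 0 := by
    intro v
    rw [hP, eval_prod]
    exact Finset.prod_eq_zero (Finset.mem_univ v) (by simp)
  have hdegP : P.degree = Fintype.card V := by
    rw [hP, degree_prod]
    simp
  -- `P (X + y) - P X - P y` has smaller degree than `P`, and it vanishes at all roots of `P`.
  set D := P.comp (X + C y) - P - C (P.eval y) with hD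
  have hcomp : (P.comp (X + C y)).Monic := hmonic.comp_X_add_C y
  have hcd : (P.comp (X + C y)).degree = P.degree := by
    rw [degree_eq_natDegree hcomp.ne_zero, degree_eq_natDegree hmonic.ne_zero, natDegree_comp,
      natDegree_X_add_C, mul_one]
  have hcard : 0 < Fintype.card V := Fintype.card_pos
  have hdeg : D.degree < Fintype.card V := by
    refine (degree_sub_le _ _).trans_lt (max_lt ?_ ?_)
    · rw [← hdegP, ← hcd]
      exact degree_sub_lt_left hcd hcomp.ne_zero (by rw [hcomp.leadingCoeff, hmonic.leadingCoeff])
    · exact degree_C_le.trans_lt (by exact_mod_cast hcard)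
  have hD0 : D = 0 := by
    refine eq_zero_of_degree_lt_of_eval_finset_eq_zero (Finset.univ.image φ) ?_ ?_
    · rwa [Finset.card_image_of_injective _ hφ, Finset.card_univ]
    · intro z hz
      obtain ⟨v, -, rfl⟩ := Finset.mem_image.1 hz
      simp [hD, hroot, hP0]
  have := congrArg (eval x) hD0
  simp only [hD, eval_sub, eval_comp, eval_add, eval_X, eval_C, eval_zero] at this
  rw [hev, hev, hev]
  linear_combination this

end

/-! ### The exponential function of a lattice -/

section

open Filter Topology

variable {F : Type*} [Field F] [Fintype F]

instance : IsUltrametricDist (KInftyAlgClosure F) :=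
  IsUltrametricDist.isUltrametricDist_of_isNonarchimedean_norm
    (isNonarchimedean_spectralNorm (K := KInfty F) (L := KInftyAlgClosure F))

theorem isUltrametricDist_completion (α : Type*) [PseudoMetricSpace α] [IsUltrametricDist α] :
    IsUltrametricDist (UniformSpace.Completion α) := by
  refine ⟨fun x y z => ?_⟩
  induction x, y, z using UniformSpace.Completion.induction_on₃ with
  | hp => exact isClosed_le (by fun_prop) (by fun_prop)
  | ih a b c =>
    simp only [UniformSpace.Completion.dist_eq]
    exact dist_triangle_max a b c

instance : IsUltrametricDist (Omega F) :=
  isUltrametricDist_completion (KInftyAlgClosure F)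

theorem norm_KInfty_algebraMap {a : F[X]} (ha : a ≠ 0) :
    ‖algebraMap (RatFunc F) (KInfty F) (algebraMap F[X] (RatFunc F) a)‖ =
      (Fintype.card F : ℝ) ^ a.natDegree := by
  have h := (KInfty.valuation_algebraMap F (algebraMap F[X] (RatFunc F) a)).trans
    (@RatFunc.inftyValuation.polynomial F _ (Classical.decEq _) _ ha)
  have h2 : ‖algebraMap (RatFunc F) (KInfty F) (algebraMap F[X] (RatFunc F) a)‖ =
     (WithZeroMulInt.toNNReal (one_lt_card F).ne_bot
        (Valued.v (algebraMap (RatFunc F) (KInfty F) (algebraMap F[X] (RatFunc F) a))) : ℝ) := by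
    change ((WithZeroMulInt.toNNReal (one_lt_card F).ne_bot
      (MonoidWithZeroHom.ValueGroup₀.embedding (Valued.v.restrict _)) : ℝ≥0) : ℝ) = _
    rw [Valuation.embedding_restrict]
  rw [h2, h, WithZeroMulInt.toNNReal_neg_apply _ WithZero.exp_ne_zero]
  have h3 : WithZero.unzero (WithZero.exp_ne_zero (a := (a.natDegree : ℤ))) =
      Multiplicative.ofAdd (a.natDegree : ℤ) := rfl
  rw [h3]
  simp

/-- The absolute value of `Ω` is normalized by `|a| = q ^ deg a`. -/
theorem norm_algebraMap {a : F[X]} (ha : a ≠ 0) :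
    ‖algebraMap F[X] (Omega F) a‖ = (Fintype.card F : ℝ) ^ a.natDegree := by
  rw [← norm_KInfty_algebraMap ha]
  refine (UniformSpace.Completion.norm_coe (E := KInftyAlgClosure F) _).trans ?_
  exact spectralNorm_extends _

theorem algebraMap_injective : Function.Injective (algebraMap F[X] (Omega F)) :=
  (algebraMap (RatFunc F) (Omega F)).injective.comp (RatFunc.algebraMap_injective F)

theorem algebraMap_ne_zero {a : F[X]} (ha : a ≠ 0) : algebraMap F[X] (Omega F) a ≠ 0 :=
  (map_ne_zero_iff _ algebraMap_injective).2 ha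

instance (d : ℕ) : Finite (Polynomial.degreeLT F d) :=
  Finite.of_equiv _ (Polynomial.degreeLTEquiv F d).toEquiv.symm

/-- The polynomials of degree less than `d`. -/
def polysLT (F : Type*) [Field F] [Fintype F] (d : ℕ) : Finset F[X] :=
  (Set.finite_coe_iff.1 (inferInstanceAs (Finite (Polynomial.degreeLT F d))) :
    (Polynomial.degreeLT F d : Set F[X]).Finite).toFinset

@[simp]
theorem mem_polysLT {d : ℕ} {a : F[X]} : a ∈ polysLT F d ↔ a.degree < d := by
  simp [polysLT, Polynomial.mem_degreeLT]

theorem prod_polysLT {M : Type*} [CommMonoid M] (d : ℕ) [Fintype (Polynomial.degreeLT F d)]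
    (f : F[X] → M) : ∏ a ∈ polysLT F d, f a = ∏ a : Polynomial.degreeLT F d, f a :=
  Finset.prod_subtype _ (fun a => by simp [Polynomial.mem_degreeLT]) f

section LatticeExp

open scoped Classical

variable {ϖ : Omega F}

theorem tendsto_lattice (x : Omega F) :
    Tendsto (fun a : {a : F[X] // a ≠ 0} => -(x / (ϖ * algebraMap F[X] (Omega F) a.1)))
      cofinite (𝓝 0) := by
  rw [tendsto_zero_iff_norm_tendsto_zero]
  refine Metric.tendsto_nhds.2 fun ε hε => ?_
  have hq : (1 : ℝ) < Fintype.card F := by exact_mod_cast Fintype.one_lt_card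
  obtain ⟨n, hn⟩ := pow_unbounded_of_one_lt (‖x / ϖ‖ / ε) hq
  have hfin : {a : {a : F[X] // a ≠ 0} | a.1 ∈ polysLT F n}.Finite :=
    (polysLT F n).finite_toSet.preimage Subtype.val_injective.injOn
  refine hfin.subset fun a ha => ?_
  by_contra hdeg
  refine ha ?_
  have hdeg' : n ≤ a.1.natDegree := by
    have : ¬ a.1.degree < n := by simpa using hdeg
    rw [Polynomial.degree_eq_natDegree a.2] at this
    exact_mod_cast not_lt.1 this
  have hpos : (0 : ℝ) < (Fintype.card F : ℝ) ^ a.1.natDegree := by positivity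
  change dist ‖_‖ 0 < ε
  rw [dist_zero_right, norm_norm, norm_neg, ← div_div, norm_div, norm_algebraMap a.2,
    div_lt_iff₀ hpos]
  rw [div_lt_iff₀ hε] at hn
  calc _ < _ := hn
    _ ≤ _ := by
      rw [mul_comm]
      exact mul_le_mul_of_nonneg_left (pow_le_pow_right₀ hq.le hdeg') hε.le

theorem latticeExp_eq (ϖ x : Omega F) : latticeExp ϖ x =
    x * ∏' a : {a : F[X] // a ≠ 0}, (1 + -(x / (ϖ * algebraMap F[X] (Omega F) a.1))) := by
  simp only [latticeExp, sub_eq_add_neg]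

/-- The kernel of the exponential function is the lattice `ϖ𝔸`. -/
theorem latticeExp_eq_zero_iff (hϖ : ϖ ≠ 0) (x : Omega F) :
    latticeExp ϖ x = 0 ↔ ∃ a : F[X], x = ϖ * algebraMap F[X] (Omega F) a := by
  constructor
  · intro h
    rw [latticeExp_eq, mul_eq_zero] at h
    rcases h with h | h
    · exact ⟨0, by simp [h]⟩
    · by_contra! hne
      refine tprod_one_add_ne_zero (tendsto_lattice x) (fun a h0 => hne a.1 ?_) h
      have h1 : ϖ * algebraMap F[X] (Omega F) a.1 ≠ 0 := mul_ne_zero hϖ (algebraMap_ne_zero a.2)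
      rw [← sub_eq_add_neg, sub_eq_zero, eq_div_iff h1, one_mul] at h0
      exact h0.symm
  · rintro ⟨a, rfl⟩
    by_cases ha : a = 0
    · simp [latticeExp, ha]
    · have h1 : ϖ * algebraMap F[X] (Omega F) a ≠ 0 := mul_ne_zero hϖ (algebraMap_ne_zero ha)
      rw [latticeExp, tprod_of_exists_eq_zero ⟨⟨a, ha⟩, by simp [div_self h1]⟩, mul_zero]

/-- The exponential function is the limit of its partial products over `deg a < d`. -/
theorem tendsto_latticeExp (ϖ x : Omega F) :
    Tendsto (fun d : ℕ => x * ∏ a ∈ (polysLT F d).subtype (· ≠ 0),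
      (1 + -(x / (ϖ * algebraMap F[X] (Omega F) a.1)))) atTop (𝓝 (latticeExp ϖ x)) := by
  rw [latticeExp_eq]
  refine Tendsto.const_mul x ?_
  have h1 : Tendsto (fun S : Finset {a : F[X] // a ≠ 0} =>
      ∏ a ∈ S, (1 + -(x / (ϖ * algebraMap F[X] (Omega F) a.1)))) atTop _ :=
    (multipliable_one_add_of_tendsto (tendsto_lattice (ϖ := ϖ) x)).hasProd
  refine h1.comp (tendsto_atTop_finset_of_monotone
    (f := fun d : ℕ => (polysLT F d).subtype (· ≠ 0)) ?_ ?_)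
  · intro m n hmn a ha
    simp only [Finset.mem_subtype, mem_polysLT] at ha ⊢
    exact ha.trans_le (by exact_mod_cast hmn)
  · intro a
    refine ⟨a.1.natDegree + 1, ?_⟩
    simp only [Finset.mem_subtype, mem_polysLT, Polynomial.degree_eq_natDegree a.2]
    exact_mod_cast Nat.lt_succ_self _

/-- The partial products of the exponential function are scalar multiples of the additive
polynomials with roots `ϖ a`, `deg a < d`. -/
theorem partial_latticeExp_eq (hϖ : ϖ ≠ 0) (x : Omega F) {d : ℕ}
    [Fintype (Polynomial.degreeLT F d)] :
    x * ∏ a ∈ (polysLT F d).subtype (· ≠ 0), (1 + -(x / (ϖ * algebraMap F[X] (Omega F) a.1))) =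
    (∏ a ∈ (polysLT F d).subtype (· ≠ 0), (-(ϖ * algebraMap F[X] (Omega F) a.1))⁻¹) *
      ∏ a : Polynomial.degreeLT F d, (x - ϖ * algebraMap F[X] (Omega F) a.1) := by
  classical
  have h0 : (0 : F[X]) ∈ polysLT F d := by simp
  rw [← prod_polysLT d fun a => x - ϖ * algebraMap F[X] (Omega F) a, ← Finset.mul_prod_erase _ _ h0]
  simp only [map_zero, mul_zero, sub_zero]
  have h1 : ∏ a ∈ (polysLT F d).erase 0, (x - ϖ * algebraMap F[X] (Omega F) a) =
      ∏ a ∈ (polysLT F d).subtype (· ≠ 0), (x - ϖ * algebraMap F[X] (Omega F) a.1) := by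
    rw [Finset.prod_subtype_eq_prod_filter (f := fun a => x - ϖ * algebraMap F[X] (Omega F) a),
      ← Finset.filter_ne' ]
  rw [h1, mul_left_comm, ← Finset.prod_mul_distrib]
  congr 1
  refine Finset.prod_congr rfl fun a _ => ?_
  have h2 : ϖ * algebraMap F[X] (Omega F) a.1 ≠ 0 := mul_ne_zero hϖ (algebraMap_ne_zero a.2)
  generalize ϖ * algebraMap F[X] (Omega F) a.1 = z at h2
  field_simp
  ring

/-- The exponential function is additive, as a limit of additive polynomials. -/
theorem latticeExp_add (hϖ : ϖ ≠ 0) (x y : Omega F) :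
    latticeExp ϖ (x + y) = latticeExp ϖ x + latticeExp ϖ y := by
  refine tendsto_nhds_unique (tendsto_latticeExp ϖ (x + y)) ?_
  refine ((tendsto_latticeExp ϖ x).add (tendsto_latticeExp ϖ y)).congr fun d => ?_
  have := Fintype.ofFinite (Polynomial.degreeLT F d)
  simp only [partial_latticeExp_eq hϖ]
  rw [← mul_add]
  congr 1
  let φ : Polynomial.degreeLT F d →+ Omega F :=
    ((AddMonoidHom.mulLeft ϖ).comp (algebraMap F[X] (Omega F)).toAddMonoidHom).comp
      (Polynomial.degreeLT F d).subtype.toAddMonoidHom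
  have hφ : Function.Injective φ := by
    intro a b hab
    exact Subtype.ext (algebraMap_injective (mul_left_cancel₀ hϖ hab))
  exact (eval_add_of_roots_addGroup φ hφ x y).symm

theorem latticeExp_C_mul (ϖ : Omega F) (c : Fˣ) (x : Omega F) :
    latticeExp ϖ (algebraMap F[X] (Omega F) (Polynomial.C c.1) * x) =
      algebraMap F[X] (Omega F) (Polynomial.C c.1) * latticeExp ϖ x := by
  have hc : Polynomial.C c.1 ≠ 0 := by simp
  have hc' : Polynomial.C (c⁻¹ : Fˣ).1 ≠ 0 := by simp
  rw [latticeExp, latticeExp, mul_assoc]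
  congr 2
  let e : {a : F[X] // a ≠ 0} ≃ {a : F[X] // a ≠ 0} :=
    { toFun a := ⟨Polynomial.C c.1 * a.1, mul_ne_zero hc a.2⟩
      invFun a := ⟨Polynomial.C (c⁻¹ : Fˣ).1 * a.1, mul_ne_zero hc' a.2⟩
      left_inv a := by ext1; simp [← mul_assoc, ← Polynomial.C_mul]
      right_inv a := by ext1; simp [← mul_assoc, ← Polynomial.C_mul] }
  rw [← e.tprod_eq]
  refine tprod_congr fun a => ?_
  have h1 := algebraMap_ne_zero hc
  simp only [e, Equiv.coe_fn_mk, map_mul]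
  rw [mul_left_comm, mul_div_mul_left _ _ h1]

end LatticeExp

end

/-! ### Carlitz polynomials and torsion points -/

section

open Filter Topology

variable {F : Type*} [Field F] [Fintype F]

section CarlitzPoly

variable (F) in
/-- The Carlitz polynomial `C_{T^n}(X) ∈ 𝔸[X]`. -/
def carlitzXPow : ℕ → F[X][X]
  | 0 => Polynomial.X
  | n + 1 => Polynomial.C Polynomial.X * carlitzXPow n + carlitzXPow n ^ Fintype.card F

/-- The Carlitz polynomial `C_a(X) ∈ 𝔸[X]`: it is `F`-linear in `a`, and `C_T(X) = T X + X ^ q`. -/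
def carlitzPoly (a : F[X]) : F[X][X] :=
  ∑ i ∈ Finset.range (a.natDegree + 1),
    Polynomial.C (Polynomial.C (a.coeff i)) * carlitzXPow F i

theorem coeff_zero_carlitzXPow (n : ℕ) : (carlitzXPow F n).coeff 0 = 0 := by
  induction n with
  | zero => simp [carlitzXPow]
  | succ n ih =>
    rw [Polynomial.coeff_zero_eq_eval_zero] at ih ⊢
    simp [carlitzXPow, ih]

theorem coeff_one_carlitzXPow (n : ℕ) : (carlitzXPow F n).coeff 1 = Polynomial.X ^ n := by
  induction n with
  | zero => simp [carlitzXPow]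
  | succ n ih =>
    obtain ⟨g, hg⟩ := Polynomial.X_dvd_iff.2 (coeff_zero_carlitzXPow (F := F) n)
    have h2 : 2 ≤ Fintype.card F := Fintype.one_lt_card
    obtain ⟨m, hm⟩ := Nat.exists_eq_add_of_le h2
    have h3 : (carlitzXPow F n ^ Fintype.card F).coeff 1 = 0 := by
      rw [hg, mul_pow, hm, Polynomial.coeff_X_pow_mul', if_neg (by lia)]
    rw [carlitzXPow, Polynomial.coeff_add, Polynomial.coeff_C_mul, ih, h3, add_zero, pow_succ']

theorem monic_carlitzXPow (n : ℕ) :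
    (carlitzXPow F n).Monic ∧ (carlitzXPow F n).natDegree = Fintype.card F ^ n := by
  induction n with
  | zero => simp [carlitzXPow, Polynomial.monic_X]
  | succ n ih =>
    obtain ⟨h1, h2⟩ := ih
    have h3 : 1 < Fintype.card F := Fintype.one_lt_card
    have h4 : (carlitzXPow F n ^ Fintype.card F).natDegree = Fintype.card F ^ (n + 1) := by
      rw [h1.natDegree_pow, h2, pow_succ']
    have hlt : (Polynomial.C Polynomial.X * carlitzXPow F n).degree <
        (carlitzXPow F n ^ Fintype.card F).degree := by
      rw [Polynomial.degree_mul, Polynomial.degree_C Polynomial.X_ne_zero, zero_add,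
        Polynomial.degree_eq_natDegree h1.ne_zero,
        Polynomial.degree_eq_natDegree (h1.pow _).ne_zero, h2, h4]
      exact_mod_cast Nat.pow_lt_pow_right h3 (Nat.lt_succ_self n)
    refine ⟨(h1.pow _).add_of_right hlt, ?_⟩
    rw [carlitzXPow, Polynomial.natDegree_add_eq_right_of_degree_lt hlt, h4]

theorem coeff_zero_carlitzPoly (a : F[X]) : (carlitzPoly a).coeff 0 = 0 := by
  simp [carlitzPoly, Polynomial.finsetSum_coeff, coeff_zero_carlitzXPow]

theorem coeff_one_carlitzPoly (a : F[X]) : (carlitzPoly a).coeff 1 = a := by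
  simp only [carlitzPoly, Polynomial.finsetSum_coeff, Polynomial.coeff_C_mul,
    coeff_one_carlitzXPow]
  exact (a.as_sum_range_C_mul_X_pow).symm

/-- For monic `a`, the Carlitz polynomial `C_a` is monic of degree `q ^ deg a`. -/
theorem monic_carlitzPoly {a : F[X]} (ha : a.Monic) :
    (carlitzPoly a).Monic ∧ (carlitzPoly a).natDegree = Fintype.card F ^ a.natDegree := by
  obtain ⟨h1, h2⟩ := monic_carlitzXPow (F := F) a.natDegree
  have h3 : 1 < Fintype.card F := Fintype.one_lt_card
  have hlt : (∑ i ∈ Finset.range a.natDegree,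
      Polynomial.C (Polynomial.C (a.coeff i)) * carlitzXPow F i).degree <
      (carlitzXPow F a.natDegree).degree := by
    refine (Polynomial.degree_sum_le _ _).trans_lt ?_
    rw [Finset.sup_lt_iff]
    · intro i hi
      refine ((Polynomial.degree_mul_le _ _).trans
        (add_le_add_left Polynomial.degree_C_le _)).trans_lt ?_
      rw [zero_add]
      obtain ⟨h4, h5⟩ := monic_carlitzXPow (F := F) i
      rw [Polynomial.degree_eq_natDegree h1.ne_zero, Polynomial.degree_eq_natDegree h4.ne_zero,
        h2, h5]
      exact_mod_cast Nat.pow_lt_pow_right h3 (Finset.mem_range.1 hi)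
    · exact bot_lt_iff_ne_bot.2 (by simpa using h1.ne_zero)
  rw [carlitzPoly, Finset.sum_range_succ, ha.coeff_natDegree, Polynomial.C_1, Polynomial.C_1,
    one_mul]
  exact ⟨h1.add_of_right hlt, by rw [Polynomial.natDegree_add_eq_right_of_degree_lt hlt, h2]⟩

variable {ϖ : Omega F}

/-- `e_C` intertwines multiplication by `a` with the Carlitz polynomial `C_a`. -/
theorem aeval_carlitzPoly (hϖ : IsCarlitzPeriod ϖ) (a : F[X]) (x : Omega F) :
    Polynomial.aeval (latticeExp ϖ x) (carlitzPoly a) =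
      latticeExp ϖ (algebraMap F[X] (Omega F) a * x) := by
  let e : Omega F →+ Omega F := AddMonoidHom.mk' (latticeExp ϖ) (latticeExp_add hϖ.1)
  have he : ∀ z, latticeExp ϖ z = e z := fun _ => rfl
  have hpow : ∀ n : ℕ, Polynomial.aeval (latticeExp ϖ x) (carlitzXPow F n) =
      latticeExp ϖ (algebraMap F[X] (Omega F) (Polynomial.X ^ n) * x) := by
    intro n
    induction n with
    | zero => simp [carlitzXPow]
    | succ n ih =>
      rw [carlitzXPow, map_add, map_mul, map_pow, Polynomial.aeval_C, ih, pow_succ', map_mul,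
        mul_assoc, hϖ.2]
  rw [carlitzPoly, map_sum]
  conv_rhs => rw [a.as_sum_range_C_mul_X_pow, map_sum, Finset.sum_mul]
  refine Eq.trans ?_ (map_sum e _ _).symm
  refine Finset.sum_congr rfl fun i _ => ?_
  rw [map_mul, Polynomial.aeval_C, hpow, (algebraMap F[X] (Omega F)).map_mul, mul_assoc, ← he]
  by_cases hc : a.coeff i = 0
  · simp [hc, latticeExp]
  · exact (latticeExp_C_mul ϖ (Units.mk0 _ hc) _).symm

/-- The value `e_C(ϖ a / D)`. -/
def tors (ϖ : Omega F) (D a : F[X]) : Omega F := expAt ϖ (frac a D)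

theorem tors_eq (ϖ : Omega F) (D a : F[X]) : tors ϖ D a =
    latticeExp ϖ (ϖ * (algebraMap F[X] (Omega F) a / algebraMap F[X] (Omega F) D)) := by
  rw [tors, expAt, frac, map_div₀]
  rfl

theorem tors_add (hϖ : IsCarlitzPeriod ϖ) (D a b : F[X]) :
    tors ϖ D (a + b) = tors ϖ D a + tors ϖ D b := by
  rw [tors_eq, tors_eq, tors_eq, ← latticeExp_add hϖ.1, map_add, add_div, mul_add]

theorem tors_C_mul (ϖ : Omega F) (D : F[X]) (c : F) (a : F[X]) :
    tors ϖ D (Polynomial.C c * a) = algebraMap F[X] (Omega F) (Polynomial.C c) * tors ϖ D a := by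
  by_cases hc : c = 0
  · simp [hc, tors_eq, latticeExp]
  · rw [tors_eq, tors_eq, map_mul, mul_div_assoc, mul_left_comm]
    exact latticeExp_C_mul ϖ (Units.mk0 c hc) _

theorem tors_eq_zero_iff (hϖ : IsCarlitzPeriod ϖ) {D : F[X]} (hD : D ≠ 0) (a : F[X]) :
    tors ϖ D a = 0 ↔ D ∣ a := by
  have h0 := algebraMap_ne_zero hD
  rw [tors_eq, latticeExp_eq_zero_iff hϖ.1]
  refine exists_congr fun b => ?_
  rw [mul_right_inj' hϖ.1, div_eq_iff h0, ← map_mul, algebraMap_injective.eq_iff, mul_comm]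

theorem tors_mul_mul_right (ϖ : Omega F) {N : F[X]} (hN : N ≠ 0) (D a : F[X]) :
    tors ϖ (D * N) (a * N) = tors ϖ D a := by
  rw [tors_eq, tors_eq, map_mul, map_mul, mul_div_mul_right _ _ (algebraMap_ne_zero hN)]

theorem aeval_tors (hϖ : IsCarlitzPeriod ϖ) (D a b : F[X]) :
    Polynomial.aeval (tors ϖ D b) (carlitzPoly a) = tors ϖ D (a * b) := by
  rw [tors_eq, aeval_carlitzPoly hϖ, tors_eq, map_mul, mul_left_comm, mul_div_assoc]

theorem tors_sub (hϖ : IsCarlitzPeriod ϖ) (D a b : F[X]) :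
    tors ϖ D (a - b) = tors ϖ D a - tors ϖ D b := by
  rw [eq_sub_iff_add_eq, ← tors_add hϖ, sub_add_cancel]

theorem tors_eq_iff (hϖ : IsCarlitzPeriod ϖ) {D : F[X]} (hD : D ≠ 0) (a b : F[X]) :
    tors ϖ D a = tors ϖ D b ↔ D ∣ a - b := by
  rw [← tors_eq_zero_iff hϖ hD, tors_sub hϖ, sub_eq_zero]

theorem card_polysLT (d : ℕ) : (polysLT F d).card = Fintype.card F ^ d := by
  have := Fintype.ofFinite (Polynomial.degreeLT F d)
  have h : (polysLT F d).card = Fintype.card (Polynomial.degreeLT F d) := by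
    rw [polysLT, ← Set.ncard_eq_toFinset_card _]
    exact (Nat.card_coe_set_eq _).symm.trans Nat.card_eq_fintype_card
  rw [h, Fintype.card_congr (Polynomial.degreeLTEquiv F d).toEquiv, Fintype.card_fun,
    Fintype.card_fin]

/-- The roots of `C_D(X) - e_C(ϖ c / N)` are the `q ^ deg D` division points `e_C(ϖ (c + b N) / (N D))`,
`deg b < deg D`. -/
theorem map_carlitzPoly_sub_eq_prod (hϖ : IsCarlitzPeriod ϖ) {D : F[X]} (hD : D.Monic)
    {N : F[X]} (hN : N ≠ 0) (c : F[X]) :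
    (carlitzPoly D).map (algebraMap F[X] (Omega F)) - Polynomial.C (tors ϖ N c) =
      ∏ b ∈ polysLT F D.natDegree, (Polynomial.X - Polynomial.C (tors ϖ (N * D) (c + b * N))) := by
  classical
  obtain ⟨h1, h2⟩ := monic_carlitzPoly hD
  have hinj : Set.InjOn (fun b => tors ϖ (N * D) (c + b * N)) (polysLT F D.natDegree) := by
    intro a ha b hb hab
    have h3 := (tors_eq_iff hϖ (mul_ne_zero hN hD.ne_zero) _ _).1 hab
    rw [add_sub_add_left_eq_sub, ← sub_mul, mul_comm N, mul_dvd_mul_iff_right hN] at h3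
    refine sub_eq_zero.1 (Polynomial.eq_zero_of_dvd_of_degree_lt h3 ?_)
    refine (Polynomial.degree_sub_le _ _).trans_lt ?_
    rw [Polynomial.degree_eq_natDegree hD.ne_zero]
    exact max_lt (mem_polysLT.1 ha) (mem_polysLT.1 hb)
  have hq : 0 < Fintype.card F ^ D.natDegree := pow_pos Fintype.card_pos _
  have hm := h1.map (algebraMap F[X] (Omega F))
  have hdm : ((carlitzPoly D).map (algebraMap F[X] (Omega F))).natDegree =
      Fintype.card F ^ D.natDegree := by rw [h1.natDegree_map, h2]
  have hC : (Polynomial.C (tors ϖ N c)).degree <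
      ((carlitzPoly D).map (algebraMap F[X] (Omega F))).degree := by
    refine Polynomial.degree_C_le.trans_lt ?_
    rw [Polynomial.degree_eq_natDegree hm.ne_zero, hdm]
    exact_mod_cast hq
  have hPm : (∏ b ∈ polysLT F D.natDegree,
      (Polynomial.X - Polynomial.C (tors ϖ (N * D) (c + b * N)))).Monic :=
    Polynomial.monic_prod_of_monic _ _ fun b _ => Polynomial.monic_X_sub_C _
  rw [← sub_eq_zero]
  refine Polynomial.eq_zero_of_degree_lt_of_eval_finset_eq_zero
    ((polysLT F D.natDegree).image fun b => tors ϖ (N * D) (c + b * N)) ?_ ?_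
  · rw [Finset.card_image_of_injOn hinj, card_polysLT]
    have h5 : ((carlitzPoly D).map (algebraMap F[X] (Omega F)) - Polynomial.C (tors ϖ N c)).degree =
        (Fintype.card F ^ D.natDegree : ℕ) := by
      rw [Polynomial.degree_sub_eq_left_of_degree_lt hC, Polynomial.degree_eq_natDegree hm.ne_zero,
        hdm]
    rw [← h5]
    refine Polynomial.degree_sub_lt_left ?_ ?_ ?_
    · rw [h5, Polynomial.degree_prod]
      simp [card_polysLT]
    · intro h
      rw [h, Polynomial.degree_zero] at h5
      exact absurd h5 (WithBot.natCast_ne_bot _).symm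
    · rw [(hm.sub_of_left hC).leadingCoeff, hPm.leadingCoeff]
  · intro z hz
    obtain ⟨b, hb, rfl⟩ := Finset.mem_image.1 hz
    rw [Polynomial.eval_sub, Polynomial.eval_prod, Finset.prod_eq_zero hb (by simp), sub_zero,
      Polynomial.eval_sub, Polynomial.eval_C, Polynomial.eval_map_algebraMap, aeval_tors hϖ,
      mul_comm D, tors_mul_mul_right ϖ hD.ne_zero, sub_eq_zero, tors_eq_iff hϖ hN]
    exact ⟨b, by ring⟩

theorem odd_card_pow (hodd : ringChar F ≠ 2) (d : ℕ) : Odd (Fintype.card F ^ d) :=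
  Odd.pow (Nat.odd_iff.2 (FiniteField.odd_card_of_char_ne_two hodd))

/-- The distribution relation of `e_C`: the constant terms in `map_carlitzPoly_sub_eq_prod`. The sign
is `+1`, because `q` is odd. -/
theorem prod_tors (hodd : ringChar F ≠ 2) (hϖ : IsCarlitzPeriod ϖ) {D : F[X]} (hD : D.Monic)
    {N : F[X]} (hN : N ≠ 0) (c : F[X]) :
    ∏ b ∈ polysLT F D.natDegree, tors ϖ (N * D) (c + b * N) = tors ϖ N c := by
  have h := congrArg (Polynomial.eval 0) (map_carlitzPoly_sub_eq_prod hϖ hD hN c)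
  simp only [Polynomial.eval_sub, Polynomial.eval_C, Polynomial.eval_prod, Polynomial.eval_X,
    zero_sub, ← Polynomial.coeff_zero_eq_eval_zero, Polynomial.coeff_map, coeff_zero_carlitzPoly,
    map_zero, Finset.prod_neg, card_polysLT, (odd_card_pow hodd _).neg_one_pow] at h
  simpa using h.symm

open scoped Classical in
/-- The product of the nonzero `D`-torsion points of the Carlitz module is `D`: the linear terms in
`map_carlitzPoly_sub_eq_prod`. The sign is `+1`, because `q` is odd. -/
theorem prod_tors_ne_zero (hodd : ringChar F ≠ 2) (hϖ : IsCarlitzPeriod ϖ) {D : F[X]}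
    (hD : D.Monic) :
    ∏ b ∈ (polysLT F D.natDegree).erase 0, tors ϖ D b = algebraMap F[X] (Omega F) D := by
  have h0 : (0 : F[X]) ∈ polysLT F D.natDegree := by simp
  have h1 : tors ϖ 1 0 = 0 := by simp [tors_eq, latticeExp]
  have h2 : tors ϖ D 0 = 0 := by simp [tors_eq, latticeExp]
  have h := map_carlitzPoly_sub_eq_prod hϖ hD one_ne_zero 0
  simp only [one_mul, mul_one, zero_add, h1, Polynomial.C_0, sub_zero] at h
  rw [← Finset.mul_prod_erase _ _ h0, h2, Polynomial.C_0, sub_zero] at h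
  have h3 := congrArg (fun p : (Omega F)[X] => p.coeff 1) h
  have hev : Even ((polysLT F D.natDegree).erase 0).card := by
    rw [Finset.card_erase_of_mem h0, card_polysLT]
    exact Nat.Odd.sub_odd (odd_card_pow hodd _) odd_one
  simp only [Polynomial.coeff_map, coeff_one_carlitzPoly, Polynomial.coeff_X_mul,
    Polynomial.coeff_zero_eq_eval_zero, Polynomial.eval_prod, Polynomial.eval_sub,
    Polynomial.eval_X, Polynomial.eval_C, zero_sub, Finset.prod_neg, hev.neg_one_pow,
    one_mul] at h3
  exact h3.symm

end CarlitzPoly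

end

/-! ### Sums over sections of a sign function -/

section

section SectionSums

open scoped Classical

variable {F : Type*} [Field F]

/-- `s` is a sign function on the `F`-space `A`: it is homogeneous and vanishes only at `0`. The
elements of sign `1` represent the nonzero elements modulo `F^*`. -/
structure IsSign {A : Type*} [AddCommGroup A] [Module F A] (s : A → F) : Prop where
  map_smul : ∀ (β : F) (x : A), s (β • x) = β * s x
  ne_zero : ∀ x, x ≠ 0 → s x ≠ 0

theorem IsSign.map_zero {A : Type*} [AddCommGroup A] [Module F A] {s : A → F} (hs : IsSign s) :
    s 0 = 0 := by
  have := hs.map_smul 0 0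
  simpa using this

theorem IsSign.ne_zero_of_eq_one {A : Type*} [AddCommGroup A] [Module F A] {s : A → F}
    (hs : IsSign s) {x : A} (hx : s x = 1) : x ≠ 0 := by
  rintro rfl
  simp [hs.map_zero] at hx

/-- Pairs of nonzero elements modulo `F^*` may be represented by the pairs whose second coordinate
has sign `1`, or by those whose first coordinate has sign `1`; both give the same sum of an
`F^*`-invariant function. -/
theorem sum_section_swap {A B M : Type*} [AddCommGroup A] [Module F A] [Fintype A]
    [AddCommGroup B] [Module F B] [Fintype B] [AddCommGroup M] {s : A → F} {t : B → F}
    (hs : IsSign s) (ht : IsSign t) (f : A → B → M)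
    (hf : ∀ β : F, β ≠ 0 → ∀ a b, a ≠ 0 → b ≠ 0 → f (β • a) (β • b) = f a b) :
    ∑ b with t b = 1, ∑ a with a ≠ 0, f a b = ∑ a with s a = 1, ∑ b with b ≠ 0, f a b := by
  rw [Finset.sum_comm' (t' := Finset.univ.filter (· ≠ 0))
    (s' := fun _ : A => Finset.univ.filter fun b : B => t b = 1) (by simp)]
  rw [Finset.sum_sigma', Finset.sum_sigma']
  have key : ∀ (a : A) (b : B), a ≠ 0 → b ≠ 0 → ∀ β : F, β ≠ 0 → f a b = f (β • a) (β • b) :=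
    fun a b ha hb β hβ => (hf β hβ a b ha hb).symm
  refine Finset.sum_bij' (fun z _ => ⟨(s z.1)⁻¹ • z.1, (s z.1)⁻¹ • z.2⟩)
    (fun z _ => ⟨(t z.2)⁻¹ • z.1, (t z.2)⁻¹ • z.2⟩) ?_ ?_ ?_ ?_ ?_
  · rintro ⟨a, b⟩ h
    simp only [Finset.mem_sigma, Finset.mem_filter, Finset.mem_univ, true_and] at h ⊢
    have ha := hs.ne_zero _ h.1
    exact ⟨by rw [hs.map_smul, inv_mul_cancel₀ ha],
      smul_ne_zero (inv_ne_zero ha) (ht.ne_zero_of_eq_one h.2)⟩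
  · rintro ⟨a, b⟩ h
    simp only [Finset.mem_sigma, Finset.mem_filter, Finset.mem_univ, true_and] at h ⊢
    have hb := ht.ne_zero _ h.2
    exact ⟨smul_ne_zero (inv_ne_zero hb) (hs.ne_zero_of_eq_one h.1),
      by rw [ht.map_smul, inv_mul_cancel₀ hb]⟩
  · rintro ⟨a, b⟩ h
    simp only [Finset.mem_sigma, Finset.mem_filter, Finset.mem_univ, true_and] at h
    have ha := hs.ne_zero _ h.1
    simp only [ht.map_smul, h.2, mul_one, inv_inv, smul_smul, mul_inv_cancel₀ ha, one_smul]
  · rintro ⟨a, b⟩ h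
    simp only [Finset.mem_sigma, Finset.mem_filter, Finset.mem_univ, true_and] at h
    have hb := ht.ne_zero _ h.2
    simp only [hs.map_smul, h.1, mul_one, inv_inv, smul_smul, mul_inv_cancel₀ hb, one_smul]
  · rintro ⟨a, b⟩ h
    simp only [Finset.mem_sigma, Finset.mem_filter, Finset.mem_univ, true_and] at h
    exact key a b h.1 (ht.ne_zero_of_eq_one h.2) _ (inv_ne_zero (hs.ne_zero _ h.1))

theorem units_smul_ne_zero {A : Type*} [CommRing A] (c : Aˣ) {x : A} (hx : x ≠ 0) : c.1 * x ≠ 0 := by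
  simpa using hx

variable {A : Type*} [CommRing A] [Algebra F A] [Fintype A]

/-- Multiplication by a unit permutes the nonzero elements modulo `F^*`. -/
theorem sum_section_mul {M : Type*} [AddCommGroup M] {s : A → F} (hs : IsSign s) (c : Aˣ)
    (f : A → M) (hf : ∀ β : F, β ≠ 0 → ∀ a, a ≠ 0 → f (β • a) = f a) :
    ∑ a with s a = 1, f (c * a) = ∑ a with s a = 1, f a := by
  refine Finset.sum_bij' (fun a _ => (s (c * a))⁻¹ • (c * a))
    (fun a _ => (s (c⁻¹ * a))⁻¹ • ((c⁻¹ : Aˣ) * a)) ?_ ?_ ?_ ?_ ?_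
  · intro a ha
    simp only [Finset.mem_filter, Finset.mem_univ, true_and] at ha ⊢
    rw [hs.map_smul, inv_mul_cancel₀]
    exact hs.ne_zero _ (units_smul_ne_zero c (hs.ne_zero_of_eq_one ha))
  · intro a ha
    simp only [Finset.mem_filter, Finset.mem_univ, true_and] at ha ⊢
    rw [hs.map_smul, inv_mul_cancel₀]
    exact hs.ne_zero _ (units_smul_ne_zero _ (hs.ne_zero_of_eq_one ha))
  · intro a ha
    simp only [Finset.mem_filter, Finset.mem_univ, true_and] at ha
    have h := hs.ne_zero _ (units_smul_ne_zero c (hs.ne_zero_of_eq_one ha))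
    simp only [mul_smul_comm, Units.inv_mul_cancel_left, hs.map_smul, ha, mul_one, inv_inv,
      smul_smul, mul_inv_cancel₀ h, one_smul]
  · intro a ha
    simp only [Finset.mem_filter, Finset.mem_univ, true_and] at ha
    have h := hs.ne_zero _ (units_smul_ne_zero c⁻¹ (hs.ne_zero_of_eq_one ha))
    simp only [mul_smul_comm, Units.mul_inv_cancel_left, hs.map_smul, ha, mul_one, inv_inv,
      smul_smul, mul_inv_cancel₀ h, one_smul]
  · intro a ha
    simp only [Finset.mem_filter, Finset.mem_univ, true_and] at ha
    have h0 := units_smul_ne_zero c (hs.ne_zero_of_eq_one ha)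
    exact (hf _ (inv_ne_zero (hs.ne_zero _ h0)) _ h0).symm

section Pairing

variable {R : Type*} [CommRing R] {h : A → R} {s : A → F}

/-- The function by which multiplication by `c` changes the logarithmic sign `h`. It satisfies the
cocycle identity `logShift h (a * c) x = logShift h a (c * x) + logShift h c x`. -/
def logShift (h : A → R) (c : Aˣ) (x : A) : R := h (c * x) - h x

/-- The commutator pairing of the cup square of the cocycle `c ↦ logShift h c`. -/
def logPairing (h : A → R) (s : A → F) (a c : Aˣ) : R :=
  ∑ x with s x = 1, (logShift h c x * logShift h a (c * x) - logShift h a x * logShift h c (a * x))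

theorem logPairing_swap (a c : Aˣ) : logPairing h s a c = -logPairing h s c a := by
  rw [logPairing, logPairing, ← Finset.sum_neg_distrib]
  exact Finset.sum_congr rfl fun x _ => by ring

theorem logPairing_self (a : Aˣ) : logPairing h s a a = 0 := by
  rw [logPairing]
  exact Finset.sum_eq_zero fun x _ => by ring

variable {lg : F → R}

theorem logShift_smul (hh : ∀ β : F, β ≠ 0 → ∀ a : A, a ≠ 0 → h (β • a) = lg β + h a) (c : Aˣ)
    {β : F} (hβ : β ≠ 0) {a : A} (ha : a ≠ 0) : logShift h c (β • a) = logShift h c a := by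
  rw [logShift, logShift, mul_smul_comm, hh β hβ _ (units_smul_ne_zero c ha), hh β hβ _ ha]
  ring

theorem logPairing_mul (hs : IsSign s)
    (hh : ∀ β : F, β ≠ 0 → ∀ a : A, a ≠ 0 → h (β • a) = lg β + h a) (a b c : Aˣ) :
    logPairing h s (a * b) c = logPairing h s a c + logPairing h s b c := by
  have h1 : ∀ (u : Aˣ) {β : F}, β ≠ 0 → ∀ {x : A}, x ≠ 0 → logShift h u (β • x) = logShift h u x :=
    fun u β hβ x hx => logShift_smul hh u hβ hx
  have e1 : logPairing h s a c = ∑ x with s x = 1,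
      (logShift h c (b * x) * logShift h a (c * (b * x)) -
        logShift h a (b * x) * logShift h c (a * (b * x))) := by
    rw [logPairing]
    refine (sum_section_mul hs b (fun x => logShift h c x * logShift h a (c * x) -
      logShift h a x * logShift h c (a * x)) ?_).symm
    intro β hβ x hx
    simp only [mul_smul_comm, h1 _ hβ hx, h1 _ hβ (units_smul_ne_zero _ hx)]
  have e2 : ∑ x with s x = 1, logShift h b (c * x) * logShift h a (b * (c * x)) =
      ∑ x with s x = 1, logShift h b x * logShift h a (b * x) := by
    refine sum_section_mul hs c (fun x => logShift h b x * logShift h a (b * x)) ?_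
    intro β hβ x hx
    simp only [mul_smul_comm, h1 _ hβ hx, h1 _ hβ (units_smul_ne_zero _ hx)]
  rw [e1, logPairing, logPairing, ← Finset.sum_add_distrib, ← sub_eq_zero,
    ← Finset.sum_sub_distrib]
  rw [eq_comm, ← sub_eq_zero, ← Finset.sum_sub_distrib] at e2
  rw [← e2]
  refine Finset.sum_congr rfl fun x _ => ?_
  simp only [logShift, Units.val_mul, mul_assoc]
  rw [mul_left_comm (c : A) (b : A) x, mul_left_comm (c : A) (a : A),
    mul_left_comm (c : A) (b : A) x]
  ring

/-- The pairing is bilinear and alternating, hence trivial on a cyclic group. -/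
theorem logPairing_eq_zero (hs : IsSign s)
    (hh : ∀ β : F, β ≠ 0 → ∀ a : A, a ≠ 0 → h (β • a) = lg β + h a) [IsCyclic Aˣ] (a c : Aˣ) :
    logPairing h s a c = 0 := by
  obtain ⟨g, hg⟩ := IsCyclic.exists_generator (α := Aˣ)
  let φ (c : Aˣ) : Aˣ →* Multiplicative R :=
    MonoidHom.mk' (fun a => Multiplicative.ofAdd (logPairing h s a c)) fun a b => by
      rw [logPairing_mul hs hh]; rfl
  have key : ∀ c, logPairing h s g c = 0 → ∀ a, logPairing h s a c = 0 := by
    intro c hc a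
    have h1 : Subgroup.zpowers g ≤ (φ c).ker := by
      rw [Subgroup.zpowers_le]
      exact hc
    exact h1 (hg a)
  refine key c ?_ a
  rw [logPairing_swap, key g (logPairing_self g) c, neg_zero]

end Pairing

section Main

variable {R M : Type*} [CommRing R] [AddCommGroup M] [Module R M] {lg : F → R}

theorem sum_eq_zero_add {Z : Type*} [AddCommGroup Z] [Fintype Z] (f : Z → M) :
    ∑ z, f z = f 0 + ∑ z with z ≠ 0, f z := by
  rw [← Finset.add_sum_erase _ _ (Finset.mem_univ (0 : Z)), Finset.filter_ne']

/-- The error term of `sum_divisor_sub` vanishes. The function `E x - h x • g₀`, where `h = lg ∘ s`,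
is invariant under `F^*`, so its contribution cancels by substitution; what `h • g₀` contributes is
the pairing `logPairing`. -/
theorem sum_logShift_smul_eq_zero {s : A → F} (hs : IsSign s)
    (hlg : ∀ a b : F, a ≠ 0 → b ≠ 0 → lg (a * b) = lg a + lg b) [IsCyclic Aˣ]
    {E : A → M} {g₀ : M} (hE : ∀ β : F, β ≠ 0 → ∀ x : A, x ≠ 0 → E (β • x) = lg β • g₀ + E x)
    (a c : Aˣ) :
    ∑ x with s x = 1, (logShift (lg ∘ s) c x • (E (a * (c * x)) - E (c * x)) -
      logShift (lg ∘ s) a x • (E (a * (c * x)) - E (a * x))) = 0 := by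
  set h : A → R := lg ∘ s with hh'
  have hh : ∀ β : F, β ≠ 0 → ∀ a : A, a ≠ 0 → h (β • a) = lg β + h a := by
    intro β hβ x hx
    simp only [hh', Function.comp, hs.map_smul]
    exact hlg _ _ hβ (hs.ne_zero x hx)
  obtain ⟨S, hS⟩ : ∃ S : A → M, ∀ x, E x = h x • g₀ + S x := ⟨fun x => E x - h x • g₀, by simp⟩
  have hSinv : ∀ β : F, β ≠ 0 → ∀ x : A, x ≠ 0 → S (β • x) = S x := by
    intro β hβ x hx
    have := hE β hβ x hx
    rw [hS, hS, hh β hβ x hx] at this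
    have h2 : S (β • x) = (lg β • g₀ + (h x • g₀ + S x)) - (lg β + h x) • g₀ := by
      rw [← this]; abel
    rw [h2, add_smul]; abel
  have h1 : ∀ (u : Aˣ) {β : F}, β ≠ 0 → ∀ {x : A}, x ≠ 0 → logShift h u (β • x) = logShift h u x :=
    fun u β hβ x hx => logShift_smul hh u hβ hx
  have e1 : ∑ x with s x = 1, logShift h c (a * x) • S (c * (a * x)) =
      ∑ x with s x = 1, logShift h c x • S (c * x) := by
    refine sum_section_mul hs a (fun x => logShift h c x • S (c * x)) ?_
    intro β hβ x hx
    simp only [mul_smul_comm, h1 _ hβ hx, hSinv β hβ _ (units_smul_ne_zero _ hx)]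
  have e2 : ∑ x with s x = 1, logShift h a (c * x) • S (a * (c * x)) =
      ∑ x with s x = 1, logShift h a x • S (a * x) := by
    refine sum_section_mul hs c (fun x => logShift h a x • S (a * x)) ?_
    intro β hβ x hx
    simp only [mul_smul_comm, h1 _ hβ hx, hSinv β hβ _ (units_smul_ne_zero _ hx)]
  have e3 := congrArg (· • g₀) (logPairing_eq_zero hs hh a c)
  simp only [logPairing, zero_smul, Finset.sum_smul] at e3
  have e4 : ∑ x with s x = 1, (logShift h c x • (E (a * (c * x)) - E (c * x)) -
      logShift h a x • (E (a * (c * x)) - E (a * x))) =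
      ∑ x with s x = 1, (logShift h c x * logShift h a (c * x) -
        logShift h a x * logShift h c (a * x)) • g₀ +
      (∑ x with s x = 1, logShift h c (a * x) • S (c * (a * x)) -
        ∑ x with s x = 1, logShift h c x • S (c * x)) -
      (∑ x with s x = 1, logShift h a (c * x) • S (a * (c * x)) -
        ∑ x with s x = 1, logShift h a x • S (a * x)) := by
    simp only [← Finset.sum_add_distrib, ← Finset.sum_sub_distrib]
    refine Finset.sum_congr rfl fun x _ => ?_
    simp only [hS, logShift, mul_left_comm (c : A) (a : A)]
    module
  rw [e4, e3, e1, e2]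
  simp

/-- The change of the divisor sum defining `u_{PQ}` under multiplication by a unit `c` of the
first factor. Here `A` and `B` stand for the residue rings modulo `P` and `Q`, `w a b` for the leading
coefficient of the polynomial of degree less than `deg P + deg Q` in the classes `a`, `b`, and `E a b`
for the class of its torsion point modulo `(q - 1)`-th powers. -/
theorem sum_divisor_sub {B : Type*} [AddCommGroup B] [Module F B] [Fintype B]
    {s : A → F} {t : B → F} {w : A → B → F} (hs : IsSign s) (ht : IsSign t)
    (hw : ∀ β : F, ∀ a b, w (β • a) (β • b) = β * w a b)
    (hw0 : ∀ a b, a ≠ 0 → w a b ≠ 0)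
    (hlg : ∀ a b : F, a ≠ 0 → b ≠ 0 → lg (a * b) = lg a + lg b) (hlg0 : lg 0 = 0) [IsCyclic Aˣ]
    {E : A → B → M} {E' : A → M} {g₀ : M}
    (hE : ∀ β : F, β ≠ 0 → ∀ a b, a ≠ 0 → E (β • a) (β • b) = lg β • g₀ + E a b)
    (hE' : ∀ β : F, β ≠ 0 → ∀ a, a ≠ 0 → E' (β • a) = lg β • g₀ + E' a)
    (hdist : ∀ a, a ≠ 0 → ∑ b, E a b = E' a) {v : Aˣ}
    (hE0 : ∀ a, a ≠ 0 → E a 0 = E' (v * a)) (hw1 : ∀ a, a ≠ 0 → lg (w a 0) = lg (s (v * a)))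
    (c : Aˣ) :
    ∑ b with t b = 1, ∑ a, lg (w a b) • (E (c * a) b - E a b) -
      ∑ a with s a = 1, ∑ b, lg (w a b) • (E (c * a) b - E a b) =
    ((∑ b, lg (t b)) * ∑ a with s a = 1, lg (s (c * a))) • g₀ := by
  have hlg1 : lg 1 = 0 := by simpa using hlg 1 1 one_ne_zero one_ne_zero
  have eA : ∑ b with t b = 1, ∑ a, lg (w a b) • (E (c * a) b - E a b) =
      ∑ b with t b = 1, ∑ a with a ≠ 0, lg (w a b) • (E (c * a) b - E a b) := by
    refine Finset.sum_congr rfl fun b _ => ?_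
    rw [sum_eq_zero_add]
    simp
  -- Subtracting `lg (s a)` from `lg (w a b)` makes the summand invariant under `F^*`, so that the
  -- sum can be normalized at `b`; on `s a = 1` the subtracted term is zero.
  have eB : ∑ a with s a = 1, ∑ b, lg (w a b) • (E (c * a) b - E a b) =
      ∑ a with s a = 1, lg (s (v * a)) • (E' (v * (c * a)) - E' (v * a)) +
      ∑ b with t b = 1, ∑ a with a ≠ 0, (lg (w a b) - lg (s a)) • (E (c * a) b - E a b) := by
    rw [sum_section_swap hs ht, ← Finset.sum_add_distrib]
    · refine Finset.sum_congr rfl fun a ha => ?_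
      simp only [Finset.mem_filter, Finset.mem_univ, true_and] at ha
      have ha0 := hs.ne_zero_of_eq_one ha
      rw [sum_eq_zero_add, hw1 a ha0, hE0 a ha0, hE0 _ (units_smul_ne_zero c ha0), ha, hlg1]
      simp only [sub_zero]
    · intro β hβ a b ha hb
      rw [hw, hs.map_smul, hlg _ _ hβ (hw0 a b ha), hlg _ _ hβ (hs.ne_zero a ha), mul_smul_comm,
        hE β hβ _ _ (units_smul_ne_zero c ha), hE β hβ _ _ ha]
      module
  have eC : ∀ b, ∑ a with a ≠ 0, lg (s a) • (E (c * a) b - E a b) =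
      -∑ a with a ≠ 0, logShift (lg ∘ s) c a • E (c * a) b := by
    intro b
    have h1 : ∑ a with a ≠ 0, lg (s (c * a)) • E (c * a) b = ∑ a with a ≠ 0, lg (s a) • E a b := by
      refine Finset.sum_equiv (Units.mulLeft c) ?_ ?_
      · intro a; simp
      · intro a _; rfl
    simp only [logShift, Function.comp, smul_sub, sub_smul, Finset.sum_sub_distrib, h1]
    abel
  -- Subtracting `lg (t b) • g₀` from `E` makes the summand invariant under `F^*`. After the
  -- normalization is moved to `a`, the sum over `b` is given by the distribution relation.
  have eD : ∑ b with t b = 1, ∑ a with a ≠ 0, logShift (lg ∘ s) c a • E (c * a) b =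
      ∑ a with s a = 1, logShift (lg ∘ s) c a • (E' (c * a) - E' (v * (c * a)) -
        (∑ b, lg (t b)) • g₀) := by
    have h1 : ∑ b with t b = 1, ∑ a with a ≠ 0, logShift (lg ∘ s) c a • E (c * a) b =
        ∑ b with t b = 1, ∑ a with a ≠ 0,
          logShift (lg ∘ s) c a • (E (c * a) b - lg (t b) • g₀) := by
      refine Finset.sum_congr rfl fun b hb => ?_
      simp only [Finset.mem_filter, Finset.mem_univ, true_and] at hb
      rw [hb, hlg1]
      simp
    rw [h1, sum_section_swap hs ht]
    · refine Finset.sum_congr rfl fun a ha => ?_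
      simp only [Finset.mem_filter, Finset.mem_univ, true_and] at ha
      have ha0 := units_smul_ne_zero c (hs.ne_zero_of_eq_one ha)
      have h2 := hdist _ ha0
      rw [sum_eq_zero_add, hE0 _ ha0] at h2
      rw [← Finset.smul_sum, Finset.sum_sub_distrib, ← Finset.sum_smul, ← h2,
        sum_eq_zero_add fun b => lg (t b), ht.map_zero, hlg0]
      module
    · intro β hβ a b ha hb
      rw [mul_smul_comm, hE β hβ _ _ (units_smul_ne_zero c ha), ht.map_smul,
        hlg _ _ hβ (ht.ne_zero b hb), logShift_smul (lg := lg) _ c hβ ha]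
      · module
      · intro β hβ x hx
        simp only [Function.comp, hs.map_smul]
        exact hlg _ _ hβ (hs.ne_zero x hx)
  have eE : ∑ b with t b = 1, ∑ a with a ≠ 0, lg (w a b) • (E (c * a) b - E a b) -
      ∑ b with t b = 1, ∑ a with a ≠ 0, (lg (w a b) - lg (s a)) • (E (c * a) b - E a b) =
      -∑ b with t b = 1, ∑ a with a ≠ 0, logShift (lg ∘ s) c a • E (c * a) b := by
    rw [← Finset.sum_sub_distrib, ← Finset.sum_neg_distrib]
    refine Finset.sum_congr rfl fun b _ => ?_
    rw [← eC, ← Finset.sum_sub_distrib]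
    exact Finset.sum_congr rfl fun a _ => by module
  have eF := sum_logShift_smul_eq_zero hs hlg hE' v c
  rw [eA, eB, sub_add_eq_sub_sub_swap, eE, eD]
  generalize ∑ b, lg (t b) = κ
  rw [← sub_eq_zero, ← eF, Finset.mul_sum,
    Finset.sum_smul, ← Finset.sum_neg_distrib, ← Finset.sum_sub_distrib, ← Finset.sum_sub_distrib]
  refine Finset.sum_congr rfl fun a ha => ?_
  simp only [Finset.mem_filter, Finset.mem_univ, true_and] at ha
  simp only [logShift, Function.comp, ha, hlg1, sub_zero]
  module

end Main

end SectionSums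

end

/-! ### Residues of polynomials and the Chinese remainder theorem -/

section

open scoped Classical
variable {F : Type*} [Field F] [Fintype F]

@[simp]
theorem mem_monicsLT {d : ℕ} {a : F[X]} : a ∈ monicsLT F d ↔ a.Monic ∧ a.natDegree < d := by
  simp [monicsLT]

theorem monic_mem_polysLT {d : ℕ} {a : F[X]} (ha : a.Monic) :
    a ∈ polysLT F d ↔ a.natDegree < d := by
  rw [mem_polysLT, Polynomial.degree_eq_natDegree ha.ne_zero]
  exact_mod_cast Iff.rfl

/-- Every nonzero polynomial is uniquely a constant times a monic polynomial. -/
theorem prod_polysLT_erase {M : Type*} [CommMonoid M] (d : ℕ) (f : F[X] → M) :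
    ∏ a ∈ (polysLT F d).erase 0, f a =
      ∏ a ∈ monicsLT F d, ∏ β : Fˣ, f (Polynomial.C β.1 * a) := by
  rw [← Finset.prod_product']
  symm
  refine Finset.prod_nbij (fun z => Polynomial.C z.2.1 * z.1) ?_ ?_ ?_ (fun _ _ => rfl)
  · rintro ⟨a, β⟩ h
    simp only [Finset.mem_product, mem_monicsLT, Finset.mem_univ, and_true] at h
    have hC : Polynomial.C β.1 ≠ 0 := by simp
    simp only [Finset.mem_erase, mem_polysLT, Polynomial.degree_mul,
      Polynomial.degree_C β.ne_zero, zero_add]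
    exact ⟨mul_ne_zero hC h.1.ne_zero, mem_polysLT.1 ((monic_mem_polysLT h.1).2 h.2)⟩
  · rintro ⟨a, β⟩ h ⟨b, δ⟩ h' hab
    simp only [Finset.coe_product, Set.mem_prod, Finset.mem_coe, mem_monicsLT, Finset.mem_univ,
      and_true] at h h'
    have h1 := congrArg Polynomial.leadingCoeff hab
    simp only [Polynomial.leadingCoeff_mul, Polynomial.leadingCoeff_C, h.1.leadingCoeff,
      h'.1.leadingCoeff, mul_one] at h1
    have h2 : β = δ := Units.ext h1
    subst h2
    have hC : Polynomial.C β.1 ≠ 0 := by simp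
    rw [Prod.mk.injEq]
    exact ⟨mul_left_cancel₀ hC hab, rfl⟩
  · intro a ha
    simp only [Finset.coe_erase, Set.mem_sdiff, Finset.mem_coe, mem_polysLT,
      Set.mem_singleton_iff] at ha
    have hl : a.leadingCoeff ≠ 0 := by simpa using ha.2
    have hm : (Polynomial.C a.leadingCoeff⁻¹ * a).Monic := by
      rw [Polynomial.Monic, Polynomial.leadingCoeff_mul, Polynomial.leadingCoeff_C,
        inv_mul_cancel₀ hl]
    refine ⟨(Polynomial.C a.leadingCoeff⁻¹ * a, Units.mk0 _ hl), ?_, ?_⟩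
    · simp only [Finset.coe_product, Set.mem_prod, Finset.mem_coe, Finset.coe_univ,
        Set.mem_univ, and_true]
      rw [mem_monicsLT]
      refine ⟨hm, (monic_mem_polysLT hm).1 ?_⟩
      rw [mem_polysLT, Polynomial.degree_mul, Polynomial.degree_C (inv_ne_zero hl), zero_add]
      exact ha.1
    · simp only [Units.val_mk0]
      rw [← mul_assoc, ← Polynomial.C_mul, mul_inv_cancel₀ hl, Polynomial.C_1, one_mul]

theorem sum_polysLT_erase {M : Type*} [AddCommMonoid M] (d : ℕ) (f : F[X] → M) :
    ∑ a ∈ (polysLT F d).erase 0, f a =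
      ∑ a ∈ monicsLT F d, ∑ β : Fˣ, f (Polynomial.C β.1 * a) :=
  prod_polysLT_erase (M := Multiplicative M) d f

section Residues

variable {D : F[X]}

/-- The leading coefficient of the representative of minimal degree of a residue class. -/
def residueSign (hD : D.Monic) (x : AdjoinRoot D) : F :=
  (AdjoinRoot.modByMonicHom hD x).leadingCoeff

theorem mk_modByMonicHom (hD : D.Monic) (x : AdjoinRoot D) :
    AdjoinRoot.mk D (AdjoinRoot.modByMonicHom hD x) = x :=
  AdjoinRoot.mk_leftInverse hD x

theorem modByMonicHom_mem (hD : D.Monic) (x : AdjoinRoot D) :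
    AdjoinRoot.modByMonicHom hD x ∈ polysLT F D.natDegree := by
  obtain ⟨a, rfl⟩ := AdjoinRoot.mk_surjective x
  rw [AdjoinRoot.modByMonicHom_mk, mem_polysLT, ← Polynomial.degree_eq_natDegree hD.ne_zero]
  exact Polynomial.degree_modByMonic_lt _ hD

theorem modByMonicHom_mk_of_mem (hD : D.Monic) {a : F[X]} (ha : a ∈ polysLT F D.natDegree) :
    AdjoinRoot.modByMonicHom hD (AdjoinRoot.mk D a) = a := by
  rw [AdjoinRoot.modByMonicHom_mk, Polynomial.modByMonic_eq_self_iff hD,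
    Polynomial.degree_eq_natDegree hD.ne_zero]
  exact mem_polysLT.1 ha

theorem isSign_residueSign (hD : D.Monic) : IsSign (residueSign hD) where
  map_smul β x := by
    rw [residueSign, map_smul, Polynomial.smul_eq_C_mul, Polynomial.leadingCoeff_mul,
      Polynomial.leadingCoeff_C]
    rfl
  ne_zero x hx := by
    rw [residueSign, Polynomial.leadingCoeff_ne_zero]
    intro h
    apply hx
    rw [← mk_modByMonicHom hD x, h, map_zero]

theorem finite_adjoinRoot (hD : D.Monic) : Finite (AdjoinRoot D) :=
  Finite.of_injective
    (fun x => (⟨AdjoinRoot.modByMonicHom hD x, modByMonicHom_mem hD x⟩ : polysLT F D.natDegree))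
    fun _ _ h => (AdjoinRoot.mk_leftInverse hD).injective (Subtype.ext_iff.1 h)

variable [Fintype (AdjoinRoot D)]

theorem sum_adjoinRoot {M : Type*} [AddCommMonoid M] (hD : D.Monic) (f : AdjoinRoot D → M) :
    ∑ x, f x = ∑ a ∈ polysLT F D.natDegree, f (AdjoinRoot.mk D a) := by
  refine Finset.sum_bij' (fun x _ => AdjoinRoot.modByMonicHom hD x)
    (fun a _ => AdjoinRoot.mk D a) (fun x _ => modByMonicHom_mem hD x) (by simp)
    (fun x _ => mk_modByMonicHom hD x) (fun a ha => modByMonicHom_mk_of_mem hD ha) ?_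
  intro x _
  rw [mk_modByMonicHom]

/-- The residue classes of sign `1` are those of the monic polynomials of degree less than `deg D`.
-/
theorem sum_adjoinRoot_sign {M : Type*} [AddCommMonoid M] (hD : D.Monic) (f : AdjoinRoot D → M) :
    ∑ x with residueSign hD x = 1, f x =
      ∑ a ∈ monicsLT F D.natDegree, f (AdjoinRoot.mk D a) := by
  refine Finset.sum_bij' (fun x _ => AdjoinRoot.modByMonicHom hD x)
    (fun a _ => AdjoinRoot.mk D a) ?_ ?_
    (fun x _ => mk_modByMonicHom hD x) ?_ ?_
  · intro x hx
    simp only [Finset.mem_filter, Finset.mem_univ, true_and] at hx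
    have hm : (AdjoinRoot.modByMonicHom hD x).Monic := hx
    exact mem_monicsLT.2 ⟨hm, (monic_mem_polysLT hm).1 (modByMonicHom_mem hD x)⟩
  · intro a ha
    rw [mem_monicsLT] at ha
    simp only [Finset.mem_filter, Finset.mem_univ, true_and]
    rw [residueSign, modByMonicHom_mk_of_mem hD ((monic_mem_polysLT ha.1).2 ha.2)]
    exact ha.1
  · intro a ha
    rw [mem_monicsLT] at ha
    exact modByMonicHom_mk_of_mem hD ((monic_mem_polysLT ha.1).2 ha.2)
  · intro x _
    rw [mk_modByMonicHom]

/-- For `N` prime to `D`, the polynomials `c + b N`, `deg b < deg D`, represent the residue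
classes modulo `D`. -/
theorem sum_adjoinRoot_add_mul {M : Type*} [AddCommMonoid M] (hD : D.Monic) {N : F[X]}
    (hN : IsCoprime D N) (c : F[X]) (f : AdjoinRoot D → M) :
    ∑ x, f x = ∑ b ∈ polysLT F D.natDegree, f (AdjoinRoot.mk D (c + b * N)) := by
  have hinj : Set.InjOn (fun b => AdjoinRoot.mk D (c + b * N)) (polysLT F D.natDegree) := by
    intro a ha b hb hab
    rw [AdjoinRoot.mk_eq_mk, add_sub_add_left_eq_sub, ← sub_mul] at hab
    refine sub_eq_zero.1 (Polynomial.eq_zero_of_dvd_of_degree_lt (hN.dvd_of_dvd_mul_right hab) ?_)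
    refine (Polynomial.degree_sub_le _ _).trans_lt ?_
    rw [Polynomial.degree_eq_natDegree hD.ne_zero]
    exact max_lt (mem_polysLT.1 ha) (mem_polysLT.1 hb)
  have hc : Fintype.card (AdjoinRoot D) = (polysLT F D.natDegree).card := by
    simpa using sum_adjoinRoot (M := ℕ) hD fun _ => 1
  have himg : (polysLT F D.natDegree).image (fun b => AdjoinRoot.mk D (c + b * N)) =
      Finset.univ := by
    apply Finset.eq_univ_of_card
    rw [Finset.card_image_of_injOn hinj, hc]
  rw [← himg, Finset.sum_image hinj]

end Residues

section CRT

variable {P Q : F[X]}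

/-- The representative modulo `P Q` of a pair of residue classes; here `P P' + Q Q' = 1`. -/
def crtRep (hP : P.Monic) (hQ : Q.Monic) (P' Q' : F[X]) (a : AdjoinRoot P) (b : AdjoinRoot Q) :
    F[X] :=
  (AdjoinRoot.modByMonicHom hP a * (Q * Q') + AdjoinRoot.modByMonicHom hQ b * (P * P')) %ₘ (P * Q)

variable (hP : P.Monic) (hQ : Q.Monic) {P' Q' : F[X]} (h : P * P' + Q * Q' = 1)

theorem crtRep_smul (β : F) (a : AdjoinRoot P) (b : AdjoinRoot Q) :
    crtRep hP hQ P' Q' (β • a) (β • b) = Polynomial.C β * crtRep hP hQ P' Q' a b := by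
  simp only [crtRep, map_smul, ← Polynomial.smul_eq_C_mul, ← Polynomial.smul_modByMonic]
  congr 1
  simp only [smul_add, smul_mul_assoc]

include h in
theorem crtRep_mk (x : F[X]) :
    crtRep hP hQ P' Q' (AdjoinRoot.mk P x) (AdjoinRoot.mk Q x) = x %ₘ (P * Q) := by
  have h1 : P ∣ x - AdjoinRoot.modByMonicHom hP (AdjoinRoot.mk P x) := by
    rw [← AdjoinRoot.mk_eq_mk, mk_modByMonicHom]
  have h2 : Q ∣ x - AdjoinRoot.modByMonicHom hQ (AdjoinRoot.mk Q x) := by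
    rw [← AdjoinRoot.mk_eq_mk, mk_modByMonicHom]
  have hd : AdjoinRoot.mk (P * Q) (AdjoinRoot.modByMonicHom hP (AdjoinRoot.mk P x) * (Q * Q') +
      AdjoinRoot.modByMonicHom hQ (AdjoinRoot.mk Q x) * (P * P')) = AdjoinRoot.mk (P * Q) x := by
    rw [eq_comm, AdjoinRoot.mk_eq_mk]
    obtain ⟨u, hu⟩ := h1
    obtain ⟨v, hv⟩ := h2
    refine ⟨u * Q' + v * P', ?_⟩
    linear_combination x * (-1 : F[X]) * h + Q * Q' * hu + P * P' * hv
  rw [crtRep, ← AdjoinRoot.modByMonicHom_mk (hP.mul hQ), hd, AdjoinRoot.modByMonicHom_mk]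

include h in
/-- `crtRep` is a section of the isomorphism of the Chinese remainder theorem. -/
theorem mk_crtRep (a : AdjoinRoot P) (b : AdjoinRoot Q) :
    AdjoinRoot.mk P (crtRep hP hQ P' Q' a b) = a ∧
      AdjoinRoot.mk Q (crtRep hP hQ P' Q' a b) = b := by
  set x := AdjoinRoot.modByMonicHom hP a * (Q * Q') + AdjoinRoot.modByMonicHom hQ b * (P * P')
    with hx
  have hd : P * Q ∣ crtRep hP hQ P' Q' a b - x := by
    rw [crtRep, Polynomial.modByMonic_eq_sub_mul_div, sub_sub_cancel_left, dvd_neg]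
    exact dvd_mul_right _ _
  have h1 := AdjoinRoot.mk_eq_mk.2 ((dvd_mul_right P Q).trans hd)
  have h2 := AdjoinRoot.mk_eq_mk.2 ((dvd_mul_left Q P).trans hd)
  rw [h1, h2]
  constructor
  · conv_rhs => rw [← mk_modByMonicHom hP a]
    rw [AdjoinRoot.mk_eq_mk]
    refine ⟨P' * (AdjoinRoot.modByMonicHom hQ b - AdjoinRoot.modByMonicHom hP a), ?_⟩
    rw [hx]
    linear_combination AdjoinRoot.modByMonicHom hP a * h
  · conv_rhs => rw [← mk_modByMonicHom hQ b]
    rw [AdjoinRoot.mk_eq_mk]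
    refine ⟨Q' * (AdjoinRoot.modByMonicHom hP a - AdjoinRoot.modByMonicHom hQ b), ?_⟩
    rw [hx]
    linear_combination AdjoinRoot.modByMonicHom hQ b * h

theorem crtRep_comm (a : AdjoinRoot P) (b : AdjoinRoot Q) :
    crtRep hQ hP Q' P' b a = crtRep hP hQ P' Q' a b := by
  rw [crtRep, crtRep, add_comm, mul_comm Q P]

end CRT

end

/-! ### Discrete logarithms of sign functions -/

section

open scoped Classical
variable {F : Type*} [Field F] [Fintype F]

section DiscreteLog

/-- The discrete logarithm `F^* → ℤ/(q-1)` to the base `γ`, extended by `0`. -/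
def dlog (γ : Fˣ) (hγ : ∀ x : Fˣ, x ∈ Subgroup.zpowers γ) (x : F) : ZMod (Fintype.card F - 1) :=
  if h : x = 0 then 0
  else ((mem_powers_iff_mem_zpowers.2 (hγ (Units.mk0 x h))).choose : ℕ)

variable {γ : Fˣ} (hγ : ∀ x : Fˣ, x ∈ Subgroup.zpowers γ)

include hγ in
theorem orderOf_generator : orderOf γ = Fintype.card F - 1 := by
  rw [orderOf_eq_card_of_forall_mem_zpowers hγ, Nat.card_eq_fintype_card, Fintype.card_units]

@[simp]
theorem dlog_zero : dlog γ hγ 0 = 0 := by simp [dlog]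

theorem dlog_pow (s : ℕ) : dlog γ hγ (γ ^ s : Fˣ).1 = s := by
  rw [dlog, dif_neg (γ ^ s).ne_zero]
  have h := (mem_powers_iff_mem_zpowers.2 (hγ (Units.mk0 _ (γ ^ s).ne_zero))).choose_spec
  rw [ZMod.natCast_eq_natCast_iff, ← orderOf_generator hγ]
  exact pow_eq_pow_iff_modEq.1 (h.trans (Units.mk0_val _ _))

include hγ in
theorem exists_pow_eq (x : Fˣ) : ∃ s : ℕ, γ ^ s = x := mem_powers_iff_mem_zpowers.2 (hγ x)

theorem dlog_mul (a b : F) (ha : a ≠ 0) (hb : b ≠ 0) :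
    dlog γ hγ (a * b) = dlog γ hγ a + dlog γ hγ b := by
  obtain ⟨s, hs⟩ := exists_pow_eq hγ (Units.mk0 a ha)
  obtain ⟨t, ht⟩ := exists_pow_eq hγ (Units.mk0 b hb)
  have ha' : a = (γ ^ s : Fˣ).1 := by rw [hs]; rfl
  have hb' : b = (γ ^ t : Fˣ).1 := by rw [ht]; rfl
  rw [ha', hb', ← Units.val_mul, ← pow_add, dlog_pow, dlog_pow, dlog_pow, Nat.cast_add]

include hγ in
theorem sum_units_eq {M : Type*} [AddCommMonoid M] (f : Fˣ → M) :
    ∑ β, f β = ∑ s ∈ Finset.range (Fintype.card F - 1), f (γ ^ s) := by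
  rw [← IsCyclic.image_range_orderOf hγ, orderOf_generator hγ, Finset.sum_image]
  intro s hs t ht hst
  rw [Finset.coe_range, Set.mem_Iio, ← orderOf_generator hγ] at hs ht
  exact pow_injOn_Iio_orderOf hs ht hst

theorem sum_dlog_smul {M : Type*} [AddCommGroup M] [Module (ZMod (Fintype.card F - 1)) M]
    (f : Fˣ → M) : ∑ β : Fˣ, dlog γ hγ β.1 • f β =
      ∑ s ∈ Finset.Icc 1 (Fintype.card F - 2), (s : ZMod (Fintype.card F - 1)) • f (γ ^ s) := by
  have hq : 1 < Fintype.card F := Fintype.one_lt_card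
  rw [sum_units_eq hγ]
  have h1 : Finset.range (Fintype.card F - 1) = insert 0 (Finset.Icc 1 (Fintype.card F - 2)) := by
    ext s
    simp only [Finset.mem_range, Finset.mem_insert, Finset.mem_Icc]
    lia
  rw [h1, Finset.sum_insert (by simp), dlog_pow]
  simp only [Nat.cast_zero, zero_smul, zero_add, dlog_pow]

end DiscreteLog

section DivisorSum

variable {γ : Fˣ} (hγ : ∀ x : Fˣ, x ∈ Subgroup.zpowers γ) {P Q : F[X]}
  (hP : P.Monic) (hQ : Q.Monic) {P' Q' : F[X]} (h : P * P' + Q * Q' = 1)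
  [Fintype (AdjoinRoot P)] [Fintype (AdjoinRoot Q)]
  {M : Type*} [AddCommGroup M] [Module (ZMod (Fintype.card F - 1)) M]

include h in
/-- One half of the divisor `a_{PQ}`, written as a sum over pairs of residue classes. -/
theorem sum_half_divisor (f : F[X] → M) (hf : ∀ (β : Fˣ) a, f (Polynomial.C β.1 * a) = f a) :
    ∑ A ∈ monicsLT F Q.natDegree, ∑ B ∈ monicsLT F P.natDegree,
      ∑ s ∈ Finset.Icc 1 (Fintype.card F - 2), (s : ZMod (Fintype.card F - 1)) •
        f (B * Q + Polynomial.C ((γ ^ s)⁻¹ : Fˣ).1 * A) =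
    ∑ b with residueSign hQ b = 1, ∑ a,
      dlog γ hγ (crtRep hP hQ P' Q' a b).leadingCoeff • f (crtRep hP hQ P' Q' a b) := by
  rw [sum_adjoinRoot_sign]
  refine Finset.sum_congr rfl fun A hA => ?_
  rw [mem_monicsLT] at hA
  have hcop : IsCoprime P Q := ⟨P', Q', by linear_combination h⟩
  rw [sum_adjoinRoot_add_mul hP hcop A]
  have hA' : A.degree < Q.degree := by
    rw [Polynomial.degree_eq_natDegree hQ.ne_zero]
    exact mem_polysLT.1 ((monic_mem_polysLT hA.1).2 hA.2)
  have hrep : ∀ B ∈ polysLT F P.natDegree, crtRep hP hQ P' Q' (AdjoinRoot.mk P (A + B * Q))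
      (AdjoinRoot.mk Q A) = A + B * Q := by
    intro B hB
    have h1 : AdjoinRoot.mk Q A = AdjoinRoot.mk Q (A + B * Q) := by
      rw [AdjoinRoot.mk_eq_mk]
      exact ⟨-B, by ring⟩
    rw [h1, crtRep_mk hP hQ h, Polynomial.modByMonic_eq_self_iff (hP.mul hQ), Polynomial.degree_mul]
    by_cases hB0 : B = 0
    · rw [hB0, zero_mul, add_zero]
      refine hA'.trans_le ?_
      rw [← Polynomial.degree_mul, mul_comm]
      exact Polynomial.degree_le_mul_left _ hP.ne_zero
    · refine (Polynomial.degree_add_le _ _).trans_lt (max_lt ?_ ?_)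
      · refine hA'.trans_le ?_
        rw [← Polynomial.degree_mul, mul_comm]
        exact Polynomial.degree_le_mul_left _ hP.ne_zero
      · rw [Polynomial.degree_mul]
        refine WithBot.add_lt_add_right (by simpa using hQ.ne_zero) ?_
        rw [Polynomial.degree_eq_natDegree hP.ne_zero]
        exact mem_polysLT.1 hB
  rw [Finset.sum_congr rfl fun B hB =>
      congrArg (fun x : F[X] => dlog γ hγ x.leadingCoeff • f x) (hrep B hB),
    ← Finset.add_sum_erase _ _ (show (0 : F[X]) ∈ polysLT F P.natDegree by simp)]
  have h1 : dlog γ hγ 1 = 0 := by simpa using dlog_pow hγ 0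
  rw [zero_mul, add_zero, hA.1.leadingCoeff, h1, zero_smul, zero_add, sum_polysLT_erase]
  refine Finset.sum_congr rfl fun B hB => ?_
  rw [mem_monicsLT] at hB
  have h2 : ∀ β : Fˣ, (A + Polynomial.C β.1 * B * Q).leadingCoeff = β.1 := by
    intro β
    have hC : Polynomial.C β.1 * B ≠ 0 := mul_ne_zero (by simp) hB.1.ne_zero
    rw [Polynomial.leadingCoeff_add_of_degree_lt]
    · rw [Polynomial.leadingCoeff_mul, Polynomial.leadingCoeff_mul, Polynomial.leadingCoeff_C,
        hB.1.leadingCoeff, hQ.leadingCoeff, mul_one, mul_one]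
    · refine hA'.trans_le ?_
      rw [mul_comm]
      exact Polynomial.degree_le_mul_left _ hC
  simp only [h2]
  rw [sum_dlog_smul hγ fun β => f (A + Polynomial.C β.1 * B * Q)]
  refine Finset.sum_congr rfl fun s _ => ?_
  rw [← hf (γ ^ s) (B * Q + _), mul_add, ← mul_assoc (Polynomial.C _) (Polynomial.C _),
    ← Polynomial.C_mul, Units.mul_inv, Polynomial.C_1, one_mul, add_comm, mul_assoc]

end DivisorSum

section Symmetric

variable {A B R M : Type*} [CommRing A] [Algebra F A] [Fintype A] [CommRing B] [Algebra F B]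
  [Fintype B] [CommRing R] [AddCommGroup M] [Module R M] {lg : F → R}

/-- The change of the divisor sum defining `u_{PQ}` under multiplication by a pair of units. -/
theorem sum_divisor_sub_pair {s : A → F} {t : B → F} {w : A → B → F} (hs : IsSign s)
    (ht : IsSign t) (hw : ∀ β : F, ∀ a b, w (β • a) (β • b) = β * w a b)
    (hw0 : ∀ a b, a ≠ 0 ∨ b ≠ 0 → w a b ≠ 0)
    (hlg : ∀ a b : F, a ≠ 0 → b ≠ 0 → lg (a * b) = lg a + lg b) (hlg0 : lg 0 = 0)
    [IsCyclic Aˣ] [IsCyclic Bˣ]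
    {E : A → B → M} {EA : A → M} {EB : B → M} {g₀ : M}
    (hE : ∀ β : F, β ≠ 0 → ∀ a b, a ≠ 0 ∨ b ≠ 0 → E (β • a) (β • b) = lg β • g₀ + E a b)
    (hEA : ∀ β : F, β ≠ 0 → ∀ a, a ≠ 0 → EA (β • a) = lg β • g₀ + EA a)
    (hEB : ∀ β : F, β ≠ 0 → ∀ b, b ≠ 0 → EB (β • b) = lg β • g₀ + EB b)
    (hdA : ∀ a, a ≠ 0 → ∑ b, E a b = EA a) (hdB : ∀ b, b ≠ 0 → ∑ a, E a b = EB b)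
    {v : Aˣ} {v' : Bˣ}
    (hEA0 : ∀ a, a ≠ 0 → E a 0 = EA (v * a)) (hwA : ∀ a, a ≠ 0 → lg (w a 0) = lg (s (v * a)))
    (hEB0 : ∀ b, b ≠ 0 → E 0 b = EB (v' * b)) (hwB : ∀ b, b ≠ 0 → lg (w 0 b) = lg (t (v' * b)))
    (c : Aˣ) (d : Bˣ) :
    ∑ b with t b = 1, ∑ a, lg (w a b) • (E (c * a) (d * b) - E a b) -
      ∑ a with s a = 1, ∑ b, lg (w a b) • (E (c * a) (d * b) - E a b) =
    ((∑ b, lg (t b)) * ∑ a with s a = 1, lg (s (c * a))) • g₀ -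
      ((∑ a, lg (s a)) * ∑ b with t b = 1, lg (t (d * b))) • g₀ := by
  have h1 := sum_divisor_sub hs ht hw (fun a b ha => hw0 a b (Or.inl ha)) hlg hlg0
    (E := fun a b => E a (d * b)) (E' := EA) (g₀ := g₀) (v := v)
    (fun β hβ a b ha => by rw [mul_smul_comm, hE β hβ _ _ (Or.inl ha)]) hEA
    (fun a ha => by
      rw [← hdA a ha]
      exact Equiv.sum_comp (Units.mulLeft d) (fun b => E a b))
    (fun a ha => by rw [mul_zero, hEA0 a ha]) hwA c
  have h2 := sum_divisor_sub (w := fun b a => w a b) ht hs (fun β a b => hw β b a)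
    (fun b a hb => hw0 a b (Or.inr hb)) hlg hlg0
    (E := fun b a => E a b) (E' := EB) (g₀ := g₀) (v := v')
    (fun β hβ b a hb => hE β hβ a b (Or.inr hb)) hEB hdB hEB0 hwB d
  rw [← h1, ← h2]
  have key : ∀ a b, lg (w a b) • (E (c * a) (d * b) - E a b) =
      lg (w a b) • (E (c * a) (d * b) - E a (d * b)) + lg (w a b) • (E a (d * b) - E a b) :=
    fun a b => by rw [← smul_add, sub_add_sub_cancel]
  simp only [key, Finset.sum_add_distrib]
  abel

end Symmetric

end

/-! ### Invariance of the divisor sum under the Galois group -/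

section

open scoped Classical
variable {F : Type*} [Field F] [Fintype F]

section Parity

theorem card_monicsLT (d : ℕ) :
    (monicsLT F d).card = ∑ i ∈ Finset.range d, Fintype.card F ^ i := by
  have hq : 1 < Fintype.card F := Fintype.one_lt_card
  have h0 : (0 : F[X]) ∈ polysLT F d := by simp
  have h := sum_polysLT_erase (F := F) (M := ℕ) d fun _ => 1
  simp only [Finset.sum_const, Finset.card_erase_of_mem h0, card_polysLT, Finset.card_univ,
    Fintype.card_units, smul_eq_mul, mul_one] at h
  have h2 := Nat.geomSum_eq hq d
  rw [h2, h, Nat.mul_div_cancel _ (by lia)]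

theorem odd_card_monicsLT (hodd : ringChar F ≠ 2) (d : ℕ) :
    Odd (monicsLT F d).card ↔ Odd d := by
  rw [card_monicsLT]
  induction d with
  | zero => simp
  | succ d ih =>
    have := odd_card_pow hodd d
    rw [Finset.sum_range_succ, Nat.odd_add, ih]
    simp only [Nat.odd_iff, Nat.even_iff] at *
    lia

/-- Half of `q - 1` if `d` is odd, and zero otherwise: up to constants, the square root of `P` is
the product of the torsion points `e_C(ϖ B / P)`, `B` monic, to the power `(q - 1) / 2`. -/
def halfExp (F : Type*) [Fintype F] (d : ℕ) : ℕ := if Odd d then (Fintype.card F - 1) / 2 else 0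

theorem two_mul_half (hodd : ringChar F ≠ 2) :
    2 * ((Fintype.card F - 1) / 2) = Fintype.card F - 1 := by
  have h := FiniteField.odd_card_of_char_ne_two hodd
  have hq : 1 < Fintype.card F := Fintype.one_lt_card
  lia

theorem two_mul_halfExp (hodd : ringChar F ≠ 2) (d : ℕ) :
    (2 : ZMod (Fintype.card F - 1)) * (halfExp F d : ZMod (Fintype.card F - 1)) = 0 := by
  have h := two_mul_half hodd
  rw [halfExp]
  split_ifs
  · have h2 : ((2 * ((Fintype.card F - 1) / 2) : ℕ) : ZMod (Fintype.card F - 1)) = 0 := by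
      rw [h, ZMod.natCast_self]
    exact_mod_cast h2
  · simp

variable {γ : Fˣ} (hγ : ∀ x : Fˣ, x ∈ Subgroup.zpowers γ)

theorem sum_dlog (hodd : ringChar F ≠ 2) :
    ∑ β : Fˣ, dlog γ hγ β.1 = -(((Fintype.card F - 1) / 2 : ℕ) : ZMod (Fintype.card F - 1)) := by
  rw [sum_units_eq hγ]
  simp only [dlog_pow]
  have h := two_mul_half hodd
  have hq : 1 < Fintype.card F := Fintype.one_lt_card
  have h1 := Finset.sum_range_id_mul_two (Fintype.card F - 1)
  set n := Fintype.card F - 1 with hn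
  set m := n / 2 with hm
  have h2 : ∑ i ∈ Finset.range n, i + m = m * n := by
    obtain ⟨k, hk⟩ : ∃ k, n = k + 1 := ⟨n - 1, by lia⟩
    have : n - 1 = k := by lia
    rw [this] at h1
    have h3 : (∑ i ∈ Finset.range n, i) * 2 + 2 * m = (2 * m) * n := by
      rw [h1, h]; nth_rewrite 3 [hk]; ring
    nlinarith
  have h3 := congrArg (Nat.cast : ℕ → ZMod n) h2
  push_cast at h3
  rw [ZMod.natCast_self, mul_zero] at h3
  exact eq_neg_of_add_eq_zero_left h3

/-- The sum of the logarithmic signs of all residue classes modulo `D` is `(q - 1) / 2` if `deg D`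
is odd, and `0` otherwise. These constants are cancelled by the square roots in `u_{PQ}`. -/
theorem sum_dlog_residueSign (hodd : ringChar F ≠ 2) {D : F[X]} (hD : D.Monic)
    [Fintype (AdjoinRoot D)] :
    ∑ x, dlog γ hγ (residueSign hD x) =
      -(halfExp F D.natDegree : ZMod (Fintype.card F - 1)) := by
  have h0 : (0 : F[X]) ∈ polysLT F D.natDegree := by simp
  rw [sum_adjoinRoot hD, Finset.sum_congr rfl fun a ha => by
    rw [residueSign, modByMonicHom_mk_of_mem hD ha], ← Finset.add_sum_erase _ _ h0,
    Polynomial.leadingCoeff_zero, dlog_zero, zero_add, sum_polysLT_erase]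
  have h1 : ∀ a ∈ monicsLT F D.natDegree, ∑ β : Fˣ, dlog γ hγ (Polynomial.C β.1 * a).leadingCoeff =
      -(((Fintype.card F - 1) / 2 : ℕ) : ZMod (Fintype.card F - 1)) := by
    intro a ha
    rw [← sum_dlog hγ hodd]
    refine Finset.sum_congr rfl fun β _ => ?_
    rw [Polynomial.leadingCoeff_mul, Polynomial.leadingCoeff_C, (mem_monicsLT.1 ha).1.leadingCoeff,
      mul_one]
  rw [Finset.sum_congr rfl h1, Finset.sum_const, nsmul_eq_mul]
  have h2 : (2 : ZMod (Fintype.card F - 1)) *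
      (((Fintype.card F - 1) / 2 : ℕ) : ZMod (Fintype.card F - 1)) = 0 := by
    simpa [halfExp] using two_mul_halfExp hodd 1
  have h3 := odd_card_monicsLT hodd (F := F) D.natDegree
  rw [halfExp]
  split_ifs with hd
  · obtain ⟨k, hk⟩ := h3.2 hd
    rw [hk]
    push_cast
    linear_combination -(k : ZMod (Fintype.card F - 1)) * h2
  · obtain ⟨k, hk⟩ := Nat.not_odd_iff_even.1 (mt h3.1 hd)
    rw [hk]
    push_cast
    linear_combination -(k : ZMod (Fintype.card F - 1)) * h2

end Parity

section Invariance

/-- The change of a sum over the elements of sign `1` under multiplication by a unit. -/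
theorem sum_section_mul_sub {A R M : Type*} [CommRing A] [Algebra F A] [Fintype A] [CommRing R]
    [AddCommGroup M] [Module R M] {lg : F → R} {s : A → F} (hs : IsSign s)
    (hlg : ∀ a b : F, a ≠ 0 → b ≠ 0 → lg (a * b) = lg a + lg b)
    {E : A → M} {g₀ : M} (hE : ∀ β : F, β ≠ 0 → ∀ x : A, x ≠ 0 → E (β • x) = lg β • g₀ + E x)
    (c : Aˣ) : ∑ x with s x = 1, (E (c * x) - E x) =
      (∑ x with s x = 1, lg (s (c * x))) • g₀ := by
  have hlg1 : lg 1 = 0 := by simpa using hlg 1 1 one_ne_zero one_ne_zero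
  have h := sum_section_mul hs c (fun x => E x - lg (s x) • g₀) (by
    intro β hβ x hx
    rw [hE β hβ x hx, hs.map_smul, hlg _ _ hβ (hs.ne_zero x hx)]
    module)
  rw [Finset.sum_sub_distrib, Finset.sum_sub_distrib] at h
  have h2 : ∑ x with s x = 1, lg (s x) • g₀ = 0 := by
    refine Finset.sum_eq_zero fun x hx => ?_
    simp only [Finset.mem_filter, Finset.mem_univ, true_and] at hx
    rw [hx, hlg1, zero_smul]
  rw [Finset.sum_sub_distrib, Finset.sum_smul]
  rw [h2, sub_zero] at h
  rw [← h]
  abel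

variable {γ : Fˣ} (hγ : ∀ x : Fˣ, x ∈ Subgroup.zpowers γ) {P Q : F[X]}
  {M : Type*} [AddCommGroup M] [Module (ZMod (Fintype.card F - 1)) M]

/-- A function on the `PQ`-torsion of the Carlitz module, `ℓ(a)` standing for the class of
`e_C(ϖ a / (P Q))` modulo `(q - 1)`-th powers and `g₀` for the class of the constant `γ`, that is equivariant under `Fˣ` and satisfies the distribution relations. -/
structure IsDistribution (P Q : F[X]) (g₀ : M) (ℓ : F[X] → M) : Prop where
  periodic : ∀ a b, P * Q ∣ a - b → ℓ a = ℓ b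
  smul : ∀ β : F, β ≠ 0 → ∀ a, ¬ P * Q ∣ a →
    ℓ (Polynomial.C β * a) = dlog γ hγ β • g₀ + ℓ a
  left : ∀ a, ¬ P ∣ a → ∑ b ∈ polysLT F Q.natDegree, ℓ (a + b * P) = ℓ (Q * a)
  right : ∀ a, ¬ Q ∣ a → ∑ b ∈ polysLT F P.natDegree, ℓ (a + b * Q) = ℓ (P * a)

variable {hγ} {g₀ : M} {ℓ : F[X] → M}

theorem IsDistribution.swap (h : IsDistribution hγ P Q g₀ ℓ) : IsDistribution hγ Q P g₀ ℓ where
  periodic a b hab := h.periodic a b (by rwa [mul_comm])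
  smul β hβ a ha := h.smul β hβ a (by rwa [mul_comm])
  left := h.right
  right := h.left

section

variable (hP : P.Monic) (hQ : Q.Monic) {P' Q' : F[X]} (hPQ : P * P' + Q * Q' = 1)
include hPQ

theorem not_dvd_crtRep {a : AdjoinRoot P} {b : AdjoinRoot Q} (hab : a ≠ 0 ∨ b ≠ 0) :
    ¬ P * Q ∣ crtRep hP hQ P' Q' a b := by
  intro hd
  obtain ⟨h1, h2⟩ := mk_crtRep hP hQ hPQ a b
  rcases hab with h | h
  · exact h (by rw [← h1, AdjoinRoot.mk_eq_zero]; exact (dvd_mul_right _ _).trans hd)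
  · exact h (by rw [← h2, AdjoinRoot.mk_eq_zero]; exact (dvd_mul_left _ _).trans hd)

/-- The pair `(a, 0)` of residue classes comes from a multiple of `Q`. -/
theorem crtRep_zero_right (a : AdjoinRoot P) :
    crtRep hP hQ P' Q' a 0 =
      Q * AdjoinRoot.modByMonicHom hP (AdjoinRoot.mk P Q' * a) := by
  set x := AdjoinRoot.modByMonicHom hP (AdjoinRoot.mk P Q' * a) with hx
  have h1 : AdjoinRoot.mk P (Q * x) = a := by
    rw [map_mul, hx, mk_modByMonicHom, ← mul_assoc, ← map_mul]
    have : AdjoinRoot.mk P (Q * Q') = 1 := by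
      rw [← map_one (AdjoinRoot.mk P), AdjoinRoot.mk_eq_mk]
      exact ⟨-P', by linear_combination hPQ⟩
    rw [this, one_mul]
  have h2 : AdjoinRoot.mk Q (Q * x) = 0 := by
    rw [AdjoinRoot.mk_eq_zero]; exact dvd_mul_right _ _
  rw [← h2]
  nth_rewrite 1 [← h1]
  rw [crtRep_mk hP hQ hPQ, Polynomial.modByMonic_eq_self_iff (hP.mul hQ), mul_comm P,
    Polynomial.degree_mul, Polynomial.degree_mul]
  refine WithBot.add_lt_add_left (by simpa using hQ.ne_zero) ?_
  rw [Polynomial.degree_eq_natDegree hP.ne_zero]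
  exact mem_polysLT.1 (modByMonicHom_mem hP _)

theorem IsDistribution.crtRep_mk (h : IsDistribution hγ P Q g₀ ℓ) (x : F[X]) :
    ℓ (crtRep hP hQ P' Q' (AdjoinRoot.mk P x) (AdjoinRoot.mk Q x)) = ℓ x := by
  refine h.periodic _ _ ?_
  rw [QuasiCyclotomic.crtRep_mk hP hQ hPQ, Polynomial.modByMonic_eq_sub_mul_div,
    sub_sub_cancel_left, dvd_neg]
  exact dvd_mul_right _ _

theorem IsDistribution.sum_crtRep [Fintype (AdjoinRoot Q)] (h : IsDistribution hγ P Q g₀ ℓ)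
    {a : AdjoinRoot P} (ha : a ≠ 0) :
    ∑ b, ℓ (crtRep hP hQ P' Q' a b) = ℓ (Q * AdjoinRoot.modByMonicHom hP a) := by
  have hcop : IsCoprime Q P := ⟨Q', P', by linear_combination hPQ⟩
  rw [sum_adjoinRoot_add_mul hQ hcop (AdjoinRoot.modByMonicHom hP a), ← h.left]
  · refine Finset.sum_congr rfl fun b _ => ?_
    rw [← h.crtRep_mk hP hQ hPQ (_ + b * P)]
    congr 2
    conv_lhs => rw [← mk_modByMonicHom hP a]
    rw [AdjoinRoot.mk_eq_mk]
    exact ⟨-b, by ring⟩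
  · rwa [← AdjoinRoot.mk_eq_zero, mk_modByMonicHom]

omit hPQ in
include hQ in
theorem IsDistribution.smul_rep (h : IsDistribution hγ P Q g₀ ℓ) (β : F) (hβ : β ≠ 0)
    {a : AdjoinRoot P} (ha : a ≠ 0) :
    ℓ (Q * AdjoinRoot.modByMonicHom hP (β • a)) =
      dlog γ hγ β • g₀ + ℓ (Q * AdjoinRoot.modByMonicHom hP a) := by
  rw [map_smul, Polynomial.smul_eq_C_mul, mul_left_comm, h.smul β hβ]
  rw [mul_comm, mul_dvd_mul_iff_left hQ.ne_zero, ← AdjoinRoot.mk_eq_zero, mk_modByMonicHom]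
  exact ha

omit hPQ in
include hQ in
theorem IsDistribution.sum_monics_sub [Fintype (AdjoinRoot P)] (h : IsDistribution hγ P Q g₀ ℓ)
    {c : F[X]} {u : (AdjoinRoot P)ˣ} (hu : u.1 = AdjoinRoot.mk P c) :
    ∑ B ∈ monicsLT F P.natDegree, (ℓ (c * (Q * B)) - ℓ (Q * B)) =
      (∑ a with residueSign hP a = 1, dlog γ hγ (residueSign hP (u * a))) • g₀ := by
  rw [← sum_section_mul_sub (isSign_residueSign hP) (dlog_mul hγ)
      (E := fun a => ℓ (Q * AdjoinRoot.modByMonicHom hP a)) (g₀ := g₀)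
      (fun β hβ a ha => h.smul_rep hP hQ β hβ ha), sum_adjoinRoot_sign]
  refine Finset.sum_congr rfl fun B hB => ?_
  rw [mem_monicsLT] at hB
  rw [hu, ← map_mul, modByMonicHom_mk_of_mem hP ((monic_mem_polysLT hB.1).2 hB.2)]
  congr 1
  refine h.periodic _ _ ?_
  have h1 : P ∣ c * B - AdjoinRoot.modByMonicHom hP (AdjoinRoot.mk P (c * B)) := by
    rw [← AdjoinRoot.mk_eq_mk, mk_modByMonicHom]
  rw [mul_left_comm, ← mul_sub, mul_comm P]
  exact mul_dvd_mul_left Q h1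

end

theorem isUnit_mk {D c : F[X]} (h : IsCoprime c D) : IsUnit (AdjoinRoot.mk D c) := by
  obtain ⟨u, v, huv⟩ := h
  refine IsUnit.of_mul_eq_one (AdjoinRoot.mk D u) ?_
  rw [← map_mul, ← map_one (AdjoinRoot.mk D), AdjoinRoot.mk_eq_mk]
  exact ⟨-v, by linear_combination huv⟩

/-- The class of `u_{PQ}` modulo `(q - 1)`-th powers is invariant under multiplication of the
torsion points by `c`: the three terms are the changes of the factors `√P`, `√Q` and `sin a_{PQ}`. -/
theorem IsDistribution.invariance (hodd : ringChar F ≠ 2) (h : IsDistribution hγ P Q g₀ ℓ)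
    (hP : P.Monic) (hQ : Q.Monic) (hPi : Irreducible P) (hQi : Irreducible Q)
    (hcop : IsCoprime P Q) {c : F[X]} (hcP : IsCoprime c P) (hcQ : IsCoprime c Q) :
    halfExp F Q.natDegree • ∑ B ∈ monicsLT F P.natDegree, (ℓ (c * (Q * B)) - ℓ (Q * B)) +
    halfExp F P.natDegree • ∑ A ∈ monicsLT F Q.natDegree, (ℓ (c * (P * A)) - ℓ (P * A)) +
    ∑ A ∈ monicsLT F Q.natDegree, ∑ B ∈ monicsLT F P.natDegree,
      ∑ s ∈ Finset.Icc 1 (Fintype.card F - 2), (s : ZMod (Fintype.card F - 1)) •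
        ((ℓ (c * (B * Q + Polynomial.C ((γ ^ s)⁻¹ : Fˣ).1 * A)) -
          ℓ (B * Q + Polynomial.C ((γ ^ s)⁻¹ : Fˣ).1 * A)) -
        (ℓ (c * (A * P + Polynomial.C ((γ ^ s)⁻¹ : Fˣ).1 * B)) -
          ℓ (A * P + Polynomial.C ((γ ^ s)⁻¹ : Fˣ).1 * B))) = 0 := by
  obtain ⟨P', Q', hPQ'⟩ := hcop
  have hPQ : P * P' + Q * Q' = 1 := by linear_combination hPQ'
  have hQP : Q * Q' + P * P' = 1 := by linear_combination hPQ'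
  have : Fact (Irreducible P) := ⟨hPi⟩
  have : Fact (Irreducible Q) := ⟨hQi⟩
  have := finite_adjoinRoot hP
  have := finite_adjoinRoot hQ
  let _ := Fintype.ofFinite (AdjoinRoot P)
  let _ := Fintype.ofFinite (AdjoinRoot Q)
  obtain ⟨u, hu⟩ := isUnit_mk hcP
  obtain ⟨u', hu'⟩ := isUnit_mk hcQ
  obtain ⟨v, hv⟩ := isUnit_mk (D := P) (c := Q') ⟨Q, P', by linear_combination hPQ⟩
  obtain ⟨v', hv'⟩ := isUnit_mk (D := Q) (c := P') ⟨P, Q', by linear_combination hPQ⟩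
  have hcPQ : IsCoprime (P * Q) c := (hcP.mul_right hcQ).symm
  have hE : ∀ β : F, β ≠ 0 → ∀ a b, a ≠ 0 ∨ b ≠ 0 →
      ℓ (crtRep hP hQ P' Q' (β • a) (β • b)) = dlog γ hγ β • g₀ + ℓ (crtRep hP hQ P' Q' a b) := by
    intro β hβ a b hab
    rw [crtRep_smul, h.smul β hβ _ (not_dvd_crtRep hP hQ hPQ hab)]
  -- The cyclicity of the groups of units, required here, holds because `P` and `Q` are irreducible.
  have key := sum_divisor_sub_pair (R := ZMod (Fintype.card F - 1)) (lg := dlog γ hγ)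
    (isSign_residueSign hP) (isSign_residueSign hQ)
    (w := fun a b => (crtRep hP hQ P' Q' a b).leadingCoeff)
    (fun β a b => by
      rw [crtRep_smul, Polynomial.leadingCoeff_mul, Polynomial.leadingCoeff_C])
    (fun a b hab => by
      rw [Polynomial.leadingCoeff_ne_zero]
      rintro h0
      exact not_dvd_crtRep hP hQ hPQ hab (h0 ▸ dvd_zero _))
    (dlog_mul hγ) (dlog_zero hγ)
    (E := fun a b => ℓ (crtRep hP hQ P' Q' a b))
    (EA := fun a => ℓ (Q * AdjoinRoot.modByMonicHom hP a))
    (EB := fun b => ℓ (P * AdjoinRoot.modByMonicHom hQ b)) (g₀ := g₀) hE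
    (fun β hβ a ha => h.smul_rep hP hQ β hβ ha)
    (fun β hβ b hb => h.swap.smul_rep hQ hP β hβ hb)
    (fun a ha => h.sum_crtRep hP hQ hPQ ha)
    (fun b hb => by
      rw [← h.swap.sum_crtRep hQ hP hQP hb]
      simp only [crtRep_comm])
    (v := v) (v' := v')
    (fun a _ => by rw [crtRep_zero_right hP hQ hPQ, hv])
    (fun a _ => by
      rw [crtRep_zero_right hP hQ hPQ, hv, residueSign, Polynomial.leadingCoeff_mul,
        hQ.leadingCoeff, one_mul])
    (fun b _ => by rw [← crtRep_comm, crtRep_zero_right hQ hP hQP, hv'])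
    (fun b _ => by
      rw [← crtRep_comm, crtRep_zero_right hQ hP hQP, hv', residueSign,
        Polynomial.leadingCoeff_mul, hP.leadingCoeff, one_mul]) u u'
  have hEc : ∀ a b, ℓ (crtRep hP hQ P' Q' (u * a) (u' * b)) = ℓ (c * crtRep hP hQ P' Q' a b) := by
    intro a b
    obtain ⟨h1, h2⟩ := mk_crtRep hP hQ hPQ a b
    rw [← h.crtRep_mk hP hQ hPQ (c * _), map_mul, map_mul, h1, h2, hu, hu']
  have hΔ : ∀ (β : Fˣ) (x : F[X]), ℓ (c * (Polynomial.C β.1 * x)) - ℓ (Polynomial.C β.1 * x) =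
      ℓ (c * x) - ℓ x := by
    intro β x
    by_cases hx : P * Q ∣ x
    · rw [h.periodic _ (c * x), h.periodic (Polynomial.C β.1 * x) x]
      · exact dvd_sub (dvd_mul_of_dvd_right hx _) hx
      · exact dvd_sub (dvd_mul_of_dvd_right (dvd_mul_of_dvd_right hx _) _)
          (dvd_mul_of_dvd_right hx _)
    · rw [mul_left_comm, h.smul _ β.ne_zero _ hx,
        h.smul _ β.ne_zero _ fun hd => hx (hcPQ.dvd_of_dvd_mul_left hd)]
      abel
  simp only [hEc] at key
  rw [← sum_half_divisor hγ hP hQ hPQ (fun x => ℓ (c * x) - ℓ x) hΔ] at key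
  simp only [← crtRep_comm hP hQ] at key
  rw [← sum_half_divisor hγ hQ hP hQP (fun x => ℓ (c * x) - ℓ x) hΔ,
    sum_dlog_residueSign hγ hodd, sum_dlog_residueSign hγ hodd, Finset.sum_comm (s := monicsLT F P.natDegree)] at key
  rw [h.sum_monics_sub hP hQ hu, h.swap.sum_monics_sub hQ hP hu']
  simp only [smul_sub (_ : ZMod (Fintype.card F - 1)) (ℓ _ - ℓ _) (ℓ _ - ℓ _),
    Finset.sum_sub_distrib]
  rw [key, ← Nat.cast_smul_eq_nsmul (ZMod (Fintype.card F - 1)),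
    ← Nat.cast_smul_eq_nsmul (ZMod (Fintype.card F - 1))]
  have h2 := two_mul_halfExp hodd P.natDegree
  rw [smul_smul, smul_smul, ← add_smul, ← sub_smul, ← add_smul]
  convert zero_smul (ZMod (Fintype.card F - 1)) g₀
  linear_combination (∑ b with residueSign hQ b = 1, dlog γ hγ (residueSign hQ (u'.1 * b))) * h2

end Invariance

end

/-! ### The cyclotomic function field -/

section

open scoped Classical
variable {F : Type*} [Field F] [Fintype F]

section Cyclotomic

variable {ϖ : Omega F} (hϖ : IsCarlitzPeriod ϖ) (M : F[X])

include hϖ in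
theorem tors_mem (a : F[X]) : tors ϖ M a ∈ cyclotomicField ϖ M := by
  rw [← mul_one a, ← aeval_tors hϖ, Polynomial.aeval_eq_sum_range]
  refine sum_mem fun i _ => ?_
  rw [Algebra.smul_def, IsScalarTower.algebraMap_apply F[X] (RatFunc F)]
  exact mul_mem (IntermediateField.algebraMap_mem _ _)
    (pow_mem (IntermediateField.mem_adjoin_simple_self _ _) _)

/-- The torsion point `e_C(ϖ a / M)`, as an element of the cyclotomic function field. -/
def torsK (a : F[X]) : cyclotomicField ϖ M := ⟨tors ϖ M a, tors_mem hϖ M a⟩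

@[simp]
theorem coe_torsK (a : F[X]) : (torsK hϖ M a : Omega F) = tors ϖ M a := rfl

theorem torsK_eq_iff {M : F[X]} (hM : M ≠ 0) (a b : F[X]) :
    torsK hϖ M a = torsK hϖ M b ↔ M ∣ a - b := by
  rw [← tors_eq_iff hϖ hM]
  exact Subtype.ext_iff

theorem torsK_zero : torsK hϖ M 0 = 0 := Subtype.ext (by simp [tors_eq, latticeExp])

theorem torsK_eq_zero_iff {M : F[X]} (hM : M ≠ 0) (a : F[X]) :
    torsK hϖ M a = 0 ↔ M ∣ a := by
  rw [← torsK_zero hϖ M, torsK_eq_iff hϖ hM, sub_zero]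

theorem aeval_torsK (a b : F[X]) :
    Polynomial.aeval (torsK hϖ M b) (carlitzPoly a) = torsK hϖ M (a * b) := by
  refine Subtype.ext ?_
  rw [coe_torsK, ← aeval_tors hϖ]
  exact (Polynomial.aeval_algebraMap_apply (Omega F) (torsK hϖ M b) (carlitzPoly a)).symm

/-- The Carlitz polynomial `C_M` splits in the cyclotomic field. -/
theorem map_carlitzPoly {M : F[X]} (hM : M.Monic) :
    (carlitzPoly M).map (algebraMap F[X] (cyclotomicField ϖ M)) =
      ∏ b ∈ polysLT F M.natDegree, (Polynomial.X - Polynomial.C (torsK hϖ M b)) := by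
  apply Polynomial.map_injective _ (algebraMap (cyclotomicField ϖ M) (Omega F)).injective
  have h := map_carlitzPoly_sub_eq_prod hϖ hM one_ne_zero 0
  have h0 : tors ϖ 1 0 = 0 := by simp [tors_eq, latticeExp]
  simp only [h0, map_zero, sub_zero, one_mul, zero_add, mul_one] at h
  rw [Polynomial.map_map, ← IsScalarTower.algebraMap_eq, h, Polynomial.map_prod]
  refine Finset.prod_congr rfl fun b _ => ?_
  rw [Polynomial.map_sub, Polynomial.map_X, Polynomial.map_C]
  rfl

/-- The Carlitz polynomial `C_M` over `k`. -/
def carlitzPolyRat (M : F[X]) : (RatFunc F)[X] :=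
  (carlitzPoly M).map (algebraMap F[X] (RatFunc F))

variable {M} (hM : M.Monic)
include hϖ hM

theorem map_carlitzPolyRat :
    (carlitzPolyRat M).map (algebraMap (RatFunc F) (cyclotomicField ϖ M)) =
      ∏ b ∈ polysLT F M.natDegree, (Polynomial.X - Polynomial.C (torsK hϖ M b)) := by
  rw [← map_carlitzPoly hϖ hM, carlitzPolyRat, Polynomial.map_map,
    ← IsScalarTower.algebraMap_eq]

theorem torsK_injOn : Set.InjOn (torsK hϖ M) (polysLT F M.natDegree) := by
  intro a ha b hb hab
  rw [torsK_eq_iff hϖ hM.ne_zero] at hab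
  refine sub_eq_zero.1 (Polynomial.eq_zero_of_dvd_of_degree_lt hab ?_)
  refine (Polynomial.degree_sub_le _ _).trans_lt ?_
  rw [Polynomial.degree_eq_natDegree hM.ne_zero]
  exact max_lt (mem_polysLT.1 ha) (mem_polysLT.1 hb)

theorem separable_carlitzPolyRat : (carlitzPolyRat M).Separable := by
  rw [← Polynomial.separable_map (algebraMap (RatFunc F) (cyclotomicField ϖ M)),
    map_carlitzPolyRat hϖ hM]
  exact Polynomial.separable_prod_X_sub_C_iff'.2 fun a ha b hb => torsK_injOn hϖ hM ha hb

theorem isSplittingField_cyclotomicField :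
    (carlitzPolyRat M).IsSplittingField (RatFunc F) (cyclotomicField ϖ M) := by
  rw [IntermediateField.isSplittingField_iff]
  have hs : ((carlitzPolyRat M).map (algebraMap (RatFunc F) (cyclotomicField ϖ M))).Splits := by
    rw [map_carlitzPolyRat hϖ hM]
    exact Polynomial.Splits.prod fun b _ => Polynomial.Splits.X_sub_C _
  refine ⟨hs, le_antisymm ?_ ?_⟩
  · rw [IntermediateField.adjoin_simple_le_iff]
    apply IntermediateField.subset_adjoin
    rw [Polynomial.mem_rootSet]
    refine ⟨(separable_carlitzPolyRat hϖ hM).ne_zero, ?_⟩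
    have h2 := aeval_tors hϖ M M 1
    rw [mul_one, (tors_eq_zero_iff hϖ hM.ne_zero M).2 dvd_rfl] at h2
    rw [carlitzPolyRat, Polynomial.aeval_map_algebraMap]
    exact h2
  · rw [IntermediateField.adjoin_le_iff]
    intro x hx
    rw [← hs.image_rootSet (cyclotomicField ϖ M).val] at hx
    obtain ⟨z, -, rfl⟩ := hx
    exact z.2

theorem isGalois_cyclotomicField : IsGalois (RatFunc F) (cyclotomicField ϖ M) := by
  have := isSplittingField_cyclotomicField hϖ hM
  exact IsGalois.of_separable_splitting_field (separable_carlitzPolyRat hϖ hM)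

theorem finiteDimensional_cyclotomicField :
    FiniteDimensional (RatFunc F) (cyclotomicField ϖ M) := by
  have := isSplittingField_cyclotomicField hϖ hM
  exact Polynomial.IsSplittingField.finiteDimensional _ (carlitzPolyRat M)

omit hM in
/-- An automorphism commutes with the Carlitz polynomials, so that its action on the torsion points
is determined by the image of `e_C(ϖ / M)`. -/
theorem galois_torsK_of_one {σ : Gal(cyclotomicField ϖ M/RatFunc F)} {c : F[X]}
    (h : σ (torsK hϖ M 1) = torsK hϖ M c) (a : F[X]) : σ (torsK hϖ M a) = torsK hϖ M (c * a) := by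
  have h1 := aeval_torsK hϖ M a 1
  rw [mul_one] at h1
  rw [← h1, mul_comm, ← aeval_torsK, ← h]
  exact (Polynomial.aeval_algHom_apply (σ.toAlgHom.restrictScalars F[X]) _ _).symm

/-- Every automorphism of the cyclotomic field acts on the `M`-torsion as multiplication by a
polynomial prime to `M`. -/
theorem exists_galois_torsK (σ : Gal(cyclotomicField ϖ M/RatFunc F)) :
    ∃ c : F[X], IsCoprime c M ∧ ∀ a, σ (torsK hϖ M a) = torsK hϖ M (c * a) := by
  have key : ∀ τ : Gal(cyclotomicField ϖ M/RatFunc F),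
      ∃ c : F[X], ∀ a, τ (torsK hϖ M a) = torsK hϖ M (c * a) := by
    intro τ
    have h1 := aeval_torsK hϖ M M 1
    rw [mul_one, (torsK_eq_zero_iff hϖ hM.ne_zero M).2 dvd_rfl] at h1
    have h2 : Polynomial.aeval (τ (torsK hϖ M 1)) (carlitzPoly M) = 0 := by
      have := Polynomial.aeval_algHom_apply (τ.toAlgHom.restrictScalars F[X]) (torsK hϖ M 1)
        (carlitzPoly M)
      rw [h1, map_zero] at this
      exact this
    rw [Polynomial.aeval_def, ← Polynomial.eval_map, map_carlitzPoly hϖ hM,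
      Polynomial.eval_prod, Finset.prod_eq_zero_iff] at h2
    obtain ⟨c, -, hc⟩ := h2
    rw [Polynomial.eval_sub, Polynomial.eval_X, Polynomial.eval_C, sub_eq_zero] at hc
    exact ⟨c, galois_torsK_of_one hϖ hc⟩
  obtain ⟨c, hc⟩ := key σ
  obtain ⟨d, hd⟩ := key σ⁻¹
  refine ⟨c, ?_, hc⟩
  have h1 : σ (σ⁻¹ (torsK hϖ M 1)) = torsK hϖ M 1 := by
    rw [← AlgEquiv.mul_apply, mul_inv_cancel, AlgEquiv.one_apply]
  rw [hd, hc, torsK_eq_iff hϖ hM.ne_zero] at h1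
  obtain ⟨e, he⟩ := h1
  exact ⟨d, -e, by linear_combination he⟩

omit hM in
theorem galois_ext {σ τ : Gal(cyclotomicField ϖ M/RatFunc F)}
    (h : σ (torsK hϖ M 1) = τ (torsK hϖ M 1)) : σ = τ := by
  have h1 : σ.toAlgHom = τ.toAlgHom := IntermediateField.algHom_ext_of_eq_adjoin _ rfl (by
    rintro x hx
    obtain rfl : x = expAt ϖ (frac 1 M) := hx
    exact h)
  ext x
  exact congrArg Subtype.val (DFunLike.congr_fun h1 x)

theorem isIntegral_torsK (a : F[X]) : IsIntegral F[X] (torsK hϖ M a) := by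
  refine ⟨carlitzPoly M, (monic_carlitzPoly hM).1, ?_⟩
  rw [← Polynomial.aeval_def, aeval_torsK, torsK_eq_zero_iff hϖ hM.ne_zero]
  exact dvd_mul_right _ _

end Cyclotomic

end

/-! ### Classes modulo powers and the Kummer generator -/

section

open scoped Classical
variable {F : Type*} [Field F] [Fintype F]

section PowerClasses

/-- The group `K^* / (K^*)^n`, written additively. -/
def PowClass (K : Type*) [Field K] (n : ℕ) : Type _ :=
  Additive (Kˣ ⧸ (powMonoidHom n : Kˣ →* Kˣ).range)

variable {K : Type*} [Field K] (n : ℕ)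

instance : AddCommGroup (PowClass K n) :=
  inferInstanceAs (AddCommGroup (Additive (Kˣ ⧸ (powMonoidHom n : Kˣ →* Kˣ).range)))

/-- The class of a unit modulo `n`-th powers. -/
def PowClass.of (x : Kˣ) : PowClass K n :=
  Additive.ofMul (QuotientGroup.mk x : Kˣ ⧸ (powMonoidHom n : Kˣ →* Kˣ).range)

variable {n} in
theorem PowClass.of_surjective : Function.Surjective (PowClass.of (K := K) n) :=
  QuotientGroup.mk_surjective

variable {n} in
theorem PowClass.of_eq_zero_iff (x : Kˣ) : PowClass.of n x = 0 ↔ ∃ y, y ^ n = x :=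
  QuotientGroup.eq_one_iff (N := (powMonoidHom n : Kˣ →* Kˣ).range) x

theorem PowClass.of_pow (x : Kˣ) (m : ℕ) : PowClass.of n (x ^ m) = m • PowClass.of n x :=
  rfl

instance : Module (ZMod n) (PowClass K n) :=
  AddCommGroup.zmodModule (by
    intro x
    obtain ⟨y, rfl⟩ := PowClass.of_surjective x
    rw [← PowClass.of_pow]
    exact (PowClass.of_eq_zero_iff _).2 ⟨y, rfl⟩)

/-- The class of `x` modulo `n`-th powers; the class of zero is zero. -/
def powClass (x : K) : PowClass K n :=
  if h : x = 0 then 0 else PowClass.of n (Units.mk0 x h)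

variable {n}

theorem powClass_unit (x : Kˣ) : powClass n x.1 = PowClass.of n x := by
  rw [powClass, dif_neg x.ne_zero, Units.mk0_val]

theorem powClass_mul {x y : K} (hx : x ≠ 0) (hy : y ≠ 0) :
    powClass n (x * y) = powClass n x + powClass n y := by
  lift x to Kˣ using hx.isUnit
  lift y to Kˣ using hy.isUnit
  rw [← Units.val_mul, powClass_unit, powClass_unit, powClass_unit]
  rfl

theorem powClass_one : powClass n (1 : K) = 0 := powClass_unit 1

theorem powClass_pow {x : K} (hx : x ≠ 0) (m : ℕ) :
    powClass n (x ^ m) = m • powClass n x := by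
  lift x to Kˣ using hx.isUnit
  rw [← Units.val_pow_eq_pow_val, powClass_unit, powClass_unit]
  rfl

theorem powClass_div {x y : K} (hx : x ≠ 0) (hy : y ≠ 0) :
    powClass n (x / y) = powClass n x - powClass n y := by
  rw [eq_sub_iff_add_eq, ← powClass_mul (div_ne_zero hx hy) hy, div_mul_cancel₀ _ hy]

theorem powClass_prod {ι : Type*} (s : Finset ι) {f : ι → K} (hf : ∀ i ∈ s, f i ≠ 0) :
    powClass n (∏ i ∈ s, f i) = ∑ i ∈ s, powClass n (f i) := by
  induction s using Finset.induction_on with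
  | empty => simp [powClass_one]
  | insert i s hi ih =>
    rw [Finset.prod_insert hi, Finset.sum_insert hi, powClass_mul, ih]
    · exact fun j hj => hf j (Finset.mem_insert_of_mem hj)
    · exact hf i (Finset.mem_insert_self _ _)
    · exact Finset.prod_ne_zero_iff.2 fun j hj => hf j (Finset.mem_insert_of_mem hj)

theorem exists_of_powClass_eq {x y : K} (hx : x ≠ 0) (hy : y ≠ 0)
    (h : powClass n x = powClass n y) : ∃ z : K, z ≠ 0 ∧ x = y * z ^ n := by
  lift x to Kˣ using hx.isUnit
  lift y to Kˣ using hy.isUnit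
  rw [powClass_unit, powClass_unit, ← sub_eq_zero, sub_eq_neg_add] at h
  obtain ⟨z, hz⟩ := (PowClass.of_eq_zero_iff (y⁻¹ * x)).1 h
  refine ⟨z, z.ne_zero, ?_⟩
  rw [← Units.val_pow_eq_pow_val, ← Units.val_mul]
  rw [hz, mul_inv_cancel_left]

end PowerClasses

section KummerProd

variable (γ : Fˣ) (P Q : F[X]) {E : Type*} [Field E]

theorem not_dvd_pair {P Q A B : F[X]} (hA : A ∈ monicsLT F Q.natDegree)
    (s : ℕ) :
    ¬ P * Q ∣ B * Q + Polynomial.C ((γ ^ s)⁻¹ : Fˣ).1 * A := by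
  intro h
  have h1 : Q ∣ Polynomial.C ((γ ^ s)⁻¹ : Fˣ).1 * A :=
    (dvd_add_right (dvd_mul_left Q B)).1 ((dvd_mul_left Q P).trans h)
  have hu : IsUnit (Polynomial.C ((γ ^ s)⁻¹ : Fˣ).1) := Polynomial.isUnit_C.2 (Units.isUnit _)
  rw [hu.dvd_mul_left] at h1
  rw [mem_monicsLT] at hA
  exact absurd (Polynomial.natDegree_le_of_dvd h1 hA.1.ne_zero) (not_le.2 hA.2)

theorem not_dvd_mul_monic {P Q B : F[X]} (hQ : Q ≠ 0) (hB : B ∈ monicsLT F P.natDegree) :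
    ¬ P * Q ∣ Q * B := by
  rw [mul_comm, mul_dvd_mul_iff_left hQ]
  rw [mem_monicsLT] at hB
  exact fun h => absurd (Polynomial.natDegree_le_of_dvd h hB.1.ne_zero) (not_le.2 hB.2)

/-- The expression for `u_{PQ}`, up to a constant, in terms of the values `f a` of `e_C` at
`ϖ a / (P Q)`. The square roots of `P` and `Q` are replaced by products of torsion points. -/
def kummerProd (f : F[X] → E) : E :=
  (∏ B ∈ monicsLT F P.natDegree, f (Q * B)) ^ halfExp F Q.natDegree *
    (∏ A ∈ monicsLT F Q.natDegree, f (P * A)) ^ halfExp F P.natDegree *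
    ∏ A ∈ monicsLT F Q.natDegree, ∏ B ∈ monicsLT F P.natDegree,
      ∏ s ∈ Finset.Icc 1 (Fintype.card F - 2),
        (f (B * Q + Polynomial.C ((γ ^ s)⁻¹ : Fˣ).1 * A) /
          f (A * P + Polynomial.C ((γ ^ s)⁻¹ : Fˣ).1 * B)) ^ s

theorem map_kummerProd {E' : Type*} [Field E'] (φ : E →+* E') (f : F[X] → E) :
    φ (kummerProd γ P Q f) = kummerProd γ P Q fun a => φ (f a) := by
  simp only [kummerProd, map_mul, map_pow, map_prod, map_div₀]

variable {P Q} (hP : P.Monic) (hQ : Q.Monic) {f : F[X] → E} (hf : ∀ a, ¬ P * Q ∣ a → f a ≠ 0)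

include hP hQ hf

theorem kummerProd_ne_zero : kummerProd γ P Q f ≠ 0 := by
  refine mul_ne_zero (mul_ne_zero (pow_ne_zero _ ?_) (pow_ne_zero _ ?_)) ?_
  · exact Finset.prod_ne_zero_iff.2 fun B hB => hf _ (not_dvd_mul_monic hQ.ne_zero hB)
  · refine Finset.prod_ne_zero_iff.2 fun A hA => hf _ ?_
    rw [mul_comm P Q]
    exact not_dvd_mul_monic hP.ne_zero hA
  · refine Finset.prod_ne_zero_iff.2 fun A hA => Finset.prod_ne_zero_iff.2 fun B hB =>
      Finset.prod_ne_zero_iff.2 fun s _ => pow_ne_zero _ (div_ne_zero (hf _ ?_) (hf _ ?_))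
    · exact not_dvd_pair γ hA s
    · rw [mul_comm P Q]
      exact not_dvd_pair γ hB s

theorem powClass_kummerProd : powClass (Fintype.card F - 1) (kummerProd γ P Q f) =
    halfExp F Q.natDegree • ∑ B ∈ monicsLT F P.natDegree,
        powClass (Fintype.card F - 1) (f (Q * B)) +
      halfExp F P.natDegree • ∑ A ∈ monicsLT F Q.natDegree,
        powClass (Fintype.card F - 1) (f (P * A)) +
      ∑ A ∈ monicsLT F Q.natDegree, ∑ B ∈ monicsLT F P.natDegree,
        ∑ s ∈ Finset.Icc 1 (Fintype.card F - 2), (s : ZMod (Fintype.card F - 1)) •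
          (powClass (Fintype.card F - 1) (f (B * Q + Polynomial.C ((γ ^ s)⁻¹ : Fˣ).1 * A)) -
            powClass (Fintype.card F - 1)
              (f (A * P + Polynomial.C ((γ ^ s)⁻¹ : Fˣ).1 * B))) := by
  have h1 : ∀ B ∈ monicsLT F P.natDegree, f (Q * B) ≠ 0 := fun B hB =>
    hf _ (not_dvd_mul_monic hQ.ne_zero hB)
  have h2 : ∀ A ∈ monicsLT F Q.natDegree, f (P * A) ≠ 0 := fun A hA => hf _ (by
    rw [mul_comm P Q]
    exact not_dvd_mul_monic hP.ne_zero hA)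
  have h3 : ∀ A ∈ monicsLT F Q.natDegree, ∀ B (s : ℕ),
      f (B * Q + Polynomial.C ((γ ^ s)⁻¹ : Fˣ).1 * A) ≠ 0 := fun A hA B s =>
    hf _ (not_dvd_pair γ hA s)
  have h4 : ∀ A, ∀ B ∈ monicsLT F P.natDegree, ∀ (s : ℕ),
      f (A * P + Polynomial.C ((γ ^ s)⁻¹ : Fˣ).1 * B) ≠ 0 := fun A B hB s => hf _ (by
    rw [mul_comm P Q]
    exact not_dvd_pair γ hB s)
  have h5 : ∀ A ∈ monicsLT F Q.natDegree, ∀ B ∈ monicsLT F P.natDegree, ∀ (s : ℕ),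
      (f (B * Q + Polynomial.C ((γ ^ s)⁻¹ : Fˣ).1 * A) /
          f (A * P + Polynomial.C ((γ ^ s)⁻¹ : Fˣ).1 * B)) ^ s ≠ 0 := fun A hA B hB s =>
    pow_ne_zero _ (div_ne_zero (h3 A hA B s) (h4 A B hB s))
  have h6 : ∀ A ∈ monicsLT F Q.natDegree, ∀ B ∈ monicsLT F P.natDegree,
      ∏ s ∈ Finset.Icc 1 (Fintype.card F - 2),
      (f (B * Q + Polynomial.C ((γ ^ s)⁻¹ : Fˣ).1 * A) /
          f (A * P + Polynomial.C ((γ ^ s)⁻¹ : Fˣ).1 * B)) ^ s ≠ 0 := fun A hA B hB =>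
    Finset.prod_ne_zero_iff.2 fun s _ => h5 A hA B hB s
  have h7 : ∀ A ∈ monicsLT F Q.natDegree, ∏ B ∈ monicsLT F P.natDegree,
      ∏ s ∈ Finset.Icc 1 (Fintype.card F - 2),
      (f (B * Q + Polynomial.C ((γ ^ s)⁻¹ : Fˣ).1 * A) /
          f (A * P + Polynomial.C ((γ ^ s)⁻¹ : Fˣ).1 * B)) ^ s ≠ 0 := fun A hA =>
    Finset.prod_ne_zero_iff.2 fun B hB => h6 A hA B hB
  have g1 := Finset.prod_ne_zero_iff.2 h1
  have g2 := Finset.prod_ne_zero_iff.2 h2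
  rw [kummerProd, powClass_mul (mul_ne_zero (pow_ne_zero _ g1) (pow_ne_zero _ g2))
    (Finset.prod_ne_zero_iff.2 h7), powClass_mul (pow_ne_zero _ g1) (pow_ne_zero _ g2),
    powClass_pow g1, powClass_pow g2, powClass_prod _ h1, powClass_prod _ h2, powClass_prod _ h7]
  congr 1
  refine Finset.sum_congr rfl fun A hA => ?_
  rw [powClass_prod _ (h6 A hA)]
  refine Finset.sum_congr rfl fun B hB => ?_
  rw [powClass_prod _ fun s _ => h5 A hA B hB s]
  refine Finset.sum_congr rfl fun s _ => ?_
  rw [powClass_pow (div_ne_zero (h3 A hA B s) (h4 A B hB s)),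
    powClass_div (h3 A hA B s) (h4 A B hB s), Nat.cast_smul_eq_nsmul]

end KummerProd

section Torsion

variable {ϖ : Omega F} (hϖ : IsCarlitzPeriod ϖ) {M P Q N : F[X]}

theorem torsK_C_mul (M : F[X]) (β : F) (a : F[X]) : torsK hϖ M (Polynomial.C β * a) =
    algebraMap F[X] (cyclotomicField ϖ M) (Polynomial.C β) * torsK hϖ M a :=
  Subtype.ext (tors_C_mul ϖ M β a)

theorem coe_torsK_mul (hN : N ≠ 0) (hM : M = P * Q * N) (a : F[X]) :
    (torsK hϖ M (a * N) : Omega F) = tors ϖ (P * Q) a := by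
  rw [coe_torsK, hM, tors_mul_mul_right ϖ hN]

variable {γ : Fˣ} (hγ : ∀ x : Fˣ, x ∈ Subgroup.zpowers γ)

/-- The classes of the torsion points modulo `(q - 1)`-th powers form a distribution. -/
theorem isDistribution_torsK (hodd : ringChar F ≠ 2) (hP : P.Monic) (hQ : Q.Monic) (hN : N ≠ 0)
    (hM : M = P * Q * N) :
    IsDistribution hγ P Q
      (powClass (Fintype.card F - 1)
        (algebraMap F[X] (cyclotomicField ϖ M) (Polynomial.C γ.1)))
      (fun a => powClass (Fintype.card F - 1) (torsK hϖ M (a * N))) := by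
  have hM0 : M ≠ 0 := hM ▸ mul_ne_zero (mul_ne_zero hP.ne_zero hQ.ne_zero) hN
  have hdvd : ∀ a, torsK hϖ M (a * N) = 0 ↔ P * Q ∣ a := fun a => by
    rw [torsK_eq_zero_iff hϖ hM0, hM, mul_dvd_mul_iff_right hN]
  have hinj : Function.Injective (algebraMap F[X] (cyclotomicField ϖ M)) := by
    rw [IsScalarTower.algebraMap_eq F[X] (RatFunc F)]
    exact (algebraMap (RatFunc F) _).injective.comp (RatFunc.algebraMap_injective F)
  refine ⟨?_, ?_, ?_, ?_⟩
  · intro a b hab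
    have h : torsK hϖ M (a * N) = torsK hϖ M (b * N) := by
      rw [torsK_eq_iff hϖ hM0, ← sub_mul, hM]
      exact mul_dvd_mul_right hab N
    simp only [h]
  · intro β hβ a ha
    obtain ⟨s, hs⟩ := exists_pow_eq hγ (Units.mk0 β hβ)
    have hβ' : β = (γ ^ s : Fˣ).1 := by rw [hs]; rfl
    have h0 : algebraMap F[X] (cyclotomicField ϖ M) (Polynomial.C γ.1) ≠ 0 := by
      rw [Ne, map_eq_zero_iff _ hinj]
      simp
    have h1 : algebraMap F[X] (cyclotomicField ϖ M) (Polynomial.C β) =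
        algebraMap F[X] (cyclotomicField ϖ M) (Polynomial.C γ.1) ^ s := by
      rw [hβ', Units.val_pow_eq_pow_val, map_pow, map_pow]
    rw [mul_assoc, torsK_C_mul, h1, powClass_mul (pow_ne_zero _ h0) (mt (hdvd a).1 ha),
      powClass_pow h0, hβ', dlog_pow, Nat.cast_smul_eq_nsmul]
  · intro a ha
    rw [← powClass_prod]
    · congr 1
      refine Subtype.ext ?_
      rw [coe_torsK_mul hϖ hN hM, mul_comm Q, tors_mul_mul_right ϖ hQ.ne_zero,
        ← prod_tors hodd hϖ hQ hP.ne_zero a]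
      exact (map_prod (algebraMap (cyclotomicField ϖ M) (Omega F)) _ _).trans
        (Finset.prod_congr rfl fun b _ => coe_torsK_mul hϖ hN hM _)
    · intro b _ h
      exact ha ((dvd_add_left (dvd_mul_left P b)).1 ((dvd_mul_right P Q).trans ((hdvd _).1 h)))
  · intro a ha
    rw [← powClass_prod]
    · congr 1
      refine Subtype.ext ?_
      rw [coe_torsK_mul hϖ hN hM, mul_comm P Q, mul_comm P a, tors_mul_mul_right ϖ hP.ne_zero,
        ← prod_tors hodd hϖ hP hQ.ne_zero a]
      refine (map_prod (algebraMap (cyclotomicField ϖ M) (Omega F)) _ _).trans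
        (Finset.prod_congr rfl fun b _ => ?_)
      rw [mul_comm Q P]
      exact coe_torsK_mul hϖ hN hM _
    · intro b _ h
      exact ha ((dvd_add_left (dvd_mul_left Q b)).1 ((dvd_mul_left Q P).trans ((hdvd _).1 h)))

/-- Every automorphism of the cyclotomic field changes `kummerProd`, and hence `u_{PQ}`, by a
`(q - 1)`-th power. -/
theorem galois_kummerProd (hodd : ringChar F ≠ 2) (hP : P.Monic) (hQ : Q.Monic)
    (hPi : Irreducible P) (hQi : Irreducible Q) (hcop : IsCoprime P Q) (hMm : M.Monic)
    (hN : N ≠ 0) (hM : M = P * Q * N) (hγ : ∀ x : Fˣ, x ∈ Subgroup.zpowers γ)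
    (σ : Gal(cyclotomicField ϖ M/RatFunc F)) :
    ∃ z : cyclotomicField ϖ M, z ≠ 0 ∧
      σ (kummerProd γ P Q fun a => torsK hϖ M (a * N)) =
        (kummerProd γ P Q fun a => torsK hϖ M (a * N)) * z ^ (Fintype.card F - 1) := by
  obtain ⟨c, hc, hσ⟩ := exists_galois_torsK hϖ hMm σ
  have hf : ∀ a, ¬ P * Q ∣ a → torsK hϖ M (a * N) ≠ 0 := fun a ha => by
    rwa [Ne, torsK_eq_zero_iff hϖ hMm.ne_zero, hM, mul_dvd_mul_iff_right hN]
  have hcPQ : IsCoprime c (P * Q) := hc.of_isCoprime_of_dvd_right (hM ▸ dvd_mul_right _ _)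
  have hf' : ∀ a, ¬ P * Q ∣ a → torsK hϖ M (c * a * N) ≠ 0 := fun a ha =>
    hf _ fun h => ha (hcPQ.symm.dvd_of_dvd_mul_left h)
  have hmap : σ (kummerProd γ P Q fun a => torsK hϖ M (a * N)) =
      kummerProd γ P Q fun a => torsK hϖ M (c * a * N) := by
    rw [← AlgEquiv.coe_ringEquiv, ← RingEquiv.coe_toRingHom, map_kummerProd]
    congr 1
    funext a
    rw [mul_assoc, ← hσ]
    rfl
  rw [hmap]
  refine exists_of_powClass_eq (kummerProd_ne_zero γ hP hQ hf') (kummerProd_ne_zero γ hP hQ hf) ?_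
  rw [← sub_eq_zero, powClass_kummerProd γ hP hQ hf', powClass_kummerProd γ hP hQ hf]
  have h := (isDistribution_torsK hϖ hγ hodd hP hQ hN hM).invariance hodd hP hQ hPi hQi hcop
    (hcPQ.of_mul_right_left) (hcPQ.of_mul_right_right)
  rw [← h]
  simp only [smul_sub, Finset.sum_sub_distrib]
  abel

end Torsion

end

/-! ### The values of the sine function -/

section

open scoped Classical
variable {F : Type*} [Field F] [Fintype F]

section FracPart

theorem eq_add_fracPart (A : RatFunc F) :
    A = algebraMap F[X] (RatFunc F) (A.num / A.denom) + fracPart A := by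
  have h0 : algebraMap F[X] (RatFunc F) A.denom ≠ 0 := by
    simpa using A.denom_ne_zero
  conv_lhs => rw [← RatFunc.num_div_denom A, ← EuclideanDomain.div_add_mod A.num A.denom]
  rw [map_add, map_mul, add_div, mul_div_cancel_left₀ _ h0]
  rfl

theorem fracPart_frac {C D : F[X]} (h : C.degree < D.degree) :
    fracPart (frac C D) = frac C D := by
  have hD : D ≠ 0 := by
    rintro rfl
    simp at h
  have h1 : (frac C D).num * D = C * (frac C D).denom :=
    (RatFunc.num_mul_eq_mul_denom_iff hD).2 rfl
  have h2 : (frac C D).num.degree < (frac C D).denom.degree := by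
    by_contra hle
    have h3 : (C * (frac C D).denom).degree < (D * (frac C D).denom).degree := by
      rw [Polynomial.degree_mul, Polynomial.degree_mul]
      exact WithBot.add_lt_add_right (by simpa using (frac C D).denom_ne_zero) h
    rw [← h1, mul_comm D, Polynomial.degree_mul, Polynomial.degree_mul] at h3
    exact absurd h3 (not_lt.2 (add_le_add_left (not_lt.1 hle) _))
  rw [fracPart, (Polynomial.mod_eq_self_iff (frac C D).denom_ne_zero).2 h2,
    RatFunc.num_div_denom]

theorem frac_mem_polySubgroup_iff {C D : F[X]} (hD : D ≠ 0) :
    frac C D ∈ polySubgroup F ↔ D ∣ C := by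
  have h0 : algebraMap F[X] (RatFunc F) D ≠ 0 := by simpa using hD
  rw [frac]
  constructor
  · rintro ⟨a, ha⟩
    refine ⟨a, RatFunc.algebraMap_injective F ?_⟩
    have ha' : algebraMap F[X] (RatFunc F) a = _ := ha
    rw [map_mul, ha', mul_div_cancel₀ _ h0]
  · rintro ⟨a, rfl⟩
    refine ⟨a, ?_⟩
    rw [map_mul, mul_div_cancel_left₀ _ h0]
    rfl

theorem sgn_ne_zero {A : RatFunc F} (h : A ≠ 0) : sgn A ≠ 0 := by
  simpa [sgn] using h

end FracPart

section Sine

variable {ϖ ρ : Omega F}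

theorem expAt_div_C (A : RatFunc F) {β : F} (hβ : β ≠ 0) : expAt ϖ (A / RatFunc.C β) =
    algebraMap F[X] (Omega F) (Polynomial.C β⁻¹) * expAt ϖ A := by
  have h := latticeExp_C_mul ϖ (Units.mk0 _ (inv_ne_zero hβ))
    (ϖ * algebraMap (RatFunc F) (Omega F) A)
  rw [Units.val_mk0] at h
  rw [expAt, expAt, ← h, mul_left_comm, IsScalarTower.algebraMap_apply F[X] (RatFunc F) (Omega F),
    ← map_mul, RatFunc.algebraMap_C, map_inv₀, div_eq_inv_mul]

theorem expAt_eq_zero_iff (hϖ : IsCarlitzPeriod ϖ) (A : RatFunc F) :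
    expAt ϖ A = 0 ↔ A ∈ polySubgroup F := by
  rw [expAt, latticeExp_eq_zero_iff hϖ.1]
  refine exists_congr fun a => ?_
  rw [mul_right_inj' hϖ.1, IsScalarTower.algebraMap_apply F[X] (RatFunc F) (Omega F),
    (algebraMap (RatFunc F) (Omega F)).injective.eq_iff, eq_comm]
  rfl

theorem sine_ne_zero (hϖ : IsCarlitzPeriod ϖ) (hρ : ρ ≠ 0) {A : RatFunc F}
    (hA : A ∉ polySubgroup F) : sine ϖ ρ A ≠ 0 := by
  have h1 : fracPart A ∉ polySubgroup F := by
    intro h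
    apply hA
    rw [eq_add_fracPart A]
    exact add_mem ⟨_, rfl⟩ h
  have h2 : fracPart A ≠ 0 := fun h => h1 (h ▸ zero_mem _)
  rw [sine, expAt_div_C _ (sgn_ne_zero h2)]
  refine mul_ne_zero hρ (mul_ne_zero (algebraMap_ne_zero ?_) (mt (expAt_eq_zero_iff hϖ _).1 h1))
  simpa using sgn_ne_zero h2

variable (F) in
/-- The nonzero constants `F^*`, as a multiplicative submonoid of `Ω`. -/
def constSubmonoid : Submonoid (Omega F) :=
  MonoidHom.mrange (((algebraMap F[X] (Omega F)).comp Polynomial.C : F →* Omega F).comp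
    (Units.coeHom F))

theorem C_mem_constSubmonoid {β : F} (hβ : β ≠ 0) :
    algebraMap F[X] (Omega F) (Polynomial.C β) ∈ constSubmonoid F := ⟨Units.mk0 β hβ, rfl⟩

theorem inv_mem_constSubmonoid {x : Omega F} (hx : x ∈ constSubmonoid F) :
    x⁻¹ ∈ constSubmonoid F := by
  obtain ⟨β, rfl⟩ := hx
  refine ⟨β⁻¹, eq_inv_of_mul_eq_one_left ?_⟩
  rw [← map_mul, inv_mul_cancel, map_one]

/-- The sine of `C / D` is the torsion point `e_C(ϖ C / D)`, up to the root `ρ` and a constant. -/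
theorem sine_div_tors_mem (hϖ : IsCarlitzPeriod ϖ) {C D : F[X]} (h : C.degree < D.degree)
    (hd : ¬ D ∣ C) (hρ : ρ ≠ 0) :
    sine ϖ ρ (frac C D) / (ρ * tors ϖ D C) ∈ constSubmonoid F := by
  have hD : D ≠ 0 := by
    rintro rfl
    simp at h
  have h1 := mt (frac_mem_polySubgroup_iff hD).1 hd
  have h2 : frac C D ≠ 0 := fun h0 => h1 (h0 ▸ zero_mem _)
  have h3 := mt (tors_eq_zero_iff hϖ hD C).1 hd
  rw [sine, fracPart_frac h, expAt_div_C _ (sgn_ne_zero h2), ← mul_assoc, mul_comm ρ, mul_assoc,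
    ← tors, mul_div_assoc, div_self (mul_ne_zero hρ h3), mul_one]
  exact C_mem_constSubmonoid (inv_ne_zero (sgn_ne_zero h2))

/-- The homomorphism `sin` on divisors, as a homomorphism of additive groups. -/
def sineAddHom (hϖ : IsCarlitzPeriod ϖ) (hρ : ρ ≠ 0) : Divisors F →+ Additive (Omega F) where
  toFun a := Additive.ofMul (sineHom ϖ ρ a)
  map_zero' := by
    rw [sineHom, Finsupp.prod_zero_index]
    rfl
  map_add' a b := by
    rw [← ofMul_mul]
    congr 1
    refine Finsupp.prod_add_index' (fun _ => zpow_zero _) fun c m n => zpow_add₀ ?_ m n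
    split_ifs with hc
    · exact one_ne_zero
    · obtain ⟨A, rfl⟩ := QuotientAddGroup.mk_surjective c
      exact sine_ne_zero hϖ hρ (mt (QuotientAddGroup.eq_zero_iff A).2 hc)

theorem sineHom_symb {A : RatFunc F} (hA : A ∉ polySubgroup F) :
    sineHom ϖ ρ (symb A) = sine ϖ ρ A := by
  rw [sineHom, symb, Finsupp.prod_single_index (zpow_zero _), zpow_one, if_neg]
  · rfl
  · exact mt (QuotientAddGroup.eq_zero_iff A).1 hA

theorem sineHom_aPQ (hϖ : IsCarlitzPeriod ϖ) (hρ : ρ ≠ 0) (γ : Fˣ) {P Q : F[X]} (hP : P.Monic)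
    (hQ : Q.Monic) : sineHom ϖ ρ (aPQ γ P Q) =
      ∏ A ∈ monicsLT F Q.natDegree, ∏ B ∈ monicsLT F P.natDegree,
      ∏ s ∈ Finset.Icc 1 (Fintype.card F - 2),
        (sine ϖ ρ (frac (B * Q + Polynomial.C ((γ ^ s)⁻¹ : Fˣ).1 * A) (P * Q)) /
          sine ϖ ρ (frac (A * P + Polynomial.C ((γ ^ s)⁻¹ : Fˣ).1 * B) (P * Q))) ^ s := by
  have hPQ : P * Q ≠ 0 := mul_ne_zero hP.ne_zero hQ.ne_zero
  change Additive.toMul (sineAddHom hϖ hρ (aPQ γ P Q)) = _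
  rw [aPQ, map_sum, toMul_sum]
  refine Finset.prod_congr rfl fun A hA => ?_
  rw [map_sum, toMul_sum]
  refine Finset.prod_congr rfl fun B hB => ?_
  rw [map_sum, toMul_sum]
  refine Finset.prod_congr rfl fun s _ => ?_
  rw [map_zsmul, map_sub, toMul_zsmul, toMul_sub, zpow_natCast]
  congr 2
  · refine sineHom_symb ?_
    rw [frac_mem_polySubgroup_iff hPQ]
    exact not_dvd_pair γ hA s
  · refine sineHom_symb ?_
    rw [frac_mem_polySubgroup_iff hPQ, mul_comm P Q]
    exact not_dvd_pair γ hB s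

/-- Grouping the nonzero `P`-torsion points by the action of `F^*` expresses `P` by the `(q - 1)`-th
power of the product over monic `B`. -/
theorem prod_monics_pow (hodd : ringChar F ≠ 2) (hϖ : IsCarlitzPeriod ϖ) {P : F[X]}
    (hP : P.Monic) : (-1) ^ P.natDegree *
      (∏ B ∈ monicsLT F P.natDegree, tors ϖ P B) ^ (Fintype.card F - 1) =
        algebraMap F[X] (Omega F) P := by
  rw [← prod_tors_ne_zero hodd hϖ hP, prod_polysLT_erase]
  have h1 : ∀ B ∈ monicsLT F P.natDegree, ∏ β : Fˣ, tors ϖ P (Polynomial.C β.1 * B) =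
      -1 * tors ϖ P B ^ (Fintype.card F - 1) := by
    intro B _
    simp only [tors_C_mul, Finset.prod_mul_distrib, Finset.prod_const, Finset.card_univ,
      Fintype.card_units]
    congr 1
    have h := congrArg (fun x : Fˣ => algebraMap F[X] (Omega F) (Polynomial.C x.1))
      (FiniteField.prod_univ_units_id_eq_neg_one (K := F))
    simpa only [Units.coe_prod, map_prod, Units.val_neg, Units.val_one, map_neg, map_one] using h
  rw [Finset.prod_congr rfl h1, Finset.prod_mul_distrib, Finset.prod_const, Finset.prod_pow]
  congr 1
  have := odd_card_monicsLT (F := F) hodd P.natDegree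
  rcases Nat.even_or_odd P.natDegree with h | h
  · rw [h.neg_one_pow, Even.neg_one_pow]
    exact Nat.not_odd_iff_even.1 (mt this.1 (Nat.not_odd_iff_even.2 h))
  · rw [h.neg_one_pow, (this.2 h).neg_one_pow]

/-- The chosen square root of `P` agrees with the power of torsion points in `kummerProd`, up to a
square root of `(-1) ^ (deg P * d)`. The two such factors of `u_{PQ}` involve the same sign, so that
their product is `± 1`. -/
theorem sq_root_div (hodd : ringChar F ≠ 2) (hϖ : IsCarlitzPeriod ϖ) {P : F[X]}
    (hP : P.Monic) {sP : Omega F} (hsP : sP ^ 2 = algebraMap F[X] (Omega F) P) (d : ℕ) :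
    ((if Odd d then sP else 1) /
      (∏ B ∈ monicsLT F P.natDegree, tors ϖ P B) ^ halfExp F d) ^ 2 =
      (-1) ^ (P.natDegree * d) := by
  have h0 : ∏ B ∈ monicsLT F P.natDegree, tors ϖ P B ≠ 0 := by
    refine Finset.prod_ne_zero_iff.2 fun B hB => ?_
    rw [Ne, tors_eq_zero_iff hϖ hP.ne_zero]
    rw [mem_monicsLT] at hB
    exact fun h => absurd (Polynomial.natDegree_le_of_dvd h hB.1.ne_zero) (not_le.2 hB.2)
  have h1 := prod_monics_pow hodd hϖ hP
  rw [halfExp]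
  split_ifs with hd
  · rw [div_pow, hsP, ← pow_mul, mul_comm _ 2, two_mul_half hodd, ← h1,
      mul_div_assoc, div_self (pow_ne_zero _ h0), mul_one, pow_mul]
    rcases Nat.even_or_odd P.natDegree with h | h
    · rw [h.neg_one_pow, one_pow]
    · rw [h.neg_one_pow, hd.neg_one_pow]
  · rw [pow_zero, div_one, one_pow, Even.neg_one_pow]
    exact (Nat.not_odd_iff_even.1 hd).mul_left _

theorem degree_pair_lt (β : F) {P Q A B : F[X]} (hQ : Q.Monic)
    (hA : A.Monic ∧ A.natDegree < Q.natDegree) (hB : B.Monic ∧ B.natDegree < P.natDegree) :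
    (B * Q + Polynomial.C β * A).degree < ((P.natDegree + Q.natDegree : ℕ) : WithBot ℕ) := by
  refine (Polynomial.degree_add_le _ _).trans_lt (max_lt ?_ ?_)
  · rw [Polynomial.degree_eq_natDegree (hB.1.mul hQ).ne_zero, hB.1.natDegree_mul hQ]
    exact_mod_cast Nat.add_lt_add_right hB.2 _
  · rw [← Polynomial.smul_eq_C_mul]
    refine (Polynomial.degree_smul_le _ _).trans_lt ?_
    rw [Polynomial.degree_eq_natDegree hA.1.ne_zero]
    exact_mod_cast hA.2.trans_le (Nat.le_add_left _ _)

/-- Up to a nonzero constant, `u_{PQ}` is the product `kummerProd` of torsion points; the factors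
`ρ` cancel. -/
theorem uPQ_div_kummerProd_mem (hodd : ringChar F ≠ 2) (hϖ : IsCarlitzPeriod ϖ) (hρ : ρ ≠ 0)
    (γ : Fˣ) {P Q : F[X]} (hP : P.Monic) (hQ : Q.Monic) {sP sQ : Omega F}
    (hsP : sP ^ 2 = algebraMap F[X] (Omega F) P) (hsQ : sQ ^ 2 = algebraMap F[X] (Omega F) Q) :
    uPQ ϖ ρ γ P Q sP sQ / kummerProd γ P Q (tors ϖ (P * Q)) ∈ constSubmonoid F := by
  have hPQ : P * Q ≠ 0 := mul_ne_zero hP.ne_zero hQ.ne_zero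
  have e1 : ∀ B, tors ϖ (P * Q) (Q * B) = tors ϖ P B := fun B => by
    rw [mul_comm Q, tors_mul_mul_right ϖ hQ.ne_zero]
  have e2 : ∀ A, tors ϖ (P * Q) (P * A) = tors ϖ Q A := fun A => by
    rw [mul_comm P, mul_comm P, tors_mul_mul_right ϖ hP.ne_zero]
  rw [uPQ, kummerProd, mul_div_mul_comm, mul_div_mul_comm]
  simp only [e1, e2]
  refine mul_mem ?_ ?_
  · have h1 := sq_root_div hodd hϖ hP hsP Q.natDegree
    have h2 := sq_root_div hodd hϖ hQ hsQ P.natDegree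
    have h3 := congrArg₂ (· * ·) h1 h2
    rw [← mul_pow, mul_comm Q.natDegree, ← mul_pow, neg_one_mul, neg_neg, one_pow,
      sq_eq_one_iff] at h3
    rcases h3 with h3 | h3
    · rw [h3]
      exact one_mem _
    · rw [h3]
      refine ⟨-1, ?_⟩
      simp
  · rw [sineHom_aPQ hϖ hρ γ hP hQ]
    simp only [← Finset.prod_div_distrib, ← div_pow]
    refine prod_mem fun A hA => prod_mem fun B hB => prod_mem fun s _ => pow_mem ?_ s
    have hdeg : (P * Q).natDegree = P.natDegree + Q.natDegree := hP.natDegree_mul hQ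
    rw [mem_monicsLT] at hA hB
    have h1 : (B * Q + Polynomial.C ((γ ^ s)⁻¹ : Fˣ).1 * A).degree < (P * Q).degree := by
      rw [Polynomial.degree_eq_natDegree hPQ, hdeg]
      exact degree_pair_lt _ hQ hA hB
    have h2 : (A * P + Polynomial.C ((γ ^ s)⁻¹ : Fˣ).1 * B).degree < (P * Q).degree := by
      rw [Polynomial.degree_eq_natDegree hPQ, hdeg, add_comm P.natDegree]
      exact degree_pair_lt _ hP hB hA
    have h3 := sine_div_tors_mem hϖ h1 (not_dvd_pair γ (mem_monicsLT.2 hA) s) hρ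
    have h4 := sine_div_tors_mem hϖ h2 (by
      rw [mul_comm P Q]
      exact not_dvd_pair γ (mem_monicsLT.2 hB) s) hρ
    have h5 := mul_mem h3 (inv_mem_constSubmonoid h4)
    rwa [← div_eq_mul_inv, div_div_div_comm, mul_div_mul_left _ _ hρ] at h5

theorem coe_kummerProd {k E : Type*} [Field k] [Field E] [Algebra k E] (K : IntermediateField k E)
    (γ : Fˣ) (P Q : F[X]) (f : F[X] → K) :
    ((kummerProd γ P Q f : K) : E) = kummerProd γ P Q fun a => (f a : E) :=
  map_kummerProd γ P Q (algebraMap K E) f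

/-- The element `u_{PQ}` lies in the cyclotomic field, and its class modulo `(q-1)`-th powers is
fixed by the Galois group. -/
theorem exists_uPQ_mem (hodd : ringChar F ≠ 2) (hϖ : IsCarlitzPeriod ϖ) (hρ : ρ ≠ 0)
    {γ : Fˣ} (hγ : ∀ x : Fˣ, x ∈ Subgroup.zpowers γ) {M P Q : F[X]} (hM : M.Monic)
    (hP : P ∈ monicPrimeFactors M) (hQ : Q ∈ monicPrimeFactors M) (hPQ : P ≠ Q)
    {sP sQ : Omega F} (hsP : sP ^ 2 = algebraMap F[X] (Omega F) P)
    (hsQ : sQ ^ 2 = algebraMap F[X] (Omega F) Q) :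
    ∃ u : cyclotomicField ϖ M, u ≠ 0 ∧ (u : Omega F) = uPQ ϖ ρ γ P Q sP sQ ∧
      ∀ σ : Gal(cyclotomicField ϖ M/RatFunc F), ∃ z : cyclotomicField ϖ M, z ≠ 0 ∧
        σ u = u * z ^ (Fintype.card F - 1) := by
  obtain ⟨hPm, hPi, hPM⟩ := hP
  obtain ⟨hQm, hQi, hQM⟩ := hQ
  have hcop : IsCoprime P Q := by
    refine (hPi.coprime_iff_not_dvd).2 fun h => hPQ ?_
    exact Polynomial.eq_of_monic_of_associated hPm hQm (hPi.associated_of_dvd hQi h)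
  obtain ⟨N, hN⟩ := hcop.mul_dvd hPM hQM
  have hN0 : N ≠ 0 := by
    rintro rfl
    exact hM.ne_zero (by rw [hN, mul_zero])
  have hf : ∀ a, ¬ P * Q ∣ a → torsK hϖ M (a * N) ≠ 0 := fun a ha => by
    rwa [Ne, torsK_eq_zero_iff hϖ hM.ne_zero, hN, mul_dvd_mul_iff_right hN0]
  obtain ⟨β, hβ⟩ := uPQ_div_kummerProd_mem hodd hϖ hρ γ hPm hQm hsP hsQ
  set w := kummerProd γ P Q fun a => torsK hϖ M (a * N) with hw
  have hw0 : w ≠ 0 := kummerProd_ne_zero γ hPm hQm hf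
  have hwΩ : (w : Omega F) = kummerProd γ P Q (tors ϖ (P * Q)) := by
    rw [hw, coe_kummerProd]
    simp only [coe_torsK_mul hϖ hN0 hN]
  have hw0' : (w : Omega F) ≠ 0 := fun h => hw0 (Subtype.ext h)
  set b := algebraMap (RatFunc F) (cyclotomicField ϖ M) (RatFunc.C β.1) with hb
  have hb0 : b ≠ 0 := by
    rw [hb, Ne, map_eq_zero, map_eq_zero]
    exact β.ne_zero
  have hbΩ : (b : Omega F) = algebraMap F[X] (Omega F) (Polynomial.C β.1) := by
    rw [IsScalarTower.algebraMap_apply F[X] (RatFunc F) (Omega F), RatFunc.algebraMap_C]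
    rfl
  refine ⟨b * w, mul_ne_zero hb0 hw0, ?_, fun σ => ?_⟩
  · rw [MulMemClass.coe_mul, hbΩ, hwΩ]
    rw [hwΩ] at hw0'
    exact ((div_eq_iff hw0').1 hβ.symm).symm
  · obtain ⟨z, hz, h⟩ := galois_kummerProd hϖ hodd hPm hQm hPi hQi hcop hM hN0 hN hγ σ
    refine ⟨z, hz, ?_⟩
    rw [map_mul, hb, AlgEquiv.commutes, h, mul_assoc]

end Sine

end

/-! ### Kummer extensions of Galois extensions -/

section

section KummerOverGalois

variable {k K E : Type*} [Field k] [Field K] [Field E] [Algebra k K] [Algebra k E] [Algebra K E]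
  [IsScalarTower k K E]

theorem isLifting_restrictNormal [Normal k K] (τ : Gal(E/k)) : IsLifting (τ.restrictNormal K) τ :=
  fun x => (AlgEquiv.restrictNormal_commutes τ K x).symm

theorem IsLifting.mul {σ₁ σ₂ : Gal(K/k)} {τ₁ τ₂ : Gal(E/k)} (h₁ : IsLifting σ₁ τ₁)
    (h₂ : IsLifting σ₂ τ₂) : IsLifting (σ₁ * σ₂) (τ₁ * τ₂) := fun x => by
  rw [AlgEquiv.mul_apply, h₂ x, h₁ (σ₂ x), AlgEquiv.mul_apply]

theorem IsLifting.one : IsLifting (1 : Gal(K/k)) (1 : Gal(E/k)) := fun _ => rfl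

theorem IsLifting.inv {σ : Gal(K/k)} {τ : Gal(E/k)} (h : IsLifting σ τ) :
    IsLifting σ⁻¹ τ⁻¹ := fun x => by
  apply τ.injective
  rw [h, ← AlgEquiv.mul_apply, ← AlgEquiv.mul_apply]
  simp

theorem IsLifting.pow {σ : Gal(K/k)} {τ : Gal(E/k)} (h : IsLifting σ τ) (m : ℕ) :
    IsLifting (σ ^ m) (τ ^ m) := by
  induction m with
  | zero => simpa using IsLifting.one
  | succ m ih => rw [pow_succ, pow_succ]; exact ih.mul h

theorem IsLifting.unique {σ₁ σ₂ : Gal(K/k)} {τ : Gal(E/k)} (h₁ : IsLifting σ₁ τ)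
    (h₂ : IsLifting σ₂ τ) : σ₁ = σ₂ := by
  ext x
  exact (algebraMap K E).injective ((h₁ x).symm.trans (h₂ x))

theorem isLifting_iff [Normal k K] {σ : Gal(K/k)} {τ : Gal(E/k)} :
    IsLifting σ τ ↔ AlgEquiv.restrictNormalHom K τ = σ :=
  ⟨fun h => (isLifting_restrictNormal τ).unique h, fun h => h ▸ isLifting_restrictNormal τ⟩

/-- An automorphism of `E = K(y)` over `k` is determined by its restriction to `K` and its value at
`y`. -/
theorem galois_ext_of_adjoin {y : E} (hE : IntermediateField.adjoin K {y} = ⊤) {τ₁ τ₂ : Gal(E/k)}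
    (hK : ∀ x : K, τ₁ (algebraMap K E x) = τ₂ (algebraMap K E x)) (hy : τ₁ y = τ₂ y) :
    τ₁ = τ₂ := by
  ext x
  have hx : x ∈ IntermediateField.adjoin K {y} := hE ▸ IntermediateField.mem_top
  induction hx using IntermediateField.adjoin_induction with
  | mem x hx => rw [Set.mem_singleton_iff.1 hx, hy]
  | algebraMap x => exact hK x
  | add x z _ _ h1 h2 => rw [map_add, map_add, h1, h2]
  | inv x _ h => rw [map_inv₀, map_inv₀, h]
  | mul x z _ _ h1 h2 => rw [map_mul, map_mul, h1, h2]

theorem exists_ringHom_of_splits {E' : Type*} [Field E'] (p : K[X]) [p.IsSplittingField K E]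
    {f : K →+* E'} (hp : (p.map f).Splits) :
    ∃ φ : E →+* E', ∀ x, φ (algebraMap K E x) = f x := by
  let _ := f.toAlgebra
  exact ⟨(Polynomial.IsSplittingField.lift E p hp).toRingHom,
    (Polynomial.IsSplittingField.lift E p hp).commutes⟩

variable {n : ℕ} [NeZero n] {ζ : k} (hζ : IsPrimitiveRoot ζ n) {u : K} (hu : u ≠ 0) {y : E}
  (hy : y ^ n = algebraMap K E u) (hE : IntermediateField.adjoin K {y} = ⊤)

include hζ hu hy hE

omit hu in
theorem isSplittingField_kummer : (Polynomial.X ^ n - Polynomial.C u).IsSplittingField K E := by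
  have hζE : IsPrimitiveRoot (algebraMap k E ζ) n :=
    hζ.map_of_injective (algebraMap k E).injective
  rw [isSplittingField_iff_intermediateField]
  constructor
  · rw [Polynomial.map_sub, Polynomial.map_pow, Polynomial.map_X, Polynomial.map_C, ← hy]
    exact X_pow_sub_C_splits_of_isPrimitiveRoot hζE rfl
  · rw [eq_top_iff, ← hE, IntermediateField.adjoin_simple_le_iff]
    apply IntermediateField.subset_adjoin
    rw [Polynomial.mem_rootSet]
    refine ⟨Polynomial.X_pow_sub_C_ne_zero (NeZero.pos n) u, ?_⟩
    simp [hy]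

theorem isGalois_kummer_top : IsGalois K E := by
  have := isSplittingField_kummer hζ hy hE
  have hn : (n : K) ≠ 0 := by
    have := hζ.neZero'
    rw [← map_natCast (algebraMap k K), Ne, map_eq_zero]
    exact NeZero.ne _
  exact IsGalois.of_separable_splitting_field (Polynomial.separable_X_pow_sub_C u hn hu)

omit hu in
theorem finiteDimensional_kummer [FiniteDimensional k K] : FiniteDimensional k E := by
  have := isSplittingField_kummer hζ hy hE
  have := Polynomial.IsSplittingField.finiteDimensional E (Polynomial.X ^ n - Polynomial.C u)
  exact FiniteDimensional.trans k K E

omit hu in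
/-- If `σ` changes `u` by an `n`-th power, then `σ` lifts to `K(u^(1/n))`. -/
theorem exists_isLifting [FiniteDimensional k K] {σ : Gal(K/k)} {z : K} (hz : σ u = u * z ^ n) :
    ∃ τ : Gal(E/k), IsLifting σ τ := by
  have hsf := isSplittingField_kummer hζ hy hE
  have := finiteDimensional_kummer hζ hy hE
  have hζE : IsPrimitiveRoot (algebraMap k E ζ) n :=
    hζ.map_of_injective (algebraMap k E).injective
  have hs : ((Polynomial.X ^ n - Polynomial.C u).map
      ((algebraMap K E).comp (σ : K →+* K))).Splits := by
    rw [Polynomial.map_sub, Polynomial.map_pow, Polynomial.map_X, Polynomial.map_C]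
    refine X_pow_sub_C_splits_of_isPrimitiveRoot hζE (α := y * algebraMap K E z) ?_
    rw [mul_pow, hy, ← map_pow, ← map_mul, ← hz]
    rfl
  obtain ⟨φ, hφ⟩ := exists_ringHom_of_splits (E := E) (Polynomial.X ^ n - Polynomial.C u) hs
  let φ' : E →ₐ[k] E := { φ with
    commutes' := fun x => by
      rw [IsScalarTower.algebraMap_apply k K E]
      exact (hφ _).trans (congrArg _ (σ.commutes x)) }
  exact ⟨AlgEquiv.ofBijective φ' (Algebra.IsAlgebraic.algHom_bijective φ'), hφ⟩

variable (hσ : ∀ σ : Gal(K/k), ∃ z, σ u = u * z ^ n)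
include hσ

/-- If the class of `u` modulo `n`-th powers is invariant under `Gal(K/k)`, then `K(u^(1/n))` is
Galois over `k`. -/
theorem isGalois_kummer [FiniteDimensional k K] [IsGalois k K] : IsGalois k E := by
  have := finiteDimensional_kummer hζ hy hE
  have hKE := isGalois_kummer_top hζ hu hy hE
  have : FiniteDimensional K E := FiniteDimensional.right k K E
  apply IsGalois.of_fixedField_eq_bot
  rw [eq_bot_iff]
  intro x hx
  have hx' : ∀ τ : Gal(E/k), τ x = x := fun τ => hx ⟨τ, Subgroup.mem_top _⟩
  obtain ⟨x, rfl⟩ := (IsGalois.mem_range_algebraMap_iff_fixed (F := K) x).2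
    fun τ => hx' (τ.restrictScalars k)
  obtain ⟨a, rfl⟩ := (IsGalois.mem_range_algebraMap_iff_fixed (F := k) x).2 (fun σ => by
    obtain ⟨z, hz⟩ := hσ σ
    obtain ⟨τ, hτ⟩ := exists_isLifting hζ hy hE hz
    apply (algebraMap K E).injective
    rw [← hτ, hx'])
  rw [← IsScalarTower.algebraMap_apply]
  exact IntermediateField.algebraMap_mem _ _

omit hE in
/-- Every automorphism multiplies the Kummer generator by an element of `K`. -/
theorem exists_root_mul [Normal k K] (g : Gal(E/k)) : ∃ z : K, g y = algebraMap K E z * y := by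
  obtain ⟨z, hz⟩ := hσ (g.restrictNormal K)
  have hζE : IsPrimitiveRoot (algebraMap k E ζ) n :=
    hζ.map_of_injective (algebraMap k E).injective
  have h1 : (g y) ^ n = (y * algebraMap K E z) ^ n := by
    rw [← map_pow, hy, isLifting_restrictNormal g u, hz, mul_pow, hy, map_mul, map_pow]
  have h2 : y * algebraMap K E z ≠ 0 := by
    intro h
    rw [h, zero_pow (NeZero.ne n), ← map_pow, hy, map_eq_zero, map_eq_zero] at h1
    exact hu h1
  have h3 : (g y / (y * algebraMap K E z)) ^ n = 1 := by
    rw [div_pow, h1, div_self (pow_ne_zero _ h2)]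
  obtain ⟨i, -, hi⟩ := hζE.eq_pow_of_pow_eq_one h3
  refine ⟨algebraMap k K ζ ^ i * z, ?_⟩
  rw [eq_div_iff h2] at hi
  rw [← hi, map_mul, map_pow, ← IsScalarTower.algebraMap_apply]
  ring

omit hE hσ in
theorem exists_root_mul_of_isLifting_one {τ : Gal(E/k)}
    (hτ : IsLifting (1 : Gal(K/k)) τ) : ∃ z : k, z ^ n = 1 ∧ τ y = algebraMap k E z * y := by
  have hζE : IsPrimitiveRoot (algebraMap k E ζ) n :=
    hζ.map_of_injective (algebraMap k E).injective
  have hy0 : y ≠ 0 := by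
    rintro rfl
    rw [zero_pow (NeZero.ne n), eq_comm, map_eq_zero] at hy
    exact hu hy
  have h1 : (τ y / y) ^ n = 1 := by
    rw [div_pow, ← map_pow, hy, hτ u, AlgEquiv.one_apply, ← hy, div_self (pow_ne_zero _ hy0)]
  obtain ⟨i, -, hi⟩ := hζE.eq_pow_of_pow_eq_one h1
  rw [eq_div_iff hy0, ← map_pow] at hi
  refine ⟨ζ ^ i, ?_, hi.symm⟩
  rw [← pow_mul, mul_comm, pow_mul, hζ.pow_eq_one, one_pow]

/-- The group `Gal(K(u^(1/n))/K)` is central in `Gal(K(u^(1/n))/k)`, since the `n`-th roots of unity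
lie in `k`. -/
theorem mul_comm_of_isLifting_one [Normal k K] {τ : Gal(E/k)} (hτ : IsLifting (1 : Gal(K/k)) τ)
    (g : Gal(E/k)) : τ * g = g * τ := by
  obtain ⟨w, hw⟩ := exists_root_mul hζ hu hy hσ g
  obtain ⟨z, -, hz⟩ := exists_root_mul_of_isLifting_one hζ hu hy hτ
  refine galois_ext_of_adjoin hE (fun x => ?_) ?_
  · rw [AlgEquiv.mul_apply, AlgEquiv.mul_apply, hτ, isLifting_restrictNormal g, hτ,
      AlgEquiv.one_apply, AlgEquiv.one_apply, isLifting_restrictNormal g]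
  · rw [AlgEquiv.mul_apply, AlgEquiv.mul_apply, hw, hz, map_mul, map_mul, hτ, hz, hw,
      AlgEquiv.commutes, AlgEquiv.one_apply]
    ring

omit hσ in
theorem pow_eq_one_of_isLifting_one {τ : Gal(E/k)} (hτ : IsLifting (1 : Gal(K/k)) τ) :
    τ ^ n = 1 := by
  obtain ⟨z, hzn, hz⟩ := exists_root_mul_of_isLifting_one hζ hu hy hτ
  have h1 : ∀ m : ℕ, (τ ^ m) y = algebraMap k E (z ^ m) * y := by
    intro m
    induction m with
    | zero => simp
    | succ m ih =>
      rw [pow_succ, AlgEquiv.mul_apply, hz, map_mul, AlgEquiv.commutes, ih, pow_succ, map_mul]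
      ring
  refine galois_ext_of_adjoin hE (fun x => ?_) ?_
  · rw [hτ.pow n, one_pow]
    rfl
  · rw [h1, hzn, map_one, one_mul, AlgEquiv.one_apply]

end KummerOverGalois

end

/-! ### The tame character and the first ramification group -/

section

section Tame

variable {O : Type*} [CommRing O] [IsDedekindDomain O] (𝔓 : Ideal O) {G : Type*} [Group G]
  [MulSemiringAction G O]

variable {𝔓} in
theorem smul_mem_of_inertia {g : G} (hg : g ∈ 𝔓.inertia G) (i : ℕ) {x : O} (hx : x ∈ 𝔓 ^ i) :
    g • x ∈ 𝔓 ^ i := by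
  have h : (𝔓 ^ i).map (MulSemiringAction.toRingHom G O g) ≤ 𝔓 ^ i := by
    rw [Ideal.map_pow]
    refine Ideal.pow_right_mono (Ideal.map_le_iff_le_comap.2 fun y hy => ?_) i
    have := add_mem (hg y) hy
    rwa [sub_add_cancel] at this
  exact h (Ideal.mem_map_of_mem _ hx)

variable {𝔓} in
theorem smul_sub_mem_pow_succ {g : G} (hg : g ∈ (𝔓 ^ 2).inertia G) (i : ℕ) {x : O}
    (hx : x ∈ 𝔓 ^ i) : g • x - x ∈ 𝔓 ^ (i + 1) := by
  have hg1 : g ∈ 𝔓.inertia G := fun x => Ideal.pow_le_self two_ne_zero (hg x)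
  induction i generalizing x with
  | zero => simpa using hg1 x
  | succ i ih =>
    rw [pow_succ] at hx
    induction hx using Submodule.mul_induction_on' with
    | mem_mul_mem a ha b hb =>
      have h1 : g • (a * b) - a * b = g • a * (g • b - b) + (g • a - a) * b := by
        rw [smul_mul']
        ring
      rw [h1]
      refine add_mem ?_ ?_
      · have := Ideal.mul_mem_mul (smul_mem_of_inertia hg1 i ha) (hg b)
        rwa [← pow_add] at this
      · rw [pow_succ]
        exact Ideal.mul_mem_mul (ih ha) hb
    | add x _ y _ hx hy =>
      rw [smul_add, add_sub_add_comm]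
      exact add_mem hx hy

/-- The first ramification group has no nontrivial elements of order prime to the residue
characteristic. -/
theorem smul_eq_of_mem_inertia_sq [𝔓.IsPrime] {g : G} (hg : g ∈ (𝔓 ^ 2).inertia G) {m : ℕ}
    (hm : g ^ m = 1) (hm' : IsUnit (m : O)) (x : O) : g • x = x := by
  obtain ⟨m', hm'⟩ := hm'
  -- If `g` is trivial modulo `𝔓 ^ i`, then `m * x` is congruent to the sum `y` of the conjugates of
  -- `x` under `g`, and `g` fixes `y`; as `m` is a unit, `g` is trivial modulo `𝔓 ^ (i + 1)`.
  have key : ∀ i : ℕ, ∀ x : O, g • x - x ∈ 𝔓 ^ i := by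
    intro i
    induction i with
    | zero => simp
    | succ i ih =>
      intro x
      have hpow : ∀ j : ℕ, ∀ x : O, g ^ j • x - x ∈ 𝔓 ^ i := by
        intro j
        induction j with
        | zero => simp
        | succ j ihj =>
          intro x
          have := add_mem (ihj (g • x)) (ih x)
          rwa [sub_add_sub_cancel, ← mul_smul, ← pow_succ] at this
      set y := ∑ j ∈ Finset.range m, g ^ j • x with hy
      have h1 : g • y = y := by
        have h2 := Finset.sum_range_succ' (fun j => g ^ j • x) m
        rw [Finset.sum_range_succ, hm, pow_zero, add_left_inj] at h2
        rw [hy, Finset.smul_sum]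
        rw [h2]
        simp only [← mul_smul, pow_succ']
      have h3 : y - m * x ∈ 𝔓 ^ i := by
        have : y - m * x = ∑ j ∈ Finset.range m, (g ^ j • x - x) := by
          simp [Finset.sum_sub_distrib, hy]
        rw [this]
        exact sum_mem fun j _ => hpow j x
      have h4 := smul_sub_mem_pow_succ hg i h3
      have h5 : g • (y - m * x) - (y - m * x) = -(m * (g • x - x)) := by
        have hnat : g • (m : O) = m := map_natCast (MulSemiringAction.toRingHom G O g) m
        rw [smul_sub, h1, smul_mul', hnat]
        ring
      rw [h5, neg_mem_iff, ← hm'] at h4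
      exact (Ideal.unit_mul_mem_iff_mem _ m'.isUnit).1 h4
  have hinf : g • x - x ∈ (⨅ i : ℕ, 𝔓 ^ i) := (Submodule.mem_iInf _).2 fun i => key i x
  rw [Ideal.iInf_pow_eq_bot_of_isDomain 𝔓 (Ideal.IsPrime.ne_top ‹_›)] at hinf
  exact sub_eq_zero.1 hinf

variable [𝔓.IsMaximal]

variable {𝔓} in
/-- If an element of the inertia group fixes a uniformizer modulo `𝔓 ^ 2`, then it lies in the first
ramification group: for residue fields of `q` elements, `x ↦ g x - x` kills `q`-th powers modulo
`𝔓 ^ 2`, and every residue class is a `q`-th power. -/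
theorem mem_inertia_sq_of_uniformizer (p : ℕ) [Fact p.Prime] [CharP O p] [Finite (O ⧸ 𝔓)]
    (hP : 𝔓 ≠ ⊥) {π : O} (hπ : π ∈ 𝔓) (hπ' : π ∉ 𝔓 ^ 2) {g : G}
    (hg : g ∈ 𝔓.inertia G) (h : g • π - π ∈ 𝔓 ^ 2) : g ∈ (𝔓 ^ 2).inertia G := by
  have h𝔓 : ∀ x ∈ 𝔓, g • x - x ∈ 𝔓 ^ 2 := by
    intro x hx
    obtain ⟨d, e, he, rfl⟩ := Ideal.exists_mul_add_mem_pow_succ (P := 𝔓) hP (i := 1) π x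
      (by simpa using hπ) (by simpa using hπ') (by simpa using hx)
    have h1 : g • (π * d + e) - (π * d + e) =
        (g • π - π) * (g • d) + π * (g • d - d) + (g • e - e) := by
      rw [smul_add, smul_mul']
      ring
    rw [h1]
    refine add_mem (add_mem (Ideal.mul_mem_right _ _ h) ?_)
      (sub_mem (smul_mem_of_inertia hg 2 he) he)
    rw [sq]
    exact Ideal.mul_mem_mul hπ (hg d)
  intro x
  let _ := Ideal.Quotient.field 𝔓
  let _ := Fintype.ofFinite (O ⧸ 𝔓)
  have hch : CharP (O ⧸ 𝔓) p := by
    rw [CharP.charP_iff_prime_eq_zero Fact.out, ← map_natCast (Ideal.Quotient.mk 𝔓),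
      CharP.cast_eq_zero, map_zero]
  obtain ⟨⟨n, hn0⟩, -, hn⟩ := FiniteField.card (O ⧸ 𝔓) p
  replace hn : Fintype.card (O ⧸ 𝔓) = p ^ n := hn
  have h1 : x ^ p ^ n - x ∈ 𝔓 := by
    rw [← Ideal.Quotient.eq, map_pow, ← hn, FiniteField.pow_card]
  have h2 := h𝔓 _ h1
  have h3 : g • (x ^ p ^ n) - x ^ p ^ n ∈ 𝔓 ^ 2 := by
    rw [smul_pow', ← sub_pow_char_pow]
    have h4 := Ideal.pow_mem_pow (hg x) (p ^ n)
    refine Ideal.pow_le_pow_right ?_ h4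
    exact (Nat.Prime.two_le Fact.out).trans (Nat.le_self_pow hn0.ne' p)
  have h5 := sub_mem h3 h2
  rw [smul_sub, sub_sub_sub_comm, sub_sub_cancel, sub_sub_cancel] at h5
  exact h5

/-- The character of the inertia group with values in the units of the residue field, whose kernel
is the first ramification group: for a uniformizer `π`, it maps `g` to the class of `g π / π`. -/
theorem exists_tame_character (p : ℕ) [Fact p.Prime] [CharP O p] [Finite (O ⧸ 𝔓)]
    (hP : 𝔓 ≠ ⊥) : ∃ θ : 𝔓.inertia G →* (O ⧸ 𝔓)ˣ, ∀ g, θ g = 1 ↔ (g : G) ∈ (𝔓 ^ 2).inertia G := by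
  obtain ⟨π, hπ, hπ'⟩ : ∃ π ∈ 𝔓, π ∉ 𝔓 ^ 2 := by
    have := Ideal.pow_succ_lt_pow hP 1
    rw [pow_one] at this
    obtain ⟨π, h1, h2⟩ := SetLike.exists_of_lt this
    exact ⟨π, h1, h2⟩
  have hex : ∀ g : 𝔓.inertia G, ∃ d, g • π - π * d ∈ 𝔓 ^ 2 := by
    intro g
    have h1 := smul_mem_of_inertia g.2 1 (x := π) (by simpa using hπ)
    obtain ⟨d, e, he, h2⟩ := Ideal.exists_mul_add_mem_pow_succ (P := 𝔓) hP (i := 1) π (g.1 • π)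
      (by simpa using hπ) (by simpa using hπ') h1
    refine ⟨d, ?_⟩
    have h3 : g • π = π * d + e := h2.symm
    rwa [h3, add_sub_cancel_left]
  choose d hd using hex
  have huniq : ∀ a b : O, π * (a - b) ∈ 𝔓 ^ 2 → a - b ∈ 𝔓 := by
    intro a b hab
    refine Ideal.mul_add_mem_pow_succ_unique (P := 𝔓) hP (i := 1) π a b 0 0 hπ'
      (zero_mem _) (zero_mem _) ?_
    rwa [add_zero, add_zero, ← mul_sub]
  have h1 : d 1 - 1 ∈ 𝔓 := by
    apply huniq
    have := neg_mem (hd 1)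
    rw [one_smul] at this
    convert this using 1
    ring
  have hmul : ∀ g h, d (g * h) - d g * d h ∈ 𝔓 := by
    intro g h
    apply huniq
    have e1 := hd (g * h)
    have e2 : g • (h • π - π * d h) ∈ 𝔓 ^ 2 := smul_mem_of_inertia g.2 2 (hd h)
    have e3 : π * (g • d h - d h) ∈ 𝔓 ^ 2 := by
      rw [sq]
      exact Ideal.mul_mem_mul hπ (g.2 (d h))
    have e4 := Ideal.mul_mem_right (g • d h) _ (hd g)
    rw [smul_sub, smul_mul', ← mul_smul] at e2
    have e5 : π * (d (g * h) - d g * d h) = -((g * h) • π - π * d (g * h)) +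
        ((g * h) • π - g • π * g • d h) + (g • π - π * d g) * g • d h +
        (π * (g • d h - d h)) * d g := by ring
    rw [e5]
    exact add_mem (add_mem (add_mem (neg_mem e1) e2) e4) (Ideal.mul_mem_right _ _ e3)
  let θ : 𝔓.inertia G →* O ⧸ 𝔓 :=
    { toFun := fun g => Ideal.Quotient.mk 𝔓 (d g)
      map_one' := by rwa [← map_one (Ideal.Quotient.mk 𝔓), Ideal.Quotient.eq]
      map_mul' := fun g h => by rw [← map_mul, Ideal.Quotient.eq]; exact hmul g h }
  refine ⟨θ.toHomUnits, fun g => ?_⟩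
  have h2 : θ.toHomUnits g = 1 ↔ d g - 1 ∈ 𝔓 := by
    rw [Units.ext_iff, ← Ideal.Quotient.eq, map_one]
    rfl
  rw [h2]
  constructor
  · intro h
    refine mem_inertia_sq_of_uniformizer p hP hπ hπ' g.2 ?_
    have h3 : g.1 • π - π = (g • π - π * d g) + π * (d g - 1) := by
      change g • π - π = _
      ring
    rw [h3]
    refine add_mem (hd g) ?_
    rw [sq]
    exact Ideal.mul_mem_mul hπ h
  · intro h
    apply huniq
    have h3 : π * (d g - 1) = (g.1 • π - π) - (g • π - π * d g) := by
      change _ = g • π - π - _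
      ring
    rw [h3]
    exact sub_mem (h π) (hd g)

end Tame

end

/-! ### Inertia groups and ramification indices -/

section

section Inertia

/-- The order of the inertia group is the ramification index. -/
theorem card_inertia_eq_ramificationIdx (G A : Type*) {B : Type*} [CommRing A] [IsDedekindDomain A]
    [CommRing B] [IsDomain B] [Algebra A B] [Module.Finite A B] [Module.IsTorsionFree A B]
    [Group G] [Finite G] [MulSemiringAction G B] [IsGaloisGroup G A B] (𝔓 : Ideal B) [𝔓.IsPrime]
    (h : 𝔓.under A ≠ ⊥) [Finite (A ⧸ 𝔓.under A)] :
    Nat.card (𝔓.inertia G) = 𝔓.ramificationIdx A := by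
  have : (𝔓.under A).IsMaximal := Ideal.IsPrime.isMaximal inferInstance h
  have hfin : Finite (𝔓.under A).ResidueField :=
    Finite.of_surjective _ (Ideal.bijective_algebraMap_quotient_residueField (𝔓.under A)).2
  rw [Ideal.card_inertia_eq_ramificationIdxIn (𝔓.under A) 𝔓,
    Ideal.ramificationIdxIn_eq_ramificationIdx (𝔓.under A) 𝔓 G]

variable {R k K E : Type*} [CommRing R] [IsDedekindDomain R] [Field k] [Field K] [Field E]
  [Algebra k K] [Algebra k E] [Algebra K E] [IsScalarTower k K E]
  [Algebra R k] [IsFractionRing R k] [Algebra R K] [Algebra R E]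
  [IsScalarTower R k K] [IsScalarTower R k E] [IsScalarTower R K E]
  [FiniteDimensional k K] [FiniteDimensional k E] [IsGalois k E]

/-- The action of `Gal(E/K)` on `E` commutes with that of `R`, which gives its action on the
integral closure of `R`. -/
theorem smulCommClass_galois (R K E : Type*) [CommRing R] [Field K] [Field E] [Algebra K E]
    [Algebra R K] [Algebra R E] [IsScalarTower R K E] : SMulCommClass Gal(E/K) R E :=
  ⟨fun g r x => by rw [← algebraMap_smul K r x, ← algebraMap_smul K r (g • x), smul_comm]⟩

attribute [local instance] smulCommClass_galois

omit [IsDedekindDomain R] [IsFractionRing R k] [FiniteDimensional k E] [IsGalois k E] in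
theorem inertiaGroup_eq (𝔓 : Ideal (integralClosure R E)) :
    inertiaGroup k 𝔓 = 𝔓.inertia Gal(E/k) := rfl

/-- `Gal(E/k)` acts on the integral closure as on a Galois extension of rings. -/
theorem isGaloisGroup_integralClosure : IsGaloisGroup Gal(E/k) R (integralClosure R E) := by
  have := integralClosure.isFractionRing_of_finite_extension (A := R) k E
  exact IsGaloisGroup.of_isFractionRing Gal(E/k) R (integralClosure R E) k E

omit [FiniteDimensional k E] [IsGalois k E] in
theorem isTorsionFree_integralClosure (k : Type*) [Field k] [Algebra R k] [IsFractionRing R k]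
    [Algebra k E] [IsScalarTower R k E] : Module.IsTorsionFree R (integralClosure R E) := by
  rw [Module.isTorsionFree_iff_algebraMap_injective]
  intro x y hxy
  apply IsFractionRing.injective R k
  apply (algebraMap k E).injective
  rw [← IsScalarTower.algebraMap_apply, ← IsScalarTower.algebraMap_apply]
  exact congrArg Subtype.val hxy

theorem card_inertiaGroup (𝔓 : Ideal (integralClosure R E)) [𝔓.IsPrime]
    (h : 𝔓.under R ≠ ⊥) [Finite (R ⧸ 𝔓.under R)] :
    Nat.card (inertiaGroup k 𝔓) = 𝔓.ramificationIdx R := by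
  have := isGaloisGroup_integralClosure (R := R) (k := k) (E := E)
  have := IsIntegralClosure.finite R k E (integralClosure R E)
  have := isTorsionFree_integralClosure (R := R) (E := E) k
  rw [inertiaGroup_eq]
  exact card_inertia_eq_ramificationIdx Gal(E/k) R 𝔓 h

/-- If `a ∈ 𝔭 ^ m`, then the ramification index of a prime `𝔭` over `(a)` is at least `m`. -/
theorem le_ramificationIdx_of_mem_pow {A B : Type*} [CommRing A] [CommRing B] [IsDedekindDomain B]
    [Algebra A B] (𝔭 : Ideal B) [𝔭.IsPrime] {a : A} (ha : 𝔭.under A = Ideal.span {a})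
    (ha0 : algebraMap A B a ≠ 0) {m : ℕ} (hm : algebraMap A B a ∈ 𝔭 ^ m) :
    m ≤ 𝔭.ramificationIdx A := by
  have hmap : (Ideal.span {a}).map (algebraMap A B) = Ideal.span {algebraMap A B a} := by
    rw [Ideal.map_span, Set.image_singleton]
  have hlo : 𝔭.LiesOver (Ideal.span {a}) := ⟨ha.symm⟩
  have h0 : (Ideal.span {a}).map (algebraMap A B) ≠ ⊥ := by
    rwa [hmap, Ne, Ideal.span_singleton_eq_bot]
  rw [Ideal.IsDedekindDomain.ramificationIdx_eq_multiplicity (Ideal.span {a}) 𝔭 h0, hmap]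
  have hmem : algebraMap A B a ∈ 𝔭 :=
    Ideal.mem_comap.1 (show a ∈ 𝔭.under A from ha ▸ Ideal.mem_span_singleton_self a)
  have hu : ¬ IsUnit 𝔭 := fun hu => Ideal.IsPrime.ne_top ‹_› (Ideal.isUnit_iff.1 hu)
  refine (FiniteMultiplicity.of_not_isUnit hu (hmap ▸ h0)).le_multiplicity_of_pow_dvd ?_
  rwa [Ideal.dvd_span_singleton]

include k in
/-- For a tower `E/K/k`, the ramification index of `E/K` is the order of the inertia group in
`Gal(E/K)`, and ramification indices are multiplicative. -/
theorem card_inertia_tower [IsGalois k K] (𝔓 : Ideal (integralClosure R E)) [𝔓.IsPrime]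
    (h : 𝔓.under R ≠ ⊥) [Finite (R ⧸ 𝔓.under R)] :
    Nat.card (𝔓.inertia Gal(E/K)) = ramIndex K 𝔓 ∧
    𝔓.ramificationIdx R =
      (𝔓.comap (IsScalarTower.toAlgHom R K E).mapIntegralClosure).ramificationIdx R *
        ramIndex K 𝔓 := by
  let φ : integralClosure R K →ₐ[R] integralClosure R E :=
    (IsScalarTower.toAlgHom R K E).mapIntegralClosure
  let _ : Algebra (integralClosure R K) (integralClosure R E) := φ.toRingHom.toAlgebra
  have : IsScalarTower R (integralClosure R K) (integralClosure R E) :=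
    IsScalarTower.of_algebraMap_eq fun x => (φ.commutes x).symm
  have : IsScalarTower (integralClosure R K) (integralClosure R E) E :=
    IsScalarTower.of_algebraMap_eq fun x => rfl
  have : IsScalarTower (integralClosure R K) K E := inferInstance
  have := IsIntegralClosure.finite R k K (integralClosure R K)
  have := IsIntegralClosure.finite R k E (integralClosure R E)
  have : Module.Finite (integralClosure R K) (integralClosure R E) :=
    Module.Finite.of_restrictScalars_finite R _ _
  have := isTorsionFree_integralClosure (R := R) (E := E) k
  have := isTorsionFree_integralClosure (R := R) (E := K) k
  have := integralClosure.isDedekindDomain R k K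
  have := integralClosure.isDedekindDomain R k E
  have := integralClosure.isFractionRing_of_finite_extension (A := R) k E
  have := integralClosure.isFractionRing_of_finite_extension (A := R) k K
  have : FiniteDimensional K E := FiniteDimensional.right k K E
  have : IsGalois K E := IsGalois.tower_top_of_isGalois k K E
  have : FaithfulSMul (integralClosure R K) (integralClosure R E) := by
    rw [faithfulSMul_iff_algebraMap_injective]
    intro x y hxy
    exact Subtype.ext ((algebraMap K E).injective (congrArg Subtype.val hxy))
  have : IsGaloisGroup Gal(E/K) (integralClosure R K) (integralClosure R E) :=
    IsGaloisGroup.of_isFractionRing Gal(E/K) (integralClosure R K) (integralClosure R E) K E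
  have hunder : (𝔓.under (integralClosure R K)).under R = 𝔓.under R := Ideal.under_under _
  have hbot : 𝔓.under (integralClosure R K) ≠ ⊥ := by
    intro h0
    rw [h0] at hunder
    apply h
    rw [← hunder, Ideal.under_def, Ideal.comap_bot_of_injective]
    exact FaithfulSMul.algebraMap_injective R (integralClosure R K)
  have hfin : Finite (integralClosure R K ⧸ 𝔓.under (integralClosure R K)) := by
    have : Finite (R ⧸ (𝔓.under (integralClosure R K)).under R) := by rwa [hunder]
    exact Module.finite_of_finite (R ⧸ (𝔓.under (integralClosure R K)).under R)
  constructor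
  · exact card_inertia_eq_ramificationIdx Gal(E/K) (integralClosure R K) 𝔓 hbot
  · exact Ideal.ramificationIdx_tower (R := R) (𝔓.under (integralClosure R K)) 𝔓

end Inertia

end

/-! ### Groups with a tame character -/

section

section GroupTheory

theorem eq_one_of_pow_eq_one_of_coprime {G : Type*} [Group G] {x : G} {m n : ℕ}
    (h : m.Coprime n) (hm : x ^ m = 1) (hn : x ^ n = 1) : x = 1 := by
  rw [← orderOf_eq_one_iff]
  exact Nat.eq_one_of_dvd_coprimes h (orderOf_dvd_of_pow_eq_one hm) (orderOf_dvd_of_pow_eq_one hn)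

/-- Every element of finite order is the product of two powers of it, one of `p`-power order and
one of order prime to `p`. -/
theorem exists_pow_mul_pow_eq {G : Type*} [Group G] {p : ℕ} (hp : p.Prime) {g : G}
    (hg : 0 < orderOf g) :
    ∃ i j t m : ℕ, p.Coprime m ∧ g = g ^ i * g ^ j ∧ (g ^ i) ^ p ^ t = 1 ∧ (g ^ j) ^ m = 1 := by
  obtain ⟨t, m, hm, ho⟩ := Nat.exists_eq_pow_mul_and_not_dvd hg.ne' p hp.ne_one
  have hpm : p.Coprime m := (Nat.Prime.coprime_iff_not_dvd hp).2 hm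
  have hcop : (p ^ t).Coprime m := hpm.pow_left t
  obtain ⟨i, hi1, hi2⟩ := Nat.chineseRemainder hcop 1 0
  obtain ⟨j, hj1, hj2⟩ := Nat.chineseRemainder hcop 0 1
  refine ⟨i, j, t, m, hpm, ?_, ?_, ?_⟩
  · rw [← pow_add]
    nth_rewrite 1 [← pow_one g]
    rw [pow_eq_pow_iff_modEq, ho, ← Nat.modEq_and_modEq_iff_modEq_mul hcop]
    exact ⟨(hi1.add hj1).symm, (hi2.add hj2).symm⟩
  · rw [← pow_mul, ← orderOf_dvd_iff_pow_eq_one, ho, mul_comm i]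
    exact mul_dvd_mul_left _ ((Nat.modEq_zero_iff_dvd).1 hi2)
  · rw [← pow_mul, ← orderOf_dvd_iff_pow_eq_one, ho]
    exact mul_dvd_mul_right ((Nat.modEq_zero_iff_dvd).1 hj1) _

/-- A generator of a quotient of a finite cyclic group lifts to a generator. -/
theorem exists_generator_lift {H U : Type*} [Group H] [Finite H] [IsCyclic H] [Group U]
    (f : H →* U) {s : U} (hs : f.range = Subgroup.zpowers s) :
    ∃ τ : H, f τ = s ∧ ∀ h : H, h ∈ Subgroup.zpowers τ := by
  obtain ⟨g, hg⟩ := IsCyclic.exists_generator (α := H)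
  have hg' : ∀ h, ∃ n : ℕ, g ^ n = h := fun h => mem_powers_iff_mem_zpowers.2 (hg h)
  obtain ⟨h, hh⟩ : s ∈ f.range := hs ▸ Subgroup.mem_zpowers s
  obtain ⟨j, rfl⟩ := hg' h
  have h1 : Subgroup.zpowers (f g) = Subgroup.zpowers s := by
    rw [← hs]
    refine le_antisymm (by rw [Subgroup.zpowers_le]; exact ⟨g, rfl⟩) ?_
    rintro _ ⟨h, rfl⟩
    obtain ⟨n, rfl⟩ := hg' h
    rw [map_pow]
    exact Subgroup.npow_mem_zpowers _ _
  have hfin : IsOfFinOrder (f g) := f.isOfFinOrder (isOfFinOrder_of_finite g)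
  have hord : orderOf (f g) = orderOf s := by
    rw [← Nat.card_zpowers, h1, Nat.card_zpowers]
  have hcop : j.Coprime (orderOf (f g)) := by
    have hpos := hfin.orderOf_pos
    rw [map_pow] at hh
    rw [← hh, hfin.orderOf_pow] at hord
    have h2 := Nat.div_mul_cancel (Nat.gcd_dvd_left (orderOf (f g)) j)
    rw [← hord] at h2
    exact Nat.coprime_comm.1 ((Nat.mul_eq_left hpos.ne').1 h2)
  have hdvd : orderOf (f g) ∣ orderOf g := orderOf_map_dvd f g
  have : NeZero (orderOf g) := ⟨(orderOf_pos g).ne'⟩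
  obtain ⟨w, hw⟩ := ZMod.unitsMap_surjective hdvd (ZMod.unitOfCoprime j hcop)
  have hwj : w.1.val ≡ j [MOD orderOf (f g)] := by
    have := congrArg Units.val hw
    rw [ZMod.unitsMap_val, ZMod.coe_unitOfCoprime] at this
    rw [← ZMod.natCast_eq_natCast_iff, ← this, ← ZMod.cast_eq_val]
  refine ⟨g ^ w.1.val, ?_, fun h => ?_⟩
  · rw [map_pow, ← hh, map_pow f g j, pow_eq_pow_iff_modEq]
    exact hwj
  · have h2 : (w.1.val).Coprime (orderOf g) := ZMod.val_coe_unit_coprime w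
    have h3 : g ∈ Subgroup.zpowers (g ^ w.1.val) := by
      obtain ⟨i, hi⟩ := exists_pow_eq_self_of_coprime h2
      have h3 := Subgroup.npow_mem_zpowers (g ^ w.1.val) i
      rwa [hi] at h3
    exact (Subgroup.zpowers_le (g := g)).2 h3 (hg h)

variable {G U C : Type*} [Group G] [Finite G] [CommGroup U] [CommGroup C] [Finite C] [IsCyclic C]
  {I G₁ H : Subgroup G} {p n m : ℕ}

/-- The data that determine the structure of an inertia group `I` with wild part `G₁`. The character
`θ` has kernel `G₁` and values in a cyclic group of order prime to `p`, and `G₁` has no elements of order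
prime to `p`. The homomorphism `χ` maps `I` onto an abelian group `U` that is generated by a group `U₁` of
`p`-power torsion and an element `s` of order prime to `p`; its kernel is killed by an integer `n` prime to
`p`. Finally, `H` is the preimage of the group generated by `s`. -/
structure TameData (I G₁ H : Subgroup G) (p n m : ℕ) (θ : I →* C) (χ : I →* U) (U₁ : Subgroup U)
    (s : U) : Prop where
  prime : p.Prime
  le : G₁ ≤ I
  card : p.Coprime (Nat.card C)
  tame : ∀ g, θ g = 1 ↔ g.1 ∈ G₁
  wild : ∀ g ∈ G₁, ∀ m : ℕ, p.Coprime m → g ^ m = 1 → g = 1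
  surj : Function.Surjective χ
  pow : ∀ g, χ g = 1 → g.1 ^ n = 1
  coprime : p.Coprime n
  powU : ∀ u ∈ U₁, ∃ t : ℕ, u ^ p ^ t = 1
  coprime' : p.Coprime m
  pow_s : s ^ m = 1
  exists_s : ∀ u, ∃ i : ℕ, u * (s ^ i)⁻¹ ∈ U₁
  mem : ∀ g, g ∈ H ↔ ∃ h : g ∈ I, χ ⟨g, h⟩ ∈ Subgroup.zpowers s

namespace TameData

variable {θ : I →* C} {χ : I →* U} {U₁ : Subgroup U} {s : U}
  (D : TameData I G₁ H p n m θ χ U₁ s)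
include D

theorem le' : H ≤ I := fun g hg => ((D.mem g).1 hg).1

/-- The wild part is a `p`-group. -/
theorem exists_pow {g : G} (hg : g ∈ G₁) : ∃ t : ℕ, g ^ p ^ t = 1 := by
  obtain ⟨i, j, t, m, hm, h1, h2, h3⟩ := exists_pow_mul_pow_eq D.prime (orderOf_pos g)
  have := D.wild _ (pow_mem hg j) m hm h3
  rw [this, mul_one] at h1
  exact ⟨t, by rw [h1, h2]⟩

/-- The wild part contains all elements of `p`-power order. -/
theorem mem_of_pow {g : G} (hg : g ∈ I) {t : ℕ} (h : g ^ p ^ t = 1) : g ∈ G₁ := by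
  rw [← D.tame ⟨g, hg⟩]
  refine eq_one_of_pow_eq_one_of_coprime (D.card.pow_left t) ?_ pow_card_eq_one'
  rw [← map_pow, ← map_one θ]
  exact congrArg θ (Subtype.ext h)

theorem pow_zpowers {u : U} (hu : u ∈ Subgroup.zpowers s) : u ^ m = 1 := by
  obtain ⟨i, rfl⟩ := hu
  dsimp only
  rw [← zpow_natCast, ← zpow_mul, mul_comm, zpow_mul, zpow_natCast, D.pow_s, one_zpow]

/-- The group `U₁` contains all elements of `p`-power order. -/
theorem mem_U₁_of_pow {u : U} {t : ℕ} (h : u ^ p ^ t = 1) : u ∈ U₁ := by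
  obtain ⟨i, hi⟩ := D.exists_s u
  obtain ⟨t', ht'⟩ := D.powU _ hi
  have h1 : s ^ i = 1 := by
    refine eq_one_of_pow_eq_one_of_coprime (D.coprime'.pow_left (t + t')) ?_
      (D.pow_zpowers (Subgroup.npow_mem_zpowers s i))
    have h2 : (s ^ i)⁻¹ ^ p ^ (t + t') = 1 := by
      have h3 : (s ^ i)⁻¹ = u⁻¹ * (u * (s ^ i)⁻¹) := by group
      rw [h3, mul_pow, pow_add, pow_mul, inv_pow, h, inv_one, one_pow, one_mul, mul_comm (p ^ t),
        pow_mul, ht', one_pow]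
    rwa [inv_pow, inv_eq_one] at h2
  rwa [h1, inv_one, mul_one] at hi

/-- Every element of `I` is a product of an element of the wild part and an element of order prime
to `p`. -/
theorem exists_eq_mul (g : I) : ∃ x y : I, x.1 ∈ G₁ ∧ g = x * y ∧
    ∃ m : ℕ, p.Coprime m ∧ χ y ^ m = 1 := by
  obtain ⟨i, j, t, m, hm, h1, h2, h3⟩ := exists_pow_mul_pow_eq D.prime (orderOf_pos g)
  refine ⟨g ^ i, g ^ j, D.mem_of_pow (t := t) (g ^ i).2 ?_, h1, m, hm, ?_⟩
  · exact congrArg Subtype.val h2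
  · rw [← map_pow, h3, map_one]

/-- The wild part meets the kernel of `χ` trivially. -/
theorem eq_one_of_mem_G₁ {g : I} (hg : g.1 ∈ G₁) (h : χ g = 1) : g.1 = 1 :=
  D.wild _ hg n D.coprime (D.pow g h)

theorem map_mem {g : I} (hg : g.1 ∈ G₁) : χ g ∈ U₁ := by
  obtain ⟨t, ht⟩ := D.exists_pow hg
  refine D.mem_U₁_of_pow (t := t) ?_
  rw [← map_pow, ← map_one χ]
  exact congrArg χ (Subtype.ext ht)

/-- The homomorphism `χ` maps the wild part isomorphically onto `U₁`. -/
theorem nonempty_mulEquiv : Nonempty (G₁ ≃* U₁) := by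
  let f : G₁ →* U₁ := (χ.comp (Subgroup.inclusion D.le)).codRestrict U₁
    fun g => D.map_mem (g := Subgroup.inclusion D.le g) g.2
  refine ⟨MulEquiv.ofBijective f ⟨?_, ?_⟩⟩
  · rw [injective_iff_map_eq_one]
    intro g hg
    exact Subtype.ext (D.eq_one_of_mem_G₁ (g := Subgroup.inclusion D.le g) g.2
      (congrArg Subtype.val hg))
  · rintro ⟨u, hu⟩
    obtain ⟨g, rfl⟩ := D.surj u
    obtain ⟨x, y, hx, rfl, m', hm', hy⟩ := D.exists_eq_mul g
    have h1 : χ y = 1 := by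
      have h2 : χ y ∈ U₁ := by
        have := U₁.mul_mem (U₁.inv_mem (D.map_mem hx)) hu
        rwa [map_mul, inv_mul_cancel_left] at this
      obtain ⟨t, ht⟩ := D.powU _ h2
      exact eq_one_of_pow_eq_one_of_coprime (hm'.pow_left t) ht hy
    have h3 : χ x = χ (x * y) := by rw [map_mul, h1, mul_one]
    exact ⟨⟨x.1, hx⟩, Subtype.ext h3⟩

theorem disjoint : Disjoint G₁ H := by
  rw [Subgroup.disjoint_def]
  intro g hg hH
  obtain ⟨hI, hs⟩ := (D.mem g).1 hH
  refine D.eq_one_of_mem_G₁ (g := ⟨g, hI⟩) hg ?_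
  obtain ⟨t, ht⟩ := D.powU _ (D.map_mem (g := ⟨g, hI⟩) hg)
  exact eq_one_of_pow_eq_one_of_coprime (D.coprime'.pow_left t) ht (D.pow_zpowers hs)

theorem sup_eq : G₁ ⊔ H = I := by
  refine le_antisymm (sup_le D.le D.le') fun g hg => ?_
  obtain ⟨x, y, hx, hxy, m', hm', hy⟩ := D.exists_eq_mul ⟨g, hg⟩
  have hg' : g = x.1 * y.1 := congrArg Subtype.val hxy
  rw [hg']
  refine Subgroup.mul_mem_sup hx ((D.mem _).2 ⟨y.2, ?_⟩)
  obtain ⟨i, hi⟩ := D.exists_s (χ y)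
  obtain ⟨t, ht⟩ := D.powU _ hi
  have h1 : χ y * (s ^ i)⁻¹ = 1 := by
    refine eq_one_of_pow_eq_one_of_coprime ((hm'.mul_right D.coprime').pow_left t) ht ?_
    rw [mul_pow, pow_mul, hy, one_pow, one_mul, inv_pow, mul_comm m', pow_mul,
      D.pow_zpowers (Subgroup.npow_mem_zpowers s i), one_pow, inv_one]
  rw [mul_inv_eq_one] at h1
  change χ y ∈ _
  rw [h1]
  exact Subgroup.npow_mem_zpowers s i

/-- A commutator of the wild part and the tame part lies in `G₁` and, as `U` is abelian, in the
kernel of `χ`. -/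
theorem commute {x y : G} (hx : x ∈ G₁) (hy : y ∈ H) : x * y = y * x := by
  have hyI := D.le' hy
  have hxI := D.le hx
  have h1 : x * y * x⁻¹ * y⁻¹ ∈ G₁ := by
    have h2 : y * x⁻¹ * y⁻¹ ∈ G₁ := by
      have h3 : θ (⟨y, hyI⟩ * ⟨x, hxI⟩⁻¹ * ⟨y, hyI⟩⁻¹) = 1 := by
        rw [map_mul, map_mul, map_inv, map_inv, (D.tame ⟨x, hxI⟩).2 hx]
        simp
      exact (D.tame _).1 h3
    have := mul_mem hx h2
    rwa [← mul_assoc, ← mul_assoc] at this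
  have h4 : χ (⟨x, hxI⟩ * ⟨y, hyI⟩ * ⟨x, hxI⟩⁻¹ * ⟨y, hyI⟩⁻¹) = 1 := by
    simp only [map_mul, map_inv]
    rw [mul_inv_cancel_comm, mul_inv_cancel]
  have h5 := D.eq_one_of_mem_G₁ (g := ⟨x, hxI⟩ * ⟨y, hyI⟩ * ⟨x, hxI⟩⁻¹ * ⟨y, hyI⟩⁻¹) h1 h4
  have h6 : x * y * x⁻¹ * y⁻¹ = 1 := h5
  rwa [mul_inv_eq_one, mul_inv_eq_iff_eq_mul] at h6

/-- The tame part is cyclic, as `θ` is injective on it, and it has a generator that maps to `s`. -/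
theorem exists_generator : ∃ τ : G, ∃ h : τ ∈ I, χ ⟨τ, h⟩ = s ∧ H = Subgroup.zpowers τ ∧
    orderOf τ = Nat.card χ.ker * orderOf s := by
  let ι : H →* I := Subgroup.inclusion D.le'
  have hcyc : IsCyclic H := by
    refine isCyclic_of_injective (θ.comp ι) ?_
    rw [injective_iff_map_eq_one]
    intro g hg
    exact Subtype.ext (Subgroup.disjoint_def.1 D.disjoint ((D.tame (ι g)).1 hg) g.2)
  have hrange : (χ.comp ι).range = Subgroup.zpowers s := by
    refine le_antisymm ?_ ?_
    · rintro _ ⟨g, rfl⟩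
      exact ((D.mem g.1).1 g.2).2
    · rw [Subgroup.zpowers_le]
      obtain ⟨g, hg⟩ := D.surj s
      exact ⟨⟨g.1, (D.mem _).2 ⟨g.2, hg ▸ Subgroup.mem_zpowers _⟩⟩, hg⟩
  obtain ⟨τ, hτ, hgen⟩ := exists_generator_lift (χ.comp ι) hrange
  have hH : H = Subgroup.zpowers τ.1 := by
    refine le_antisymm (fun h hh => ?_) (Subgroup.zpowers_le.2 τ.2)
    obtain ⟨i, hi⟩ := hgen ⟨h, hh⟩
    exact ⟨i, congrArg Subtype.val hi⟩
  refine ⟨τ.1, D.le' τ.2, hτ, hH, ?_⟩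
  have h1 := (χ.comp ι).ker.card_mul_index
  rw [Subgroup.index_ker, hrange, Nat.card_zpowers] at h1
  have h2 : Nat.card H = orderOf τ.1 := by
    conv_lhs => rw [hH]
    exact Nat.card_zpowers _
  rw [← h2, ← h1]
  congr 1
  refine Nat.card_congr ⟨fun g => ⟨ι g.1, g.2⟩,
    fun g => ⟨⟨g.1.1, (D.mem _).2 ⟨g.1.2, ?_⟩⟩, g.2⟩, fun _ => rfl, fun _ => rfl⟩
  have : χ ⟨g.1.1, g.1.2⟩ = 1 := g.2
  rw [this]
  exact one_mem _

end TameData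

end GroupTheory

end

/-! ### Units modulo a prime power and the ramification of torsion points -/

section

open scoped Classical

section Units

variable {F : Type*} [Field F]

theorem mem_oneUnits_iff {L : F[X]} {r : ℕ} (hr : r ≠ 0) {u : (F[X] ⧸ Ideal.span {L ^ r})ˣ}
    {c : F[X]} (hc : (u : F[X] ⧸ Ideal.span {L ^ r}) = Ideal.Quotient.mk _ c) :
    u ∈ oneUnits L r ↔ L ∣ c - 1 := by
  rw [oneUnits, MonoidHom.mem_ker, Units.ext_iff]
  change Ideal.Quotient.mk _ (u : F[X] ⧸ Ideal.span {L ^ r}) = 1 ↔ _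
  have h1 : ∀ x : F[X] ⧸ Ideal.span {L ^ r},
      Ideal.Quotient.mk (Ideal.span {Ideal.Quotient.mk (Ideal.span {L ^ r}) L}) x = 1 ↔
        Ideal.Quotient.mk (Ideal.span {L ^ r}) L ∣ x - 1 := fun x => by
    rw [← Ideal.mem_span_singleton, ← Ideal.Quotient.eq_zero_iff_mem, map_sub, map_one,
      sub_eq_zero]
  rw [hc, h1, ← map_one (Ideal.Quotient.mk _), ← map_sub]
  constructor
  · rintro ⟨d, hd⟩
    obtain ⟨d, rfl⟩ := Ideal.Quotient.mk_surjective d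
    rw [← map_mul, Ideal.Quotient.eq, Ideal.mem_span_singleton] at hd
    exact (dvd_sub_left (dvd_mul_right L d)).1 ((dvd_pow_self L hr).trans hd)
  · exact fun h => map_dvd _ h

theorem not_dvd_of_unit {L : F[X]} (hL : Irreducible L) {r : ℕ} (hr : r ≠ 0)
    (u : (F[X] ⧸ Ideal.span {L ^ r})ˣ) {c : F[X]}
    (hc : (u : F[X] ⧸ Ideal.span {L ^ r}) = Ideal.Quotient.mk _ c) : ¬ L ∣ c := by
  intro hd
  have h2 : (u : F[X] ⧸ Ideal.span {L ^ r}) ^ r = 0 := by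
    rw [hc, ← map_pow, Ideal.Quotient.eq_zero_iff_dvd]
    exact pow_dvd_pow_of_dvd hd r
  have h3 : (1 : F[X] ⧸ Ideal.span {L ^ r}) = 0 :=
    (u.isUnit.pow r).mul_right_cancel (by rw [h2, mul_zero, mul_zero])
  rw [← map_one (Ideal.Quotient.mk _), Ideal.Quotient.eq_zero_iff_dvd] at h3
  exact hL.not_isUnit (isUnit_of_dvd_one ((dvd_pow_self L hr).trans h3))

variable [Fintype F]

/-- The units congruent to `1` modulo `L` have `p`-power order modulo `L ^ r`. -/
theorem exists_dvd_pow_sub_one {L c : F[X]} (h : L ∣ c - 1) (r : ℕ) :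
    ∃ t : ℕ, L ^ r ∣ c ^ ringChar F ^ t - 1 := by
  have : Fact (ringChar F).Prime := ⟨CharP.char_is_prime F _⟩
  refine ⟨r, ?_⟩
  have h1 : c ^ ringChar F ^ r - 1 = (c - 1) ^ ringChar F ^ r := by
    rw [sub_pow_char_pow, one_pow]
  rw [h1]
  exact (pow_dvd_pow_of_dvd h r).trans
    (pow_dvd_pow _ (Nat.lt_pow_self this.out.one_lt).le)

theorem coprime_ringChar_card_pow_sub_one {d : ℕ} (hd : d ≠ 0) :
    (ringChar F).Coprime (Fintype.card F ^ d - 1) := by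
  have : Fact (ringChar F).Prime := ⟨CharP.char_is_prime F _⟩
  obtain ⟨n, hn, hc⟩ := FiniteField.card F (ringChar F)
  have h1 : ringChar F ∣ Fintype.card F ^ d := by
    rw [hc]
    exact dvd_pow (dvd_pow_self _ n.ne_zero) hd
  have h2 : 1 ≤ Fintype.card F ^ d := Nat.one_le_pow _ _ Fintype.card_pos
  refine ((Nat.coprime_self_sub_right h2).2 (Nat.coprime_one_right _)).coprime_dvd_left h1

/-- The units modulo `L ^ r` are represented by the polynomials prime to `L` of degree less than
`deg (L ^ r)`. -/
theorem card_units_quotient_le {L : F[X]} (hL : Irreducible L) (hm : L.Monic) {r : ℕ}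
    (hr : r ≠ 0) :
    Finite (F[X] ⧸ Ideal.span {L ^ r})ˣ ∧ Nat.card (F[X] ⧸ Ideal.span {L ^ r})ˣ ≤
      ((polysLT F (L ^ r).natDegree).filter (¬ L ∣ ·)).card := by
  set S := (polysLT F (L ^ r).natDegree).filter (¬ L ∣ ·)
  have hex : ∀ u : (F[X] ⧸ Ideal.span {L ^ r})ˣ,
      ∃ c : S, (u : F[X] ⧸ Ideal.span {L ^ r}) = Ideal.Quotient.mk _ c.1 := by
    intro u
    obtain ⟨c, hc⟩ := Ideal.Quotient.mk_surjective (u : F[X] ⧸ Ideal.span {L ^ r})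
    have h1 : Ideal.Quotient.mk (Ideal.span {L ^ r}) (c %ₘ L ^ r) =
        (u : F[X] ⧸ Ideal.span {L ^ r}) := by
      rw [← hc, Ideal.Quotient.eq, Ideal.mem_span_singleton, ← neg_sub,
        Polynomial.modByMonic_eq_sub_mul_div c (L ^ r), sub_sub_cancel, dvd_neg]
      exact dvd_mul_right _ _
    refine ⟨⟨c %ₘ L ^ r, ?_⟩, h1.symm⟩
    rw [Finset.mem_filter, mem_polysLT]
    refine ⟨?_, not_dvd_of_unit hL hr u h1.symm⟩
    rw [← Polynomial.degree_eq_natDegree (hm.pow r).ne_zero]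
    exact Polynomial.degree_modByMonic_lt c (hm.pow r)
  choose f hf using hex
  have hinj : Function.Injective f := fun u v huv => Units.ext (by rw [hf, hf, huv])
  refine ⟨Finite.of_injective f hinj, ?_⟩
  rw [← Nat.card_eq_finsetCard]
  exact Nat.card_le_card_of_injective f hinj

/-- The torsion points of exact order `L ^ r` have product `L`. -/
theorem prod_tors_primitive (hodd : ringChar F ≠ 2) {ϖ : Omega F} (hϖ : IsCarlitzPeriod ϖ)
    {L : F[X]} (hm : L.Monic) (r : ℕ) :
    ∏ b ∈ (polysLT F (L ^ (r + 1)).natDegree).filter (¬ L ∣ ·), tors ϖ (L ^ (r + 1)) b =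
      algebraMap F[X] (Omega F) L := by
  have h1 := prod_tors_ne_zero hodd hϖ (hm.pow (r + 1))
  have h2 := prod_tors_ne_zero hodd hϖ (hm.pow r)
  rw [← Finset.prod_filter_mul_prod_filter_not _ (L ∣ ·)] at h1
  have h3 : ∏ b ∈ ((polysLT F (L ^ (r + 1)).natDegree).erase 0).filter (L ∣ ·),
      tors ϖ (L ^ (r + 1)) b =
      ∏ b ∈ (polysLT F (L ^ r).natDegree).erase 0, tors ϖ (L ^ r) b := by
    symm
    refine Finset.prod_bij (fun b _ => b * L) ?_ ?_ ?_ ?_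
    · intro b hb
      rw [Finset.mem_erase, mem_polysLT] at hb
      rw [Finset.mem_filter, Finset.mem_erase, mem_polysLT]
      refine ⟨⟨mul_ne_zero hb.1 hm.ne_zero, ?_⟩, dvd_mul_left _ _⟩
      rw [hm.natDegree_pow, Polynomial.degree_eq_natDegree hb.1, Nat.cast_lt] at hb
      rw [hm.natDegree_pow, Polynomial.degree_eq_natDegree (mul_ne_zero hb.1 hm.ne_zero),
        Nat.cast_lt, Polynomial.natDegree_mul hb.1 hm.ne_zero]
      nlinarith [hb.2]
    · intro a _ b _ h
      exact mul_right_cancel₀ hm.ne_zero h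
    · intro b hb
      rw [Finset.mem_filter, Finset.mem_erase, mem_polysLT] at hb
      obtain ⟨⟨hb0, hb⟩, c, rfl⟩ := hb
      have hc : c ≠ 0 := right_ne_zero_of_mul hb0
      refine ⟨c, ?_, mul_comm _ _⟩
      rw [Finset.mem_erase, mem_polysLT]
      refine ⟨hc, ?_⟩
      rw [hm.natDegree_pow, Polynomial.degree_eq_natDegree hb0,
        Nat.cast_lt, Polynomial.natDegree_mul hm.ne_zero hc] at hb
      rw [hm.natDegree_pow, Polynomial.degree_eq_natDegree hc, Nat.cast_lt]
      nlinarith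
    · intro b _
      rw [pow_succ, tors_mul_mul_right ϖ hm.ne_zero]
  have h4 : ((polysLT F (L ^ (r + 1)).natDegree).erase 0).filter (¬ L ∣ ·) =
      (polysLT F (L ^ (r + 1)).natDegree).filter (¬ L ∣ ·) := by
    ext b
    simp only [Finset.mem_filter, Finset.mem_erase]
    refine ⟨fun h => ⟨h.1.2, h.2⟩, fun h => ⟨⟨?_, h.1⟩, h.2⟩⟩
    rintro rfl
    exact h.2 (dvd_zero L)
  rw [h3, h4, h2, pow_succ, map_mul] at h1
  refine mul_left_cancel₀ ?_ h1
  rw [← h2]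
  exact Finset.prod_ne_zero_iff.2 fun b hb h => by
    rw [tors_eq_zero_iff hϖ (hm.pow r).ne_zero] at h
    rw [Finset.mem_erase, mem_polysLT, ← Polynomial.degree_eq_natDegree (hm.pow r).ne_zero] at hb
    exact hb.1 (Polynomial.eq_zero_of_dvd_of_degree_lt h hb.2)

end Units

section Ramification

variable {F : Type*} [Field F] [Fintype F] {ϖ : Omega F} (hϖ : IsCarlitzPeriod ϖ) {M : F[X]}
  (hM : M.Monic)

/-- The torsion points of the Carlitz module, as integral elements of the cyclotomic field. -/
def torsO (a : F[X]) : integralClosure F[X] (cyclotomicField ϖ M) :=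
  ⟨torsK hϖ M a, isIntegral_torsK hϖ hM a⟩

/-- The Carlitz polynomials have no constant term, so that multiples of a torsion point are
divisible by it. -/
theorem torsO_dvd (a b : F[X]) : torsO hϖ hM b ∣ torsO hϖ hM (a * b) := by
  have h : Polynomial.aeval (torsO hϖ hM b) (carlitzPoly a) = torsO hϖ hM (a * b) := by
    refine Subtype.ext ?_
    change _ = torsK hϖ M (a * b)
    rw [← aeval_torsK hϖ]
    exact (Polynomial.aeval_algebraMap_apply (cyclotomicField ϖ M) (torsO hϖ hM b)
      (carlitzPoly a)).symm
  obtain ⟨p, hp⟩ := Polynomial.X_dvd_iff.2 (coeff_zero_carlitzPoly a)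
  rw [← h, hp, map_mul, Polynomial.aeval_X]
  exact dvd_mul_right _ _

include hϖ hM in
/-- The ramification index of a prime over `L` is at least the number of residue classes prime
to `L` modulo `L ^ (r + 1)`: `L` is the product of as many torsion points, and each of them divides all
others. -/
theorem card_le_ramificationIdx (hodd : ringChar F ≠ 2) {L N : F[X]} {r : ℕ} (hL : Irreducible L)
    (hm : L.Monic) (hN : M = L ^ (r + 1) * N)
    (𝔭 : Ideal (integralClosure F[X] (cyclotomicField ϖ M))) [𝔭.IsPrime]
    (h𝔭 : 𝔭.under F[X] = Ideal.span {L}) :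
    ((polysLT F (L ^ (r + 1)).natDegree).filter (¬ L ∣ ·)).card ≤ 𝔭.ramificationIdx F[X] := by
  set S := (polysLT F (L ^ (r + 1)).natDegree).filter (¬ L ∣ ·)
  have hN0 : N ≠ 0 := by
    rintro rfl
    exact hM.ne_zero (by rw [hN, mul_zero])
  have hcoe : ∀ b, ((torsO hϖ hM (b * N) : cyclotomicField ϖ M) : Omega F) =
      tors ϖ (L ^ (r + 1)) b := by
    intro b
    change tors ϖ M (b * N) = _
    rw [hN, tors_mul_mul_right ϖ hN0]
  have hprod : ∏ b ∈ S, torsO hϖ hM (b * N) =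
      algebraMap F[X] (integralClosure F[X] (cyclotomicField ϖ M)) L := by
    have hinj : Function.Injective (((cyclotomicField ϖ M).val.restrictScalars F[X]).comp
        (integralClosure F[X] (cyclotomicField ϖ M)).val) :=
      fun x y h => Subtype.ext (Subtype.ext h)
    apply hinj
    rw [map_prod, AlgHom.commutes, ← prod_tors_primitive hodd hϖ hm r]
    exact Finset.prod_congr rfl fun b _ => hcoe b
  have := isGalois_cyclotomicField hϖ hM
  have := finiteDimensional_cyclotomicField hϖ hM
  have := integralClosure.isDedekindDomain F[X] (RatFunc F) (cyclotomicField ϖ M)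
  have hL𝔭 : algebraMap F[X] (integralClosure F[X] (cyclotomicField ϖ M)) L ∈ 𝔭 :=
    Ideal.mem_comap.1 (show L ∈ 𝔭.under F[X] from h𝔭 ▸ Ideal.mem_span_singleton_self L)
  refine le_ramificationIdx_of_mem_pow 𝔭 h𝔭 ?_ ?_
  · have := isTorsionFree_integralClosure (R := F[X]) (E := cyclotomicField ϖ M) (RatFunc F)
    rw [Ne, FaithfulSMul.algebraMap_eq_zero_iff]
    exact hm.ne_zero
  · rw [← hprod] at hL𝔭 ⊢
    obtain ⟨b, hb, hb𝔭⟩ := (Ideal.IsPrime.prod_mem_iff).1 hL𝔭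
    have hall : ∀ c ∈ S, torsO hϖ hM (c * N) ∈ 𝔭 := by
      intro c hc
      have hcop : IsCoprime b (L ^ (r + 1)) :=
        ((hL.coprime_iff_not_dvd).2 (Finset.mem_filter.1 hb).2).symm.pow_right
      obtain ⟨u, v, huv⟩ := hcop
      have h1 : torsO hϖ hM (c * N) = torsO hϖ hM (c * u * (b * N)) := by
        refine Subtype.ext ((torsK_eq_iff hϖ hM.ne_zero _ _).2 ⟨c * v, ?_⟩)
        rw [hN]
        linear_combination (-c * N) * huv
      rw [h1]
      exact 𝔭.mem_of_dvd (torsO_dvd hϖ hM _ _) hb𝔭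
    have h2 : ∏ c ∈ S, torsO hϖ hM (c * N) ∈ ∏ _c ∈ S, 𝔭 := Ideal.prod_mem_prod hall
    rwa [Finset.prod_const] at h2

end Ramification

end

/-! ### The action of inertia on torsion points -/

section

attribute [local instance] smulCommClass_galois

section InertiaCharacter

variable {F : Type*} [Field F] [Fintype F] {ϖ : Omega F} (hϖ : IsCarlitzPeriod ϖ) {M : F[X]}
  (hM : M.Monic)

include hM in
/-- The homomorphism from the Galois group of the cyclotomic field to the units modulo a divisor
`D` of `M`. -/
theorem exists_unitHom {D : F[X]} (hD : D ∣ M) :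
    ∃ χ : Gal(cyclotomicField ϖ M/RatFunc F) →* (F[X] ⧸ Ideal.span {D})ˣ,
      ∀ σ c, σ (torsK hϖ M 1) = torsK hϖ M c →
        (χ σ : F[X] ⧸ Ideal.span {D}) = Ideal.Quotient.mk _ c := by
  choose c hcop hc using exists_galois_torsK hϖ hM
  have hu : ∀ σ, IsUnit (Ideal.Quotient.mk (Ideal.span {D}) (c σ)) := by
    intro σ
    obtain ⟨a, b, h⟩ := (hcop σ).of_isCoprime_of_dvd_right hD
    refine IsUnit.of_mul_eq_one (Ideal.Quotient.mk _ a) ?_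
    rw [← map_mul, ← map_one (Ideal.Quotient.mk _), Ideal.Quotient.eq, Ideal.mem_span_singleton]
    exact ⟨-b, by linear_combination h⟩
  have key : ∀ σ d, σ (torsK hϖ M 1) = torsK hϖ M d →
      Ideal.Quotient.mk (Ideal.span {D}) (c σ) = Ideal.Quotient.mk (Ideal.span {D}) d := by
    intro σ d h
    rw [hc, mul_one, torsK_eq_iff hϖ hM.ne_zero] at h
    rw [Ideal.Quotient.eq, Ideal.mem_span_singleton]
    exact hD.trans h
  refine ⟨MonoidHom.mk' (fun σ => (hu σ).unit) fun σ τ => Units.ext ?_, key⟩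
  rw [Units.val_mul, IsUnit.unit_spec, IsUnit.unit_spec, IsUnit.unit_spec, ← map_mul]
  apply key
  rw [AlgEquiv.mul_apply, hc τ, hc σ, mul_one]

variable (E : IntermediateField (cyclotomicField ϖ M) (Omega F))
  (𝔓 : Ideal (integralClosure F[X] E))

open scoped Classical in
variable {E 𝔓} in
include hM in
/-- The inertia group at `L` fixes the torsion points of order `N` prime to `L`: the difference of
two distinct such points divides `N`, which is not in `𝔓`. -/
theorem dvd_sub_one_of_mem_inertia (hodd : ringChar F ≠ 2) [𝔓.IsPrime] {L D N : F[X]}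
    (hD : D ≠ 0) (hN : N.Monic) (hMN : M = N * D) (hLN : ¬ L ∣ N)
    (h𝔓 : 𝔓.under F[X] = Ideal.span {L})
    {g : Gal(E/RatFunc F)} (hg : g ∈ inertiaGroup (RatFunc F) 𝔓)
    {σ : Gal(cyclotomicField ϖ M/RatFunc F)} (hσ : IsLifting σ g) {c : F[X]}
    (hc : σ (torsK hϖ M 1) = torsK hϖ M c) : N ∣ c - 1 := by
  by_contra hNc
  let x : ∀ b : F[X], integralClosure F[X] E := fun b =>
    ⟨algebraMap (cyclotomicField ϖ M) E (torsK hϖ M b), (isIntegral_torsK hϖ hM b).map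
      (IsScalarTower.toAlgHom F[X] (cyclotomicField ϖ M) E)⟩
  have hcoe : ∀ b, ((x (b * D) : E) : Omega F) = tors ϖ N b := by
    intro b
    change tors ϖ M (b * D) = _
    rw [hMN, tors_mul_mul_right ϖ hD]
  have h1 : x ((c - 1) * D) ∈ 𝔓 := by
    have h2 := AddSubgroup.mem_inertia.1 hg (x D)
    have h3 : x ((c - 1) * D) = galIntegralClosure F[X] (RatFunc F) E g (x D) - x D := ?_
    · rw [h3]
      exact h2
    refine Subtype.ext ?_
    change algebraMap (cyclotomicField ϖ M) E (torsK hϖ M ((c - 1) * D)) =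
      g (algebraMap (cyclotomicField ϖ M) E (torsK hϖ M D)) - algebraMap _ _ (torsK hϖ M D)
    rw [hσ, ← map_sub, galois_torsK_of_one hϖ hc]
    congr 1
    refine Subtype.ext ?_
    change tors ϖ M _ = tors ϖ M _ - tors ϖ M _
    rw [← tors_sub hϖ, sub_mul, one_mul]
  have hmod : (c - 1) %ₘ N ∈ (polysLT F N.natDegree).erase 0 := by
    rw [Finset.mem_erase, mem_polysLT, ← Polynomial.degree_eq_natDegree hN.ne_zero]
    exact ⟨fun h => hNc ((Polynomial.modByMonic_eq_zero_iff_dvd hN).1 h),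
      Polynomial.degree_modByMonic_lt _ hN⟩
  have hx : x ((c - 1) * D) = x ((c - 1) %ₘ N * D) := by
    refine Subtype.ext (congrArg (algebraMap (cyclotomicField ϖ M) E)
      ((torsK_eq_iff hϖ hM.ne_zero _ _).2 ⟨(c - 1) /ₘ N, ?_⟩))
    rw [hMN, Polynomial.modByMonic_eq_sub_mul_div]
    ring
  have hprod : ∏ b ∈ (polysLT F N.natDegree).erase 0, x (b * D) =
      algebraMap F[X] (integralClosure F[X] E) N := by
    have hinj : Function.Injective ((E.val.restrictScalars F[X]).comp
        (integralClosure F[X] E).val) :=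
      fun x y h => Subtype.ext (Subtype.ext h)
    apply hinj
    rw [map_prod, AlgHom.commutes, ← prod_tors_ne_zero hodd hϖ hN]
    exact Finset.prod_congr rfl fun b _ => hcoe b
  have h3 : algebraMap F[X] (integralClosure F[X] E) N ∈ 𝔓 := by
    rw [← hprod]
    exact 𝔓.mem_of_dvd (Finset.dvd_prod_of_mem _ hmod) (hx ▸ h1)
  have h4 : N ∈ 𝔓.under F[X] := Ideal.mem_comap.2 h3
  rw [h𝔓, Ideal.mem_span_singleton] at h4
  exact hLN h4

end InertiaCharacter

section InertiaTower

variable {R k K E : Type*} [CommRing R] [Field k] [Field K] [Field E]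
  [Algebra k K] [Algebra k E] [Algebra K E] [IsScalarTower k K E]
  [Algebra R K] [Algebra R E]
  [Algebra R k] [IsScalarTower R k E] [IsScalarTower R K E]

/-- The inertia group in `Gal(E/K)` consists of the elements of the inertia group in `Gal(E/k)`
that are liftings of the identity. -/
theorem card_inertia_top (𝔓 : Ideal (integralClosure R E)) {χ : Type*} [Group χ]
    (f : inertiaGroup k 𝔓 →* χ) (hf : ∀ g, f g = 1 ↔ IsLifting (1 : Gal(K/k)) g.1) :
    Nat.card f.ker = Nat.card (𝔓.inertia Gal(E/K)) := by
  symm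
  refine Nat.card_congr (Equiv.ofBijective (fun g : 𝔓.inertia Gal(E/K) =>
    (⟨⟨g.1.restrictScalars k, g.2⟩, (hf _).2 fun x => g.1.commutes x⟩ : f.ker)) ⟨?_, ?_⟩)
  · intro g h hgh
    refine Subtype.ext (AlgEquiv.ext fun x => ?_)
    exact congrArg (fun w : f.ker => w.1.1 x) hgh
  · rintro ⟨g, hg⟩
    have h := (hf g).1 hg
    exact ⟨⟨AlgEquiv.ofRingEquiv (f := g.1.toRingEquiv) fun x => h x, g.2⟩, rfl⟩

end InertiaTower

end

/-! ### The inertia group at a prime of the conductor -/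

section

attribute [local instance] smulCommClass_galois

section Groups

/-- A factor `z` of order dividing `o` does not affect the order of a product, if `o` divides the
orders involved. -/
theorem orderOf_mul_eq_left {G : Type*} [Group G] {x z : G} (h : Commute x z) {o : ℕ}
    (hx : o ∣ orderOf x) (hxz : o ∣ orderOf (x * z)) (hz : z ^ o = 1) :
    orderOf (x * z) = orderOf x := by
  have key : ∀ m, o ∣ m → (x * z) ^ m = x ^ m := by
    rintro _ ⟨m, rfl⟩
    rw [h.mul_pow, pow_mul z, hz, one_pow, mul_one]
  refine Nat.dvd_antisymm ?_ ?_
  · rw [orderOf_dvd_iff_pow_eq_one, key _ hx, pow_orderOf_eq_one]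
  · rw [orderOf_dvd_iff_pow_eq_one, ← key _ hxz, pow_orderOf_eq_one]

end Groups

section Residue

variable {F : Type*} [Field F] [Fintype F]

theorem finite_quotient_span {L : F[X]} (hm : L.Monic) : Finite (F[X] ⧸ Ideal.span {L}) := by
  have := hm.finite_quotient
  exact Module.finite_of_finite F

theorem isUnit_natCast {A : Type*} [CommRing A] [Algebra F[X] A] {m : ℕ}
    (h : (ringChar F).Coprime m) : IsUnit (m : A) := by
  have : Fact (ringChar F).Prime := ⟨CharP.char_is_prime F _⟩
  have h1 : (m : F) ≠ 0 := by
    rw [Ne, ringChar.spec]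
    exact (Nat.Prime.coprime_iff_not_dvd this.out).1 h
  have h2 := (IsUnit.mk0 _ h1).map ((algebraMap F[X] A).comp Polynomial.C)
  rwa [map_natCast] at h2

theorem charP_of_algebra (A : Type*) [CommRing A] [Nontrivial A] [Algebra F[X] A] :
    CharP A (ringChar F) :=
  charP_of_injective_ringHom ((algebraMap F[X] A).comp Polynomial.C).injective _

theorem coprime_card_units (A : Type*) [Field A] [Finite A] [Algebra F[X] A] :
    (ringChar F).Coprime (Nat.card Aˣ) := by
  have := Fintype.ofFinite A
  have := charP_of_algebra (F := F) A
  have : Fact (ringChar F).Prime := ⟨CharP.char_is_prime F _⟩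
  obtain ⟨n, hn, hc⟩ := FiniteField.card A (ringChar F)
  rw [Nat.card_units, Nat.card_eq_fintype_card, hc]
  have h2 : 1 ≤ ringChar F ^ (n : ℕ) := Nat.one_le_pow _ _ this.out.pos
  refine ((Nat.coprime_self_sub_right h2).2 (Nat.coprime_one_right _)).coprime_dvd_left ?_
  exact dvd_pow_self _ n.ne_zero

end Residue

section Inertia

variable {F : Type*} [Field F] [Fintype F] {ϖ : Omega F} (hϖ : IsCarlitzPeriod ϖ) {M : F[X]}
  (hM : M.Monic) (hodd : ringChar F ≠ 2)
  {E : IntermediateField (cyclotomicField ϖ M) (Omega F)}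
  [FiniteDimensional (RatFunc F) E] [IsGalois (RatFunc F) E]
  {L N : F[X]} {r : ℕ} (hL : Irreducible L) (hm : L.Monic) (hMN : M = L ^ (r + 1) * N)
  (hLN : ¬ L ∣ N) {𝔓 : Ideal (integralClosure F[X] E)} (h𝔓 : 𝔓.under F[X] = Ideal.span {L})

include hM hMN hm in
theorem monic_cofactor : N.Monic := (hm.pow (r + 1)).of_mul_monic_left (hMN ▸ hM)

include hϖ hM hodd hL hm hMN hLN h𝔓 in
/-- Let `χ` be the character of `Gal(K/k)` that describes its action on the `L ^ (r + 1)`-torsion, and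
let `χ'` be its inflation to the inertia group at `L`. Then `χ'` is surjective, its kernel has `e_L`
elements, and, because inertia acts trivially on the `N`-torsion, it determines the restriction of an
element of the inertia group to `K`. -/
theorem exists_inertia_character [𝔓.IsPrime] :
    ∃ χ : Gal(cyclotomicField ϖ M/RatFunc F) →* (F[X] ⧸ Ideal.span {L ^ (r + 1)})ˣ,
    ∃ χ' : inertiaGroup (RatFunc F) 𝔓 →* (F[X] ⧸ Ideal.span {L ^ (r + 1)})ˣ,
      (∀ σ c, σ (torsK hϖ M 1) = torsK hϖ M c →
        (χ σ : F[X] ⧸ Ideal.span {L ^ (r + 1)}) = Ideal.Quotient.mk _ c) ∧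
      (∀ g σ, IsLifting σ g.1 → χ' g = χ σ) ∧
      Function.Surjective χ' ∧ Nat.card χ'.ker = ramIndex (cyclotomicField ϖ M) 𝔓 ∧
      (∀ σ c, σ (torsK hϖ M 1) = torsK hϖ M c → N ∣ c - 1 → χ σ = 1 → σ = 1) ∧
      ∀ g σ c, σ (torsK hϖ M 1) = torsK hϖ M c → N ∣ c - 1 → χ' g = χ σ → IsLifting σ g.1 := by
  have := isGalois_cyclotomicField hϖ hM
  have := finiteDimensional_cyclotomicField hϖ hM
  have hN := monic_cofactor hM hm hMN
  have hcop : IsCoprime (L ^ (r + 1)) N := ((hL.coprime_iff_not_dvd).2 hLN).pow_left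
  obtain ⟨χ, hχ⟩ := exists_unitHom hϖ hM (D := L ^ (r + 1)) ⟨N, hMN⟩
  have hinj : ∀ σ c, σ (torsK hϖ M 1) = torsK hϖ M c → N ∣ c - 1 → χ σ = 1 → σ = 1 := by
    intro σ c hc hNc h1
    refine galois_ext hϖ ?_
    rw [hc, AlgEquiv.one_apply, torsK_eq_iff hϖ hM.ne_zero, hMN]
    refine hcop.mul_dvd ?_ hNc
    have h2 := hχ σ c hc
    rw [h1, Units.val_one, ← map_one (Ideal.Quotient.mk _), eq_comm, Ideal.Quotient.eq,
      Ideal.mem_span_singleton] at h2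
    exact h2
  let χ' : inertiaGroup (RatFunc F) 𝔓 →* (F[X] ⧸ Ideal.span {L ^ (r + 1)})ˣ :=
    (χ.comp (AlgEquiv.restrictNormalHom (cyclotomicField ϖ M))).comp (Subgroup.subtype _)
  have hχ' : ∀ g σ, IsLifting σ g.1 → χ' g = χ σ := fun g σ h =>
    congrArg χ (isLifting_iff.1 h)
  have hex : ∀ g : inertiaGroup (RatFunc F) 𝔓, ∃ σ : Gal(cyclotomicField ϖ M/RatFunc F), ∃ c,
      IsLifting σ g.1 ∧ σ (torsK hϖ M 1) = torsK hϖ M c ∧ N ∣ c - 1 := by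
    intro g
    obtain ⟨c, -, hc⟩ := exists_galois_torsK hϖ hM (g.1.restrictNormal (cyclotomicField ϖ M))
    have hc1 := hc 1
    rw [mul_one] at hc1
    exact ⟨_, c, isLifting_restrictNormal g.1, hc1, dvd_sub_one_of_mem_inertia hϖ hM hodd
      (hm.pow (r + 1)).ne_zero hN (hMN.trans (mul_comm _ _)) hLN h𝔓 g.2
      (isLifting_restrictNormal g.1) hc1⟩
  have hlift : ∀ g σ c, σ (torsK hϖ M 1) = torsK hϖ M c → N ∣ c - 1 → χ' g = χ σ →
      IsLifting σ g.1 := by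
    intro g σ c hc hNc h
    obtain ⟨σ', c', hl, hc', hNc'⟩ := hex g
    obtain ⟨χN, hχN⟩ := exists_unitHom hϖ hM (D := N) ⟨L ^ (r + 1), hMN.trans (mul_comm _ _)⟩
    have hN1 : ∀ σ c, σ (torsK hϖ M 1) = torsK hϖ M c → N ∣ c - 1 → χN σ = 1 := by
      intro σ c h1 h2
      refine Units.ext ?_
      rw [hχN σ c h1, Units.val_one, ← map_one (Ideal.Quotient.mk _), Ideal.Quotient.eq,
        Ideal.mem_span_singleton]
      exact h2
    have h1 : χ (σ * σ'⁻¹) = 1 := by rw [map_mul, map_inv, ← h, hχ' g σ' hl, mul_inv_cancel]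
    have h2 : χN (σ * σ'⁻¹) = 1 := by
      rw [map_mul, map_inv, hN1 σ c hc hNc, hN1 σ' c' hc' hNc', inv_one, mul_one]
    obtain ⟨d, -, hd⟩ := exists_galois_torsK hϖ hM (σ * σ'⁻¹)
    have hd1 := hd 1
    rw [mul_one] at hd1
    have h3 := hχN _ d hd1
    rw [h2, Units.val_one, ← map_one (Ideal.Quotient.mk _), eq_comm, Ideal.Quotient.eq,
      Ideal.mem_span_singleton] at h3
    rwa [mul_inv_eq_one.1 (hinj _ d hd1 h3 h1)]
  have hone : (1 : Gal(cyclotomicField ϖ M/RatFunc F)) (torsK hϖ M 1) = torsK hϖ M 1 := rfl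
  have hker : ∀ g, χ' g = 1 ↔ IsLifting (1 : Gal(cyclotomicField ϖ M/RatFunc F)) g.1 := fun g =>
    ⟨fun h => hlift g 1 1 hone (by simp) (by rw [h, map_one]), fun h => by rw [hχ' g 1 h, map_one]⟩
  have h0 : 𝔓.under F[X] ≠ ⊥ := by
    rw [h𝔓, Ne, Ideal.span_singleton_eq_bot]
    exact hm.ne_zero
  have hfin : Finite (F[X] ⧸ 𝔓.under F[X]) := by
    rw [h𝔓]
    exact finite_quotient_span hm
  obtain ⟨ht1, ht2⟩ := card_inertia_tower (R := F[X]) (k := RatFunc F)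
    (K := cyclotomicField ϖ M) 𝔓 h0
  have hcard : Nat.card χ'.ker = ramIndex (cyclotomicField ϖ M) 𝔓 := by
    rw [← ht1]
    exact card_inertia_top 𝔓 χ' hker
  refine ⟨χ, χ', hχ, hχ', ?_, hcard, hinj, hlift⟩
  -- Surjectivity follows by counting: the inertia group has `e(𝔭) * e_L` elements, where `𝔭` is the
  -- prime of `K` below `𝔓`, and `e(𝔭)` is at least the number of units modulo `L ^ (r + 1)`.
  obtain ⟨hfinU, hU⟩ := card_units_quotient_le hL hm (Nat.succ_ne_zero r)
  let 𝔭 := 𝔓.comap (IsScalarTower.toAlgHom F[X] (cyclotomicField ϖ M) E).mapIntegralClosure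
  have h𝔭 : 𝔭.under F[X] = Ideal.span {L} := by
    rw [← h𝔓]
    ext x
    rfl
  have hle := hU.trans (card_le_ramificationIdx hϖ hM hodd hL hm hMN 𝔭 h𝔭)
  have h1 := card_inertiaGroup (k := RatFunc F) 𝔓 h0
  have h2 := χ'.ker.card_mul_index
  rw [Subgroup.index_ker, h1, ht2, hcard, mul_comm] at h2
  have hpos : 0 < ramIndex (cyclotomicField ϖ M) 𝔓 := hcard ▸ Nat.card_pos
  have h3 : Nat.card χ'.range = 𝔭.ramificationIdx F[X] := Nat.eq_of_mul_eq_mul_right hpos h2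
  rw [← MonoidHom.range_eq_top]
  exact Subgroup.eq_top_of_le_card _ (h3 ▸ hle)

end Inertia

end

/-! ### The structure of the inertia group -/

section

attribute [local instance] smulCommClass_galois

section Inertia

variable {F : Type*} [Field F] [Fintype F]

theorem finite_quotient_of_under (A : Type*) {B : Type*} [CommRing A] [CommRing B] [Algebra A B]
    [Module.Finite A B] (I : Ideal B) [Finite (A ⧸ I.under A)] : Finite (B ⧸ I) :=
  Module.finite_of_finite (A ⧸ I.under A)

/-- If `a` generates `(𝔸/L)^*`, which contains `F^*`, then its order modulo `L ^ r` is divisible by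
`q - 1`. -/
theorem dvd_orderOf_of_generates {γ : Fˣ} (hγ : ∀ x : Fˣ, x ∈ Subgroup.zpowers γ) {L a : F[X]}
    (hL : Irreducible L) {r : ℕ} (hr : r ≠ 0) {s : (F[X] ⧸ Ideal.span {L ^ r})ˣ}
    (hs : (s : F[X] ⧸ Ideal.span {L ^ r}) = Ideal.Quotient.mk _ a)
    (hgen : ∀ b : F[X], ¬ L ∣ b → ∃ n : ℕ, L ∣ b - a ^ n) :
    Fintype.card F - 1 ∣ orderOf s := by
  rw [← orderOf_generator hγ]
  obtain ⟨n, hn⟩ := hgen (Polynomial.C γ.1) fun h =>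
    hL.not_isUnit (isUnit_of_dvd_unit h (Polynomial.isUnit_C.2 γ.isUnit))
  rw [orderOf_dvd_iff_pow_eq_one]
  have h1 : L ∣ a ^ orderOf s - 1 := by
    have h2 : (s : F[X] ⧸ Ideal.span {L ^ r}) ^ orderOf s = 1 := by
      rw [← Units.val_pow_eq_pow_val, pow_orderOf_eq_one, Units.val_one]
    rw [hs, ← map_pow, ← map_one (Ideal.Quotient.mk _), Ideal.Quotient.eq,
      Ideal.mem_span_singleton] at h2
    exact (dvd_pow_self L hr).trans h2
  have h2 : L ∣ Polynomial.C (γ.1 ^ orderOf s - 1) := by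
    have h3 : L ∣ Polynomial.C γ.1 ^ orderOf s - (a ^ n) ^ orderOf s :=
      hn.trans (sub_dvd_pow_sub_pow _ _ _)
    have h4 : L ∣ (a ^ n) ^ orderOf s - 1 := by
      rw [← pow_mul, mul_comm, pow_mul]
      exact h1.trans (sub_one_dvd_pow_sub_one _ _)
    have h5 := dvd_add h3 h4
    rwa [sub_add_sub_cancel, ← Polynomial.C_pow, ← Polynomial.C_1, ← Polynomial.C_sub] at h5
  by_contra hne
  refine hL.not_isUnit (isUnit_of_dvd_unit h2 (Polynomial.isUnit_C.2 (IsUnit.mk0 _ ?_)))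
  rw [sub_ne_zero]
  exact fun h => hne (Units.ext (by rw [Units.val_pow_eq_pow_val, h, Units.val_one]))

theorem exists_mul_inv_pow_mem_oneUnits {L a : F[X]} (hL : Irreducible L) {r : ℕ} (hr : r ≠ 0)
    {s : (F[X] ⧸ Ideal.span {L ^ r})ˣ}
    (hs : (s : F[X] ⧸ Ideal.span {L ^ r}) = Ideal.Quotient.mk _ a)
    (hgen : ∀ b : F[X], ¬ L ∣ b → ∃ n : ℕ, L ∣ b - a ^ n) (u : (F[X] ⧸ Ideal.span {L ^ r})ˣ) :
    ∃ i : ℕ, u * (s ^ i)⁻¹ ∈ oneUnits L r := by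
  obtain ⟨b, hb⟩ := Ideal.Quotient.mk_surjective (u : F[X] ⧸ Ideal.span {L ^ r})
  obtain ⟨i, hi⟩ := hgen b (not_dvd_of_unit hL hr u hb.symm)
  refine ⟨i, ?_⟩
  obtain ⟨c, hc⟩ := Ideal.Quotient.mk_surjective
    ((u * (s ^ i)⁻¹ : (F[X] ⧸ Ideal.span {L ^ r})ˣ) : F[X] ⧸ Ideal.span {L ^ r})
  rw [mem_oneUnits_iff hr hc.symm]
  have h1 : Ideal.Quotient.mk (Ideal.span {L ^ r}) (c * a ^ i) = Ideal.Quotient.mk _ b := by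
    rw [map_mul, map_pow, ← hs, hc, hb, ← Units.val_pow_eq_pow_val, ← Units.val_mul,
      inv_mul_cancel_right]
  rw [Ideal.Quotient.eq, Ideal.mem_span_singleton] at h1
  have h2 : L ∣ (c - 1) * a ^ i := by
    have h3 := dvd_add ((dvd_pow_self L hr).trans h1) hi
    convert h3 using 1
    ring
  refine (hL.prime.dvd_or_dvd h2).resolve_right fun h => ?_
  exact not_dvd_of_unit hL hr s hs (hL.prime.dvd_of_dvd_pow h)

theorem exists_pow_eq_one_of_mem_oneUnits {L : F[X]} {r : ℕ} (hr : r ≠ 0)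
    {u : (F[X] ⧸ Ideal.span {L ^ r})ˣ} (hu : u ∈ oneUnits L r) :
    ∃ t : ℕ, u ^ ringChar F ^ t = 1 := by
  obtain ⟨c, hc⟩ := Ideal.Quotient.mk_surjective (u : F[X] ⧸ Ideal.span {L ^ r})
  obtain ⟨t, ht⟩ := exists_dvd_pow_sub_one ((mem_oneUnits_iff hr hc.symm).1 hu) r
  refine ⟨t, Units.ext ?_⟩
  rw [Units.val_pow_eq_pow_val, ← hc, ← map_pow, Units.val_one, ← map_one (Ideal.Quotient.mk _),
    Ideal.Quotient.eq, Ideal.mem_span_singleton]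
  exact ht

theorem pow_eq_one_of_dvd {L a : F[X]} {r m : ℕ} {s : (F[X] ⧸ Ideal.span {L ^ r})ˣ}
    (hs : (s : F[X] ⧸ Ideal.span {L ^ r}) = Ideal.Quotient.mk _ a) (h : L ^ r ∣ a ^ m - 1) :
    s ^ m = 1 := by
  refine Units.ext ?_
  rw [Units.val_pow_eq_pow_val, hs, ← map_pow, Units.val_one, ← map_one (Ideal.Quotient.mk _),
    Ideal.Quotient.eq, Ideal.mem_span_singleton]
  exact h

variable {ϖ : Omega F} (hϖ : IsCarlitzPeriod ϖ) {M : F[X]}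
  (hM : M.Monic) (hodd : ringChar F ≠ 2)
  {E : IntermediateField (cyclotomicField ϖ M) (Omega F)}
  [FiniteDimensional (RatFunc F) E] [IsGalois (RatFunc F) E]
  {L N : F[X]} {r : ℕ} (hL : Irreducible L) (hm : L.Monic) (hMN : M = L ^ (r + 1) * N)
  (hLN : ¬ L ∣ N) {𝔓 : Ideal (integralClosure F[X] E)} (h𝔓 : 𝔓.under F[X] = Ideal.span {L})

/-- The first ramification group has no nontrivial elements of order prime to `p`. -/
theorem eq_one_of_mem_ramificationGroup_one [𝔓.IsPrime] {g : Gal(E/RatFunc F)}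
    (hg : g ∈ ramificationGroup (RatFunc F) 𝔓 1) {m : ℕ} (hm : (ringChar F).Coprime m)
    (h : g ^ m = 1) : g = 1 := by
  have := integralClosure.isDedekindDomain F[X] (RatFunc F) E
  have := isGaloisGroup_integralClosure (R := F[X]) (k := RatFunc F) (E := E)
  have := IsGaloisGroup.faithful (G := Gal(E/RatFunc F)) F[X] (B := integralClosure F[X] E)
  refine eq_of_smul_eq_smul (α := integralClosure F[X] E) fun x => ?_
  rw [one_smul]
  exact smul_eq_of_mem_inertia_sq 𝔓 hg h (isUnit_natCast hm) x

include h𝔓 hm in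
theorem exists_tame_character_inertiaGroup [h : 𝔓.IsPrime] :
    Finite (integralClosure F[X] E ⧸ 𝔓)ˣ ∧ (ringChar F).Coprime
      (Nat.card (integralClosure F[X] E ⧸ 𝔓)ˣ) ∧
    ∃ θ : inertiaGroup (RatFunc F) 𝔓 →* (integralClosure F[X] E ⧸ 𝔓)ˣ,
      ∀ g, θ g = 1 ↔ g.1 ∈ ramificationGroup (RatFunc F) 𝔓 1 := by
  have := integralClosure.isDedekindDomain F[X] (RatFunc F) E
  have := isTorsionFree_integralClosure (R := F[X]) (E := E) (RatFunc F)
  have := IsIntegralClosure.finite F[X] (RatFunc F) E (integralClosure F[X] E)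
  have hp : Fact (ringChar F).Prime := ⟨CharP.char_is_prime F _⟩
  have hbot : 𝔓 ≠ ⊥ := by
    rintro rfl
    rw [Ideal.under_def, Ideal.comap_bot_of_injective _
      (FaithfulSMul.algebraMap_injective F[X] (integralClosure F[X] E)), eq_comm,
      Ideal.span_singleton_eq_bot] at h𝔓
    exact hm.ne_zero h𝔓
  have hmax : 𝔓.IsMaximal := h.isMaximal hbot
  have hfin : Finite (integralClosure F[X] E ⧸ 𝔓) := by
    have : Finite (F[X] ⧸ 𝔓.under F[X]) := by
      rw [h𝔓]
      exact finite_quotient_span hm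
    exact finite_quotient_of_under F[X] 𝔓
  have hchar : CharP (integralClosure F[X] E) (ringChar F) := charP_of_algebra (F := F) _
  refine ⟨inferInstance, ?_, exists_tame_character 𝔓 (ringChar F) hbot⟩
  let _ := Ideal.Quotient.field 𝔓
  exact coprime_card_units (F := F) (integralClosure F[X] E ⧸ 𝔓)

include hϖ hM hodd hL hm hMN hLN h𝔓 in
/-- The structure of the inertia group at `L`, for an extension `E` of the cyclotomic field such
that the elements of `Gal(E/K)` have order dividing `q - 1`. -/
theorem inertia_structure [𝔓.IsPrime] {γ : Fˣ} (hγ : ∀ x : Fˣ, x ∈ Subgroup.zpowers γ)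
    (hpow : ∀ τ : Gal(E/RatFunc F), IsLifting (1 : Gal(cyclotomicField ϖ M/RatFunc F)) τ →
      τ ^ (Fintype.card F - 1) = 1)
    (hcen : ∀ τ : Gal(E/RatFunc F), IsLifting (1 : Gal(cyclotomicField ϖ M/RatFunc F)) τ →
      ∀ g, τ * g = g * τ)
    {σ : Gal(cyclotomicField ϖ M/RatFunc F)} {a : F[X]}
    (hσ : σ (torsK hϖ M 1) = torsK hϖ M a) (hNa : N ∣ a - 1)
    (ha : L ^ (r + 1) ∣ a ^ (Fintype.card F ^ L.natDegree - 1) - 1)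
    (hgen : ∀ b : F[X], ¬ L ∣ b → ∃ n : ℕ, L ∣ b - a ^ n) :
    Nonempty (ramificationGroup (RatFunc F) 𝔓 1 ≃* oneUnits L (r + 1)) ∧
    (∃ τ : Gal(E/RatFunc F),
      IsLifting σ τ ∧ inertiaLiftings σ 𝔓 = Subgroup.zpowers τ) ∧
    ramificationGroup (RatFunc F) 𝔓 1 ⊔ inertiaLiftings σ 𝔓 = inertiaGroup (RatFunc F) 𝔓 ∧
    Disjoint (ramificationGroup (RatFunc F) 𝔓 1) (inertiaLiftings σ 𝔓) ∧
    (∀ τ₁ ∈ ramificationGroup (RatFunc F) 𝔓 1, ∀ τ₂ ∈ inertiaLiftings σ 𝔓,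
      τ₁ * τ₂ = τ₂ * τ₁) ∧
    ∀ τ : Gal(E/RatFunc F), IsLifting σ τ →
      orderOf τ = ramIndex (cyclotomicField ϖ M) 𝔓 * orderOf σ := by
  have := isGalois_cyclotomicField hϖ hM
  have hr := Nat.succ_ne_zero r
  obtain ⟨χ, χ', hχ, hχ', hsurj, hcard, hinj, hlift⟩ :=
    exists_inertia_character hϖ hM hodd hL hm hMN hLN h𝔓
  obtain ⟨_, hcop, θ, hθ⟩ := exists_tame_character_inertiaGroup hm h𝔓
  have hs := hχ σ a hσ
  have hone : (1 : Gal(cyclotomicField ϖ M/RatFunc F)) (torsK hϖ M 1) = torsK hϖ M 1 := rfl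
  have hσpow : ∀ i : ℕ, (σ ^ i) (torsK hϖ M 1) = torsK hϖ M (a ^ i) := by
    intro i
    induction i with
    | zero => rfl
    | succ i ih =>
      rw [pow_succ', AlgEquiv.mul_apply, ih, galois_torsK_of_one hϖ hσ, pow_succ']
  have hNpow : ∀ i : ℕ, N ∣ a ^ i - 1 := fun i => hNa.trans (sub_one_dvd_pow_sub_one _ _)
  have hfin := (card_units_quotient_le hL hm hr).1
  have D : TameData (inertiaGroup (RatFunc F) 𝔓) (ramificationGroup (RatFunc F) 𝔓 1)
      (inertiaLiftings σ 𝔓) (ringChar F) (Fintype.card F - 1) (Fintype.card F ^ L.natDegree - 1)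
      θ χ' (oneUnits L (r + 1)) (χ σ) :=
    { prime := CharP.char_is_prime F _
      le := fun g hg x => Ideal.pow_le_self two_ne_zero (hg x)
      card := hcop
      tame := hθ
      wild := fun g hg m hm' h => eq_one_of_mem_ramificationGroup_one hg hm' h
      surj := hsurj
      pow := fun g hg => hpow _ (hlift g 1 1 hone (by simp) (by rw [hg, map_one]))
      coprime := by simpa using coprime_ringChar_card_pow_sub_one (F := F) one_ne_zero
      powU := fun u hu => exists_pow_eq_one_of_mem_oneUnits hr hu
      coprime' := coprime_ringChar_card_pow_sub_one hL.natDegree_pos.ne'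
      pow_s := pow_eq_one_of_dvd hs ha
      exists_s := exists_mul_inv_pow_mem_oneUnits hL hr hs hgen
      mem := fun g => by
        constructor
        · rintro ⟨⟨σ', ⟨i, rfl⟩, hg⟩, hI⟩
          refine ⟨hI, ?_⟩
          rw [hχ' ⟨g, hI⟩ _ hg]
          exact ⟨i, (map_zpow χ σ i).symm⟩
        · rintro ⟨hI, h⟩
          refine ⟨?_, hI⟩
          rw [← mem_powers_iff_mem_zpowers] at h
          obtain ⟨i, hi⟩ := h
          exact ⟨σ ^ i, Subgroup.npow_mem_zpowers σ i, hlift ⟨g, hI⟩ (σ ^ i) (a ^ i) (hσpow i)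
            (hNpow i) (by rw [map_pow]; exact hi.symm)⟩ }
  obtain ⟨τ, hτI, hτ, hH, hord⟩ := D.exists_generator
  have hτσ := hlift ⟨τ, hτI⟩ σ a hσ hNa hτ
  refine ⟨D.nonempty_mulEquiv, ⟨τ, hτσ, hH⟩, D.sup_eq, D.disjoint,
    fun τ₁ h₁ τ₂ h₂ => D.commute h₁ h₂, fun τ' hτ' => ?_⟩
  -- All liftings of `σ` have the same order: they differ from `τ` by central elements of order
  -- dividing `q - 1`, and `q - 1` divides the order of `σ`.
  have hordσ : orderOf (χ σ) = orderOf σ := by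
    refine orderOf_eq_orderOf_iff.2 fun i => ⟨fun h => ?_, fun h => ?_⟩
    · exact hinj _ _ (hσpow i) (hNpow i) (by rw [map_pow, h])
    · rw [← map_pow, h, map_one]
  have hdvd : ∀ g : Gal(E/RatFunc F), IsLifting σ g → orderOf σ ∣ orderOf g := fun g hg => by
    rw [← isLifting_iff.1 hg]
    exact orderOf_map_dvd _ g
  have hz : IsLifting (1 : Gal(cyclotomicField ϖ M/RatFunc F)) (τ⁻¹ * τ') := by
    rw [← inv_mul_cancel σ]
    exact hτσ.inv.mul hτ'
  have hτ'' : τ' = τ * (τ⁻¹ * τ') := (mul_inv_cancel_left τ τ').symm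
  have hzo : (τ⁻¹ * τ') ^ orderOf σ = 1 := by
    obtain ⟨j, hj⟩ := dvd_orderOf_of_generates hγ hL hr hs hgen
    rw [← hordσ, hj, pow_mul, hpow _ hz, one_pow]
  rw [← hcard, ← hordσ, ← hord, hτ'']
  exact orderOf_mul_eq_left (hcen _ hz τ).symm (hdvd τ hτσ) (hτ'' ▸ hdvd τ' hτ') hzo

end Inertia

end

end QuasiCyclotomic

end

open QuasiCyclotomic in
theorem proposition2p3 {F : Type*} [Field F] [Fintype F] (hodd : ringChar F ≠ 2)
    -- a generator `γ` of `F_q^*`, a period `ϖ` of the Carlitz module, a `(q-1)`-th root of `-1`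
    (γ : Fˣ) (hγ : ∀ x : Fˣ, x ∈ Subgroup.zpowers γ)
    (ϖ : Omega F) (hϖ : IsCarlitzPeriod ϖ)
    (ρ : Omega F) (hρ : ρ ^ (Fintype.card F - 1) = -1)
    -- the conductor `M` and two distinct monic prime factors `P`, `Q` of it
    (M : F[X]) (hM : M.Monic) (P Q : F[X])
    (hP : P ∈ monicPrimeFactors M) (hQ : Q ∈ monicPrimeFactors M) (hPQ : P ≠ Q)
    (sP sQ : Omega F) (hsP : sP ^ 2 = algebraMap F[X] (Omega F) P)
    (hsQ : sQ ^ 2 = algebraMap F[X] (Omega F) Q)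
    -- a `(q-1)`-th root `y` of `u_{PQ}`, so that `kummerField ϖ M y` is the field `K̃ = K(y)`
    (y : Omega F) (hy : y ^ (Fintype.card F - 1) = uPQ ϖ ρ γ P Q sP sQ)
    -- a monic prime factor `L` of `M`, with exponent `r`, and the element `σ_L` of `Gal(K/k)`
    (L : F[X]) (hL : L ∈ monicPrimeFactors M) (r : ℕ) (hr : L ^ r ∣ M) (hr' : ¬ L ^ (r + 1) ∣ M)
    (σL : Gal(cyclotomicField ϖ M/RatFunc F)) (hσL : IsSigma ϖ M L r σL)
    -- a prime `𝔓` of `K̃` above `L`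
    (𝔓 : Ideal (integralClosure F[X] (kummerField ϖ M y))) (h𝔓 : 𝔓.IsPrime)
    (h𝔓L : 𝔓.LiesOver (Ideal.span {L})) :
    -- `G̃_1 ≅ (𝔸/L^r)^{(1)}`
    Nonempty (ramificationGroup (RatFunc F) 𝔓 1 ≃* oneUnits L r) ∧
    -- `G̃_L` is cyclic, generated by a lifting of `σ_L`
    (∃ τ : Gal(kummerField ϖ M y/RatFunc F),
      IsLifting σL τ ∧ inertiaLiftings σL 𝔓 = Subgroup.zpowers τ) ∧
    -- `Ĩ_L` is the internal direct product of `G̃_1` and `G̃_L`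
    ramificationGroup (RatFunc F) 𝔓 1 ⊔ inertiaLiftings σL 𝔓 = inertiaGroup (RatFunc F) 𝔓 ∧
    Disjoint (ramificationGroup (RatFunc F) 𝔓 1) (inertiaLiftings σL 𝔓) ∧
    (∀ τ₁ ∈ ramificationGroup (RatFunc F) 𝔓 1, ∀ τ₂ ∈ inertiaLiftings σL 𝔓,
      τ₁ * τ₂ = τ₂ * τ₁) ∧
    -- every lifting of `σ_L` has order `e_L · ord(σ_L)`
    ∀ τ : Gal(kummerField ϖ M y/RatFunc F), IsLifting σL τ →
      orderOf τ = ramIndex (cyclotomicField ϖ M) 𝔓 * orderOf σL := by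
  have hq1 : 0 < Fintype.card F - 1 := Nat.sub_pos_of_lt Fintype.one_lt_card
  have hn : NeZero (Fintype.card F - 1) := ⟨hq1.ne'⟩
  have hρ0 : ρ ≠ 0 := by
    rintro rfl
    rw [zero_pow hq1.ne'] at hρ
    exact neg_ne_zero.2 one_ne_zero hρ.symm
  obtain ⟨u, hu0, hu, hσ⟩ := exists_uPQ_mem hodd hϖ hρ0 hγ hM hP hQ hPQ hsP hsQ
  have hζ : IsPrimitiveRoot (RatFunc.C γ.1 : RatFunc F) (Fintype.card F - 1) := by
    have h1 : IsPrimitiveRoot γ (Fintype.card F - 1) :=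
      orderOf_generator hγ ▸ IsPrimitiveRoot.orderOf γ
    exact (IsPrimitiveRoot.coe_units_iff.2 h1).map_of_injective (RatFunc.C (K := F)).injective
  set yE : kummerField ϖ M y := IntermediateField.AdjoinSimple.gen (cyclotomicField ϖ M) y
    with hyE
  have hE : IntermediateField.adjoin (cyclotomicField ϖ M) {yE} = ⊤ := by
    apply IntermediateField.lift_injective
    rw [IntermediateField.lift_adjoin_simple, IntermediateField.lift_top]
    rfl
  have hyu : yE ^ (Fintype.card F - 1) = algebraMap _ (kummerField ϖ M y) u :=
    Subtype.ext (hy.trans hu.symm)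
  have hσ' : ∀ σ : Gal(cyclotomicField ϖ M/RatFunc F), ∃ z, σ u = u * z ^ (Fintype.card F - 1) :=
    fun σ => (hσ σ).imp fun z hz => hz.2
  have := isGalois_cyclotomicField hϖ hM
  have := finiteDimensional_cyclotomicField hϖ hM
  have := finiteDimensional_kummer hζ hyu hE
  have := isGalois_kummer hζ hu0 hyu hE hσ'
  obtain ⟨hLm, hLi, hLM⟩ := hL
  obtain ⟨a, N, hMN, ha, hNa, haL, hgen⟩ := hσL
  have hLN : ¬ L ∣ N := by
    rintro ⟨c, rfl⟩
    exact hr' ⟨c, by rw [hMN, pow_succ, mul_assoc]⟩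
  obtain ⟨r, rfl⟩ : ∃ r', r = r' + 1 := by
    refine Nat.exists_eq_succ_of_ne_zero ?_
    rintro rfl
    rw [pow_zero, one_mul] at hMN
    exact hLN (hMN ▸ hLM)
  exact inertia_structure hϖ hM hodd hLi hLm hMN hLN h𝔓L.over.symm hγ
    (fun τ hτ => pow_eq_one_of_isLifting_one hζ hu0 hyu hE hτ)
    (fun τ hτ => mul_comm_of_isLifting_one hζ hu0 hyu hE hσ' hτ) (Subtype.ext ha) hNa haL hgen
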